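/- Let $I$ be a finite alphabet, $A$ an $I\times I$ matrix with entries $0,1$, and $\Sigma=\{z\in I^{\mathbb N}: a_{z_k z_{k+1}}=1 \text{ for all } k\ge 0\}$ with the left shift $\sigma$ and the distance $2^{-\min\{k:\,x_k\neq y_k\}}$. Put $C(n,w)=\{z\in\Sigma: z_k=w_k,\ 0\le k\le n\}$ ($n$-cylinders). Assume $\Sigma$ is topologically mixing: for all $a,b\in I$ and all large $n$ there is $z\in\Sigma$ with $z_0=a$, $z_n=b$. Write $S_n\psi=\sum_{j=0}^{n-1}\psi\circ\sigma^j$. A Borel probability $\nu$ on $\Sigma$ is a weak Gibbs measure for $\psi:\Sigma\to\mathbb R$ if all cylinders have positive measure and there are $P\in\mathbb R$, $c\ge 1$ and $1\le K_n\le K_{n+1}$ with $\frac1n\log K_n\to0$ such that, for every $n\geq 1$ and every $(n-1)$-cylinder $C$, $$\frac1{cK_n}\le\frac{\nu(C)}{\exp(-nP+S_n\psi(z))}\le cK_n\qquad\text{for } \nu\text{-a.e. } z\in C;$$ it is Gibbs if in addition $\sup_n K_n<\infty$ and this holds for all $z\in C$; "$\sigma$-Gibbs" means also $\sigma$-invariant.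 A $\sigma$-invariant probability $\nu$ is mixing if $\nu(B\cap\sigma^{-n}D)\to\nu(B)\nu(D)$ for all Borel $B,D$; $h_\nu$ is its entropy with respect to $\sigma$. For continuous $\psi$, the topological pressure is $$P_{top}(\psi)=\lim_{n\to\infty}\frac1n\log\sum_{C}\exp\Big(\sup_{z\in C}S_n\psi(z)\Big),$$ the sum being over all $n$-cylinders $C$; an equilibrium measure for $\psi$ is a $\sigma$-invariant probability maximizing $h_\nu+\int\psi\,d\nu$. For a finite atomless measure $\nu$ on $\Sigma$, the $\nu$-dimension of $E\subset \Sigma$ is $\mathrm{Dim}_\nu(E)=\inf\{\alpha\ge0: M_\alpha(E)=0\}$, where $$M_\alpha(E)=\lim_{\varepsilon\to0}\inf\Big\{\sum_i\nu(F_i)^\alpha: E\subset\bigcup_iF_i,\ F_i \text{ cylinders},\ \mathrm{diam}\,F_i\le\varepsilon\Big\},$$ the covers being countable. **Theorem A.** Let $\phi:\Sigma\to\mathbb R$ be continuous and let $\hat\mu$ be an atomless weak $\sigma$-Gibbs measure for $\phi$. Suppose that for every $0<t\le1$ there is a mixing weak $\sigma$-Gibbs measure for $t\phi$. Let $\hat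 P$ be a (nonempty) cylinder, $w\in\Sigma$, $(\ell_n)$ a sequence in $\mathbb N$ such that $$s=\lim_{n\to\infty}-\tfrac1n\log\hat\mu(C(\ell_n,w))$$ exists and is finite, and, if $\hat\mu$ is not Gibbs for $\phi$, suppose also $\limsup_n\ell_n/n<\infty$. Let $$W=W_\sigma(\hat P,\ell_n,w)=\{z\in\hat P:\ \sigma^k(z)\in C(\ell_k,w)\text{ for infinitely many }k\}.$$ Then: 1. $\mathrm{Dim}_{\hat\mu}(W)=T$, where $0<T\le1$ is a root of the equation $$P_{top}(t\phi)-tP_{top}(\phi)=st .$$ If $s>0$, then $T$ is the only real root; if $h_{\hat\mu}>0$, then $T$ is the only root in $[0,1]$. 2. If $\hat\mu$ is mixing, then (with $0/0=0$) $$T\ \ge\ \frac{P_{top}(\phi)-\int\phi\,d\hat\mu}{P_{top}(\phi)-\int\phi\,d\hat\mu+s}\ \ge\ \frac{h_{\hat\mu}}{h_{\hat\mu}+s}.$$ 3. If $\hat\mu$ is an equilibrium measure for $\phi$, then $P_{top}(\phi)-\int\phi\,d\hat\mu=h_{\hat\mu}$. 4. If $\hat\mu$ is mixing or is the unique equilibrium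 measure for $\phi$, and $v=\lim_n\ell_n/n$ exists and is finite, then for $\hat\mu$-a.e. $x$ one has $\lim_{n}-\frac1n\log\hat\mu(C(\ell_n,x))=v\,h_{\hat\mu}$. -/

import Mathlib

open MeasureTheory Filter Topology
open scoped ENNReal NNReal

/-- The one-sided topological Markov chain with `0`-`1` transition matrix `A`. -/
def MarkovShift {I : Type*} (A : Matrix I I (Fin 2)) : Type _ :=
  {z : ℕ → I // ∀ k, A (z k) (z (k + 1)) = 1}

namespace MarkovShift

variable {I : Type*} {A : Matrix I I (Fin 2)}

/-- The distance `d(x, y) = 2 ^ (-m)`, with `m` the least index at which `x` and `y` differ. -/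
noncomputable instance : MetricSpace (MarkovShift A) :=
  letI : UniformSpace I := ⊥
  haveI : DiscreteUniformity I := ⟨rfl⟩
  letI : MetricSpace (ℕ → I) := PiNat.metricSpaceOfDiscreteUniformity (E := fun _ => I)
    (fun _ => rfl)
  MetricSpace.induced (Subtype.val : MarkovShift A → ℕ → I) Subtype.val_injective inferInstance

theorem dist_def (x y : MarkovShift A) : dist x y = PiNat.dist.dist x.1 y.1 := rfl

noncomputable instance : MeasurableSpace (MarkovShift A) := borel _

instance : BorelSpace (MarkovShift A) := ⟨rfl⟩

/-- The left shift. -/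
def shift (A : Matrix I I (Fin 2)) (z : MarkovShift A) : MarkovShift A :=
  ⟨fun k => z.1 (k + 1), fun k => z.2 (k + 1)⟩

/-- The finite word `(z 0, …, z n)`. -/
def word (n : ℕ) (z : MarkovShift A) : Fin (n + 1) → I := fun k => z.1 k

/-- The `n`-cylinder of a word of length `n + 1`. -/
def wordCylinder {n : ℕ} (u : Fin (n + 1) → I) : Set (MarkovShift A) := {z | word n z = u}

/-- The `n`-cylinder `C(n, w)` containing the point `w`. -/
def cylinder (n : ℕ) (w : MarkovShift A) : Set (MarkovShift A) := wordCylinder (word n w)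

/-- The collection of all (nonempty) cylinders. -/
def cylinders (A : Matrix I I (Fin 2)) : Set (Set (MarkovShift A)) :=
  {F | ∃ (n : ℕ) (w : MarkovShift A), F = cylinder n w}

/-- Topological mixing of the chain. -/
def IsTopologicallyMixing (A : Matrix I I (Fin 2)) : Prop :=
  ∀ a b : I, ∃ N : ℕ, ∀ n ≥ N, ∃ w : MarkovShift A, w.1 0 = a ∧ w.1 n = b

/-- The set of points of `Phat` whose orbit hits, for infinitely many times `k`,
the target `C(ℓ k, w)` at time `k`. -/
def targetSet (Phat : Set (MarkovShift A)) (ℓ : ℕ → ℕ) (w : MarkovShift A) :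
    Set (MarkovShift A) :=
  {z | z ∈ Phat ∧ ∃ᶠ k in atTop, (shift A)^[k] z ∈ cylinder (ℓ k) w}

/-- The sequence whose limit is the topological pressure: the `n`-th term is
`(1 / n) * log (∑ exp (sup_{C(n, w)} (φ + φ ∘ σ + ⋯ + φ ∘ σ ^ (n - 1))))`, the sum being over
all words of length `n + 1` that occur in the chain. -/
noncomputable def pressureSeq (φ : MarkovShift A → ℝ) (n : ℕ) : ℝ :=
  (1 / (n : ℝ)) * Real.log (∑' u : Set.range (word (A := A) n),
    Real.exp (sSup (birkhoffSum (shift A) φ n '' wordCylinder (u : Fin (n + 1) → I))))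

/-- The topological pressure of a continuous potential (finite alphabet). -/
noncomputable def topPressure (φ : MarkovShift A → ℝ) : ℝ :=
  limUnder atTop (pressureSeq φ)

/-- The two-sided Gibbs inequality at `z`, for the cylinder `C(n, x)`, which is determined by
`n + 1` symbols. -/
def GibbsBound (μ : Measure (MarkovShift A)) (φ : MarkovShift A → ℝ) (P : ℝ) (K : ℕ → ℝ)
    (c : I → ℝ) (n : ℕ) (x z : MarkovShift A) : Prop :=
  1 / (c (x.1 0) * K (n + 1)) ≤
      μ.real (cylinder n x) /
        Real.exp (-((n + 1 : ℕ) : ℝ) * P + birkhoffSum (shift A) φ (n + 1) z) ∧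
    μ.real (cylinder n x) /
        Real.exp (-((n + 1 : ℕ) : ℝ) * P + birkhoffSum (shift A) φ (n + 1) z) ≤
      c (x.1 0) * K (n + 1)

/-- `μ` is a weak Gibbs measure for `φ`. Cylinders have positive measure: otherwise the
inequality, being required at almost every point of the cylinder, would say nothing. -/
def IsWeakGibbs (μ : Measure (MarkovShift A)) (φ : MarkovShift A → ℝ) : Prop :=
  IsProbabilityMeasure μ ∧ (∀ n x, 0 < μ (cylinder n x)) ∧
    ∃ (P : ℝ) (K : ℕ → ℝ) (c : I → ℝ),
      (∀ n, 1 ≤ K n ∧ K n ≤ K (n + 1)) ∧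
      Tendsto (fun n : ℕ => (1 / (n : ℝ)) * Real.log (K n)) atTop (𝓝 0) ∧
      (∀ i, 1 ≤ c i) ∧ BddAbove (Set.range c) ∧
      ∀ n x, ∀ᵐ z ∂μ, z ∈ cylinder n x → GibbsBound μ φ P K c n x z

/-- `μ` is a Gibbs measure for `φ`. -/
def IsGibbs (μ : Measure (MarkovShift A)) (φ : MarkovShift A → ℝ) : Prop :=
  IsProbabilityMeasure μ ∧
    ∃ (P : ℝ) (K : ℕ → ℝ) (c : I → ℝ),
      (∀ n, 1 ≤ K n ∧ K n ≤ K (n + 1)) ∧ BddAbove (Set.range K) ∧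
      (∀ i, 1 ≤ c i) ∧ BddAbove (Set.range c) ∧
      ∀ n x, ∀ z ∈ cylinder n x, GibbsBound μ φ P K c n x z

/-- `μ` is a weak `σ`-Gibbs measure for `φ`: weak Gibbs and shift-invariant. -/
def IsWeakSigmaGibbs (μ : Measure (MarkovShift A)) (φ : MarkovShift A → ℝ) : Prop :=
  IsWeakGibbs μ φ ∧ MeasurePreserving (shift A) μ μ

end MarkovShift

section Dimension

variable {X : Type*} [MetricSpace X]

/-- `M_{𝓕, ψ, ε}(E)`: infimum of `∑ ψ F` over the countable covers of `E` by members of `𝓕` of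
diameter at most `ε`. -/
noncomputable def caratheodoryPre (𝓕 : Set (Set X)) (ψ : Set X → ℝ≥0∞) (ε : ℝ) (E : Set X) :
    ℝ≥0∞ :=
  ⨅ (S : Set (Set X)) (_ : S.Countable) (_ : ∀ F ∈ S, F ∈ 𝓕 ∧ Metric.diam F ≤ ε)
    (_ : E ⊆ ⋃₀ S), ∑' F : S, ψ F

/-- `M_{𝓕, ψ}(E)`, the limit (supremum) of `M_{𝓕, ψ, ε}(E)` as `ε` decreases to `0`. -/
noncomputable def caratheodoryMass (𝓕 : Set (Set X)) (ψ : Set X → ℝ≥0∞) (E : Set X) : ℝ≥0∞ :=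
  ⨆ (ε : ℝ) (_ : 0 < ε), caratheodoryPre 𝓕 ψ ε E

/-- The `(𝓕, ψ)`-dimension of `E`, `inf {α ≥ 0 : M_{𝓕, ψ ^ α}(E) = 0}`. -/
noncomputable def caratheodoryDim (𝓕 : Set (Set X)) (ψ : Set X → ℝ≥0∞) (E : Set X) : ℝ≥0∞ :=
  ⨅ (α : ℝ≥0) (_ : caratheodoryMass 𝓕 (fun F => ψ F ^ (α : ℝ)) E = 0), (α : ℝ≥0∞)

end Dimension

/-- The `μ`-dimension of a subset of a topological Markov chain. -/
noncomputable def MarkovShift.muDim {I : Type*} {A : Matrix I I (Fin 2)}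
    (μ : Measure (MarkovShift A)) (E : Set (MarkovShift A)) : ℝ≥0∞ :=
  caratheodoryDim (MarkovShift.cylinders A) (fun F => μ F) E

section Entropy

variable {X : Type*} [MeasurableSpace X]

/-- `(1 / n) H_μ(ξ ∨ T⁻¹ ξ ∨ ⋯ ∨ T ^ (-(n - 1)) ξ)` for the finite partition into the level sets
of `ξ`. -/
noncomputable def partitionEntropySeq (T : X → X) (μ : Measure X) {k : ℕ} (ξ : X → Fin k)
    (n : ℕ) : ℝ :=
  (1 / (n : ℝ)) *
    ∑ u : Fin n → Fin k, Real.negMulLog (μ.real {x | ∀ i : Fin n, ξ (T^[(i : ℕ)] x) = u i})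

/-- The Kolmogorov-Sinai entropy of `T` with respect to an invariant probability `μ`: the
supremum over all finite measurable partitions of the entropy of `T` relative to the partition. -/
noncomputable def measureEntropy (T : X → X) (μ : Measure X) : ℝ≥0∞ :=
  ⨆ (k : ℕ) (ξ : X → Fin k) (_ : Measurable ξ),
    ENNReal.ofReal (limUnder atTop (partitionEntropySeq T μ ξ))

/-- (Strong) mixing of `μ` with respect to `T`. -/
def IsMixingMeasure (T : X → X) (μ : Measure X) : Prop :=
  MeasurePreserving T μ μ ∧ ∀ B C : Set X, MeasurableSet B → MeasurableSet C →
    Tendsto (fun n : ℕ => μ (B ∩ T^[n] ⁻¹' C)) atTop (𝓝 (μ B * μ C))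

end Entropy

namespace MarkovShift

variable {I : Type*} {A : Matrix I I (Fin 2)}

/-- The entropy of the shift (a finite number when the alphabet is finite). -/
noncomputable def entropy (μ : Measure (MarkovShift A)) : ℝ :=
  (measureEntropy (shift A) μ).toReal

/-- `μ` is an equilibrium measure for `φ` (finite alphabet, continuous `φ`): it maximizes
`h_ν + ∫ φ dν` among the shift-invariant probabilities `ν`. -/
def IsEquilibrium (μ : Measure (MarkovShift A)) (φ : MarkovShift A → ℝ) : Prop :=
  IsProbabilityMeasure μ ∧ MeasurePreserving (shift A) μ μ ∧
    ∀ ν : Measure (MarkovShift A), IsProbabilityMeasure ν → MeasurePreserving (shift A) ν ν →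
      entropy ν + ∫ z, φ z ∂ν ≤ entropy μ + ∫ z, φ z ∂μ

end MarkovShift

namespace MarkovShift

/-! ### Cylinders, the topology they generate, and the shift. -/

section Basic

variable {I : Type*} {A : Matrix I I (Fin 2)}

/-! Continuity of φ and positivity of cylinders turn the almost-everywhere Gibbs inequality into an
estimate at every point: μ(C(n,x)) equals exp(S_{n+1}φ(x) - (n+1)P) up to a factor e^{B+εn}, for
each ε > 0 (`IsUniformGibbs`). Summing over cylinders shows that P is the pressure. Write G(t) =
P_top(tφ) - tP; the claim is that the dimension is a root of G(t) = st.

Upper bound (`IsUniformGibbs.caratheodoryMass_targetSet_eq_zero`). The points hitting the target at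
time k are covered by (k+ℓ_k)-cylinders of measure about exp(S_kφ - kP - sk). The α-th powers of
these measures sum to about exp(k(G(α) - sα)), which is summable in k when G(α) < sα. Linear growth
of ℓ keeps the errors o(k); for a Gibbs measure this growth is automatic, since atomless Gibbs
measures of cylinders decay exponentially.

Lower bound (`exists_hitCylinder_lt`, `IsUncovered.exists_next`,
`IsUniformGibbs.le_muDim_targetSet`). If G(t) > st, the mixing weak Gibbs measure m for tφ gives an
n-cylinder C mass about μ(C)^t e^{-nG(t)}. Passing from a k-cylinder to the part of it that hits the
target costs only a factor e^{-stk} in μ^t, so mass distributed according to m stays below μ^t even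
after it is concentrated on the hitting part. No measure on W is constructed: given a family of
cylinders of small total weight ∑ μ(F)^t, a pigeonhole argument selects nested hitting cylinders,
none of them inside a member of the family. Their common point lies in W and is not covered.

Roots. G is continuous and nonincreasing, G(1) = 0, and G(0) is the topological entropy, positive
because the chain is mixing with at least two symbols. For s > 0 the root exists and is unique. For
s = 0 the number T is defined as the dimension itself, and the lower bound forces G(T) = 0. Jensen's
inequality gives G(t) ≥ (1-t)h with h = P - ∫φ dμ; this yields the lower estimate of T, and
uniqueness on [0,1] when h > 0.

Entropy. The Kolmogorov-Sinai theorem reduces h_μ to the partition by first symbols, where the Gibbs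
estimate gives h_μ = P - ∫φ dμ for every invariant weak Gibbs measure. So item 3 and the second
inequality of item 2 become identities. Item 4 is Birkhoff's theorem applied to φ; under uniqueness,
ergodicity holds because conditioning μ on an invariant set gives another equilibrium measure. -/

theorem mem_cylinder_iff {n : ℕ} {z w : MarkovShift A} :
    z ∈ cylinder n w ↔ ∀ k ≤ n, z.1 k = w.1 k := by
  simp only [cylinder, wordCylinder, word, Set.mem_ofPred_eq, funext_iff]
  exact ⟨fun h k hk => h ⟨k, Nat.lt_succ_of_le hk⟩, fun h k => h k (Nat.le_of_lt_succ k.2)⟩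

theorem self_mem_cylinder (n : ℕ) (z : MarkovShift A) : z ∈ cylinder n z := rfl

theorem cylinder_eq_of_mem {n : ℕ} {z w : MarkovShift A} (h : z ∈ cylinder n w) :
    cylinder n z = cylinder n w := by
  change wordCylinder (word n z) = wordCylinder (word n w)
  rw [show word n z = word n w from h]

theorem cylinder_anti {m n : ℕ} (h : m ≤ n) (z : MarkovShift A) :
    cylinder n z ⊆ cylinder m z := fun _ hx =>
  mem_cylinder_iff.2 fun k hk => mem_cylinder_iff.1 hx k (hk.trans h)

theorem cylinder_subset_of_mem {m n : ℕ} (h : m ≤ n) {z x w : MarkovShift A}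
    (hz : x ∈ cylinder n z) (hw : x ∈ cylinder m w) : cylinder n z ⊆ cylinder m w := by
  rw [← cylinder_eq_of_mem hz, ← cylinder_eq_of_mem hw]
  exact cylinder_anti h x

theorem shift_iterate_apply (n k : ℕ) (z : MarkovShift A) :
    ((shift A)^[n] z).1 k = z.1 (k + n) := by
  induction n generalizing z with
  | zero => rfl
  | succ n ih =>
    rw [Function.iterate_succ_apply, ih]
    change z.1 (k + n + 1) = _
    rfl

theorem ext' {x y : MarkovShift A} (h : ∀ k, x.1 k = y.1 k) : x = y :=
  Subtype.ext (funext h)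

theorem isInducing_val [UniformSpace I] (hI : (inferInstance : UniformSpace I) = ⊥) :
    Topology.IsInducing (fun z : MarkovShift A => (z.1 : ℕ → I)) := by
  subst hI
  let : UniformSpace I := ⊥
  exact ⟨rfl⟩

/-- Stated for any discrete topology on I, since the alphabet carries no instance and each use
introduces its own. -/
theorem continuous_coord [TopologicalSpace I] [DiscreteTopology I] (k : ℕ) :
    Continuous fun z : MarkovShift A => z.1 k := by
  have ht : (inferInstance : TopologicalSpace I) = ⊥ := DiscreteTopology.eq_bot
  subst ht
  let : UniformSpace I := ⊥
  exact (continuous_apply k).comp (isInducing_val (A := A) rfl).continuous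

theorem isClopen_cylinder (n : ℕ) (w : MarkovShift A) : IsClopen (cylinder n w) := by
  let : TopologicalSpace I := ⊥
  have : DiscreteTopology I := ⟨rfl⟩
  have : cylinder n w = ⋂ k ∈ Finset.range (n + 1), (fun z : MarkovShift A => z.1 k) ⁻¹' {w.1 k} := by
    ext z
    simp [mem_cylinder_iff]
  rw [this]
  exact isClopen_biInter_finset fun k _ => (isClopen_discrete _).preimage (continuous_coord k)

theorem isOpen_cylinder (n : ℕ) (w : MarkovShift A) : IsOpen (cylinder n w) :=
  (isClopen_cylinder n w).isOpen

theorem measurableSet_cylinder (n : ℕ) (w : MarkovShift A) : MeasurableSet (cylinder n w) :=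
  (isOpen_cylinder n w).measurableSet

theorem dist_le_of_mem_cylinder {n : ℕ} {z w : MarkovShift A} (h : z ∈ cylinder n w) :
    dist z w ≤ (1 / 2) ^ n := by
  rw [dist_def]
  refine PiNat.mem_cylinder_iff_dist_le.1 ?_
  exact PiNat.mem_cylinder_iff.2 fun k hk => mem_cylinder_iff.1 h k hk.le

theorem diam_cylinder_le (n : ℕ) (w : MarkovShift A) :
    Metric.diam (cylinder n w) ≤ (1 / 2) ^ n := by
  refine Metric.diam_le_of_forall_dist_le (by positivity) fun x hx y hy => ?_
  exact dist_le_of_mem_cylinder ((cylinder_eq_of_mem hy).symm ▸ hx)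

theorem exists_cylinder_subset {U : Set (MarkovShift A)} (hU : IsOpen U) {z : MarkovShift A}
    (hz : z ∈ U) : ∃ n, cylinder n z ⊆ U := by
  obtain ⟨ε, hε, hb⟩ := Metric.isOpen_iff.1 hU z hz
  obtain ⟨n, hn⟩ := exists_pow_lt_of_lt_one hε (by norm_num : (1 / 2 : ℝ) < 1)
  exact ⟨n, fun x hx => hb ((dist_le_of_mem_cylinder hx).trans_lt hn)⟩

theorem continuous_shift : Continuous (shift A) := by
  rw [Metric.continuous_iff]
  intro b ε hε
  obtain ⟨n, hn⟩ := exists_pow_lt_of_lt_one hε (by norm_num : (1 / 2 : ℝ) < 1)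
  obtain ⟨δ, hδ, hb⟩ := Metric.isOpen_iff.1 (isOpen_cylinder (n + 1) b) b (self_mem_cylinder _ _)
  refine ⟨δ, hδ, fun a ha => (dist_le_of_mem_cylinder (n := n) ?_).trans_lt hn⟩
  refine mem_cylinder_iff.2 fun k hk => ?_
  exact mem_cylinder_iff.1 (hb ha) (k + 1) (by omega)

theorem measurable_shift : Measurable (shift A) := continuous_shift.measurable

theorem continuous_birkhoffSum {φ : MarkovShift A → ℝ} (hφ : Continuous φ) (n : ℕ) :
    Continuous (birkhoffSum (shift A) φ n) := by
  unfold birkhoffSum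
  exact continuous_finsetSum _ fun k _ => hφ.comp (continuous_shift.iterate k)

/-- The point following `x` up to time `n`, and then `y`. -/
def glue (n : ℕ) (x y : MarkovShift A) (h : x.1 n = y.1 0) : MarkovShift A :=
  ⟨fun k => if k < n then x.1 k else y.1 (k - n), fun k => by
    rcases lt_trichotomy (k + 1) n with hk | hk | hk
    · simpa [hk, (Nat.lt_succ_self k).trans hk] using x.2 k
    · have h1 : k < n := by omega
      subst hk
      simpa [h] using h ▸ x.2 k
    · have h1 : ¬ k < n := by omega
      have h2 : ¬ k + 1 < n := by omega
      have h3 : k + 1 - n = (k - n) + 1 := by omega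
      simpa only [h1, h2, if_false, h3] using y.2 (k - n)⟩

theorem glue_mem_cylinder {n : ℕ} {x y : MarkovShift A} (h : x.1 n = y.1 0) :
    glue n x y h ∈ cylinder n x := by
  refine mem_cylinder_iff.2 fun k hk => ?_
  rcases hk.lt_or_eq with hk | rfl
  · simp [glue, hk]
  · simp [glue, h]

theorem shift_iterate_glue {n : ℕ} {x y : MarkovShift A} (h : x.1 n = y.1 0) :
    (shift A)^[n] (glue n x y h) = y := by
  refine ext' fun k => ?_
  rw [shift_iterate_apply]
  simp [glue]

theorem sum_measureReal_wordCylinder (μ : Measure (MarkovShift A)) [IsProbabilityMeasure μ]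
    (n : ℕ) [Fintype (Set.range (word (A := A) n))] :
    ∑ u : Set.range (word (A := A) n), μ.real (wordCylinder (u : Fin (n + 1) → I)) = 1 := by
  have hd : Pairwise fun u v : Set.range (word (A := A) n) =>
      Disjoint (wordCylinder (A := A) (u : Fin (n + 1) → I)) (wordCylinder (v : Fin (n + 1) → I)) := by
    intro u v huv
    refine Set.disjoint_left.2 fun z hz hz' => huv (Subtype.ext ?_)
    exact (show word n z = u from hz).symm.trans hz'
  have hm : ∀ u : Set.range (word (A := A) n),
      MeasurableSet (wordCylinder (A := A) (u : Fin (n + 1) → I)) := by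
    rintro ⟨_, w, rfl⟩
    exact measurableSet_cylinder n w
  have hu : (⋃ u : Set.range (word (A := A) n), wordCylinder (A := A) (u : Fin (n + 1) → I)) =
      Set.univ :=
    Set.eq_univ_of_forall fun z => Set.mem_iUnion.2 ⟨⟨word n z, z, rfl⟩, rfl⟩
  rw [← measureReal_iUnion_fintype hd hm, hu, probReal_univ]

end Basic

/-! ### Compactness and its consequences for a finite alphabet. -/

section FiniteAlphabet

variable {I : Type*} [Finite I] {A : Matrix I I (Fin 2)}

instance : CompactSpace (MarkovShift A) := by
  let : UniformSpace I := ⊥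
  have : DiscreteUniformity I := ⟨rfl⟩
  have hind : Topology.IsInducing (fun z : MarkovShift A => (z.1 : ℕ → I)) := isInducing_val rfl
  refine ⟨hind.isCompact_iff.2 ?_⟩
  have : (fun z : MarkovShift A => (z.1 : ℕ → I)) '' Set.univ =
      ⋂ k : ℕ, {z : ℕ → I | A (z k) (z (k + 1)) = 1} := by
    ext z
    simp only [Set.mem_iInter]
    exact ⟨fun ⟨y, _, hy⟩ k => hy ▸ y.2 k, fun h => ⟨⟨z, h⟩, trivial, rfl⟩⟩
  rw [this]
  refine (isClosed_iInter fun k => ?_).isCompact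
  have : Continuous fun z : ℕ → I => (z k, z (k + 1)) := by fun_prop
  exact (isClosed_discrete {p : I × I | A p.1 p.2 = 1}).preimage this

theorem exists_bound {φ : MarkovShift A → ℝ} (hφ : Continuous φ) :
    ∃ M : ℝ, 0 ≤ M ∧ ∀ z, |φ z| ≤ M := by
  obtain ⟨M, hM⟩ := (isCompact_range hφ).isBounded.exists_norm_le
  exact ⟨max M 0, le_max_right _ _, fun z =>
    (hM (φ z) (Set.mem_range_self z)).trans (le_max_left _ _)⟩

theorem integrable_of_continuous {φ : MarkovShift A → ℝ} (hφ : Continuous φ)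
    (μ : Measure (MarkovShift A)) [IsFiniteMeasure μ] : Integrable φ μ := by
  obtain ⟨M, -, hM⟩ := exists_bound hφ
  exact Integrable.of_bound hφ.aestronglyMeasurable M (ae_of_all _ hM)

theorem countable_cylinders : (cylinders A).Countable := by
  have : cylinders A ⊆ ⋃ n : ℕ, Set.range fun u : Set.range (word (A := A) n) =>
      wordCylinder (u : Fin (n + 1) → I) := by
    rintro F ⟨n, w, rfl⟩
    exact Set.mem_iUnion.2 ⟨n, ⟨word n w, Set.mem_range_self w⟩, rfl⟩
  exact (Set.countable_iUnion fun n => (Set.finite_range _).countable).mono this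

/-- Cantor intersection: the points whose n-cylinder has measure at least δ form decreasing closed
sets, and a point common to all of them would be an atom. -/
theorem tendsto_cylinder_measure_zero (μ : Measure (MarkovShift A)) [IsFiniteMeasure μ]
    [NullSingletonClass μ] {δ : ℝ} (hδ : 0 < δ) :
    ∃ n, ∀ z, μ.real (cylinder n z) < δ := by
  by_contra! hcon
  let K : ℕ → Set (MarkovShift A) := fun n => {z | δ ≤ μ.real (cylinder n z)}
  have hanti : ∀ n, K (n + 1) ⊆ K n := fun n z hz =>
    hz.trans (measureReal_mono (cylinder_anti n.le_succ z))
  have hclosed : ∀ n, IsClosed (K n) := fun n => by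
    rw [← isOpen_compl_iff, isOpen_iff_mem_nhds]
    intro z hz
    refine mem_of_superset ((isOpen_cylinder n z).mem_nhds (self_mem_cylinder n z)) fun x hx => ?_
    simpa [K, cylinder_eq_of_mem hx] using hz
  obtain ⟨z, hz⟩ := IsCompact.nonempty_iInter_of_sequence_nonempty_isCompact_isClosed K hanti
    (fun n => hcon n) (hclosed 0).isCompact hclosed
  rw [Set.mem_iInter] at hz
  have hlim : Tendsto (fun n => μ (cylinder n z)) atTop (𝓝 (μ (⋂ n, cylinder n z))) :=
    tendsto_measure_iInter_atTop (fun n => (measurableSet_cylinder n z).nullMeasurableSet)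
      (fun m n h => cylinder_anti h z) ⟨0, measure_ne_top _ _⟩
  have hsing : (⋂ n, cylinder n z) = {z} := by
    ext x
    rw [Set.mem_iInter, Set.mem_singleton_iff]
    exact ⟨fun h => ext' fun k => mem_cylinder_iff.1 (h k) k le_rfl,
      fun h n => h ▸ self_mem_cylinder n _⟩
  rw [hsing, measure_singleton] at hlim
  have := (ENNReal.tendsto_toReal ENNReal.zero_ne_top).comp hlim
  exact absurd (ge_of_tendsto' this hz) (by simpa using hδ)

end FiniteAlphabet

end MarkovShift

namespace MarkovShift

/-! ### Topological pressure. -/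

section Pressure

variable {I : Type*} {A : Matrix I I (Fin 2)}

/-- The partition function whose exponential growth rate is the pressure. -/
noncomputable def partitionSum (φ : MarkovShift A → ℝ) (n : ℕ) : ℝ :=
  ∑' u : Set.range (word (A := A) n),
    Real.exp (sSup (birkhoffSum (shift A) φ n '' wordCylinder (u : Fin (n + 1) → I)))

theorem pressureSeq_eq (φ : MarkovShift A → ℝ) (n : ℕ) :
    pressureSeq φ n = (1 / (n : ℝ)) * Real.log (partitionSum φ n) := rfl

theorem abs_birkhoffSum_le {φ : MarkovShift A → ℝ} {M : ℝ} (hM : ∀ z, |φ z| ≤ M) (n : ℕ)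
    (z : MarkovShift A) : |birkhoffSum (shift A) φ n z| ≤ n * M := by
  refine (Finset.abs_sum_le_sum_abs _ _).trans ?_
  refine (Finset.sum_le_sum fun k _ => hM _).trans ?_
  simp

theorem sSup_birkhoffSum_le {φ : MarkovShift A → ℝ} {n : ℕ} {u : Fin (n + 1) → I}
    (hu : u ∈ Set.range (word (A := A) n)) {a : ℝ}
    (h : ∀ z ∈ wordCylinder u, birkhoffSum (shift A) φ n z ≤ a) :
    sSup (birkhoffSum (shift A) φ n '' wordCylinder u) ≤ a := by
  obtain ⟨w, rfl⟩ := hu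
  refine csSup_le ⟨_, w, rfl, rfl⟩ ?_
  rintro _ ⟨x, hx, rfl⟩
  exact h x hx

variable [Finite I]

theorem birkhoffSum_le_sSup {φ : MarkovShift A → ℝ} (hφ : Continuous φ) {n : ℕ}
    {u : Fin (n + 1) → I} {z : MarkovShift A} (hz : z ∈ wordCylinder u) :
    birkhoffSum (shift A) φ n z ≤ sSup (birkhoffSum (shift A) φ n '' wordCylinder u) := by
  obtain ⟨M, -, hM⟩ := exists_bound hφ
  refine le_csSup ⟨n * M, ?_⟩ ⟨z, hz, rfl⟩
  rintro _ ⟨x, -, rfl⟩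
  exact (le_abs_self _).trans (abs_birkhoffSum_le hM n x)

theorem partitionSum_pos [Nonempty (MarkovShift A)] (φ : MarkovShift A → ℝ) (n : ℕ) :
    0 < partitionSum φ n :=
  (Summable.of_finite).tsum_pos (fun _ => (Real.exp_pos _).le)
    ⟨word n (Classical.arbitrary _), _, rfl⟩ (Real.exp_pos _)

theorem exp_birkhoffSum_le_partitionSum {φ : MarkovShift A → ℝ} (hφ : Continuous φ) (n : ℕ)
    (z : MarkovShift A) : Real.exp (birkhoffSum (shift A) φ n z) ≤ partitionSum φ n := by
  refine le_trans ?_ ((Summable.of_finite).le_tsum (⟨word n z, z, rfl⟩ : Set.range (word n))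
    fun _ _ => (Real.exp_pos _).le)
  exact Real.exp_le_exp.2 (birkhoffSum_le_sSup hφ rfl)

theorem partitionSum_le_exp_mul {φ ψ : MarkovShift A → ℝ} (hψ : Continuous ψ) {n : ℕ} {a : ℝ}
    (h : ∀ z, birkhoffSum (shift A) φ n z ≤ birkhoffSum (shift A) ψ n z + a) :
    partitionSum φ n ≤ Real.exp a * partitionSum ψ n := by
  rw [partitionSum, partitionSum, ← tsum_mul_left]
  refine Summable.tsum_le_tsum (fun u => ?_) Summable.of_finite Summable.of_finite
  rw [← Real.exp_add, Real.exp_le_exp]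
  refine sSup_birkhoffSum_le u.2 fun z hz => (h z).trans ?_
  linarith [birkhoffSum_le_sSup hψ hz]

/-- A word of length m+n+1 is determined by its first m+1 and its last n+1 symbols, which overlap in
one place, and the Birkhoff sum splits accordingly. Fekete's lemma then makes the pressure a genuine
limit. -/
theorem partitionSum_add_le {φ : MarkovShift A → ℝ} (hφ : Continuous φ) (m n : ℕ) :
    partitionSum φ (m + n) ≤ partitionSum φ m * partitionSum φ n := by
  classical
  have := fun k => Fintype.ofFinite (Set.range (word (A := A) k))
  choose w hw using fun u : Set.range (word (A := A) (m + n)) => u.2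
  let e : Set.range (word (A := A) (m + n)) →
      Set.range (word (A := A) m) × Set.range (word (A := A) n) := fun u =>
    (⟨word m (w u), _, rfl⟩, ⟨word n ((shift A)^[m] (w u)), _, rfl⟩)
  have he : Function.Injective e := by
    intro u v huv
    have h1 : word m (w u) = word m (w v) := congrArg (fun p => (p.1 : Fin (m + 1) → I)) huv
    have h2 : word n ((shift A)^[m] (w u)) = word n ((shift A)^[m] (w v)) :=
      congrArg (fun p => (p.2 : Fin (n + 1) → I)) huv
    refine Subtype.ext ?_
    rw [← hw u, ← hw v]
    change w u ∈ cylinder (m + n) (w v)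
    replace h1 := mem_cylinder_iff.1 (show w u ∈ cylinder m (w v) from h1)
    replace h2 := mem_cylinder_iff.1
      (show (shift A)^[m] (w u) ∈ cylinder n ((shift A)^[m] (w v)) from h2)
    refine mem_cylinder_iff.2 fun k hk => ?_
    rcases le_total k m with hkm | hkm
    · exact h1 k hkm
    · have := h2 (k - m) (by omega)
      rwa [shift_iterate_apply, shift_iterate_apply, Nat.sub_add_cancel hkm] at this
  simp only [partitionSum, tsum_fintype]
  rw [Fintype.sum_mul_sum, ← Fintype.sum_prod_type']
  rw [← tsum_fintype (L := .unconditional _), ← tsum_fintype (L := .unconditional _)]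
  refine Summable.tsum_le_tsum_of_inj e he (fun _ _ => by positivity) (fun u => ?_)
    Summable.of_finite Summable.of_finite
  rw [← Real.exp_add, Real.exp_le_exp]
  refine sSup_birkhoffSum_le u.2 fun z hz => ?_
  rw [birkhoffSum_add]
  have hz' : z ∈ cylinder (m + n) (w u) := (show word (m + n) z = u from hz).trans (hw u).symm
  refine add_le_add (birkhoffSum_le_sSup hφ (cylinder_anti (Nat.le_add_right m n) _ hz'))
    (birkhoffSum_le_sSup hφ ?_)
  change _ ∈ cylinder n _
  refine mem_cylinder_iff.2 fun k hk => ?_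
  rw [shift_iterate_apply, shift_iterate_apply]
  exact mem_cylinder_iff.1 hz' _ (by omega)

theorem tendsto_pressureSeq [Nonempty (MarkovShift A)] {φ : MarkovShift A → ℝ}
    (hφ : Continuous φ) : Tendsto (pressureSeq φ) atTop (𝓝 (topPressure φ)) := by
  have hsub : Subadditive fun n => Real.log (partitionSum φ n) := fun m n => by
    rw [← Real.log_mul (partitionSum_pos φ m).ne' (partitionSum_pos φ n).ne']
    exact Real.log_le_log (partitionSum_pos φ _) (partitionSum_add_le hφ m n)
  obtain ⟨M, hM0, hM⟩ := exists_bound hφ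
  have hb : BddBelow (Set.range fun n : ℕ => Real.log (partitionSum φ n) / n) := by
    refine ⟨-M, ?_⟩
    rintro _ ⟨n, rfl⟩
    rcases n.eq_zero_or_pos with rfl | hn
    · simpa using hM0
    · have hn' : (0 : ℝ) < n := by exact_mod_cast hn
      change -M ≤ _ / _
      rw [le_div_iff₀ hn', Real.le_log_iff_exp_le (partitionSum_pos φ n)]
      refine le_trans ?_ (exp_birkhoffSum_le_partitionSum hφ n (Classical.arbitrary _))
      rw [Real.exp_le_exp]
      linarith [neg_le_of_abs_le (abs_birkhoffSum_le hM n (Classical.arbitrary _))]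
  have h : Tendsto (pressureSeq φ) atTop (𝓝 hsub.lim) := by
    refine (hsub.tendsto_lim hb).congr fun n => ?_
    rw [pressureSeq_eq]
    ring
  rwa [topPressure, h.limUnder_eq]

/-- A bound `f n ≤ B + n (a + ε)` for every `ε > 0` passes to the limit of `f n / n`. -/
theorem le_of_tendsto_of_forall_le {f : ℕ → ℝ} {l a : ℝ}
    (hl : Tendsto (fun n : ℕ => 1 / (n : ℝ) * f n) atTop (𝓝 l))
    (h : ∀ ε > 0, ∃ B : ℝ, ∀ᶠ n : ℕ in atTop, f n ≤ B + n * (a + ε)) : l ≤ a := by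
  refine le_of_forall_pos_le_add fun ε hε => ?_
  obtain ⟨B, hB⟩ := h ε hε
  have h0 : Tendsto (fun n : ℕ => B * (1 / (n : ℝ)) + (a + ε)) atTop (𝓝 (B * 0 + (a + ε))) :=
    (tendsto_one_div_atTop_nhds_zero_nat.const_mul B).add_const _
  rw [mul_zero, zero_add] at h0
  refine le_of_tendsto_of_tendsto hl h0 ?_
  filter_upwards [hB, eventually_gt_atTop 0] with n hn hn0
  have hn' : (0 : ℝ) < n := by exact_mod_cast hn0
  calc 1 / (n : ℝ) * f n ≤ 1 / (n : ℝ) * (B + n * (a + ε)) := by gcongr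
    _ = _ := by field_simp

theorem ge_of_tendsto_of_forall_ge {f : ℕ → ℝ} {l a : ℝ}
    (hl : Tendsto (fun n : ℕ => 1 / (n : ℝ) * f n) atTop (𝓝 l))
    (h : ∀ ε > 0, ∃ B : ℝ, ∀ᶠ n : ℕ in atTop, n * (a - ε) - B ≤ f n) : a ≤ l := by
  have hl' : Tendsto (fun n : ℕ => 1 / (n : ℝ) * -f n) atTop (𝓝 (-l)) := by
    simpa only [mul_neg] using hl.neg
  have := le_of_tendsto_of_forall_le (a := -a) hl' fun ε hε => by
    obtain ⟨B, hB⟩ := h ε hε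
    exact ⟨B, hB.mono fun n hn => by linarith⟩
  linarith

/-- The comparison principle behind monotonicity and continuity of the pressure in t; a sublinear
error in the Birkhoff sums is invisible to it. -/
theorem topPressure_le_add [Nonempty (MarkovShift A)] {φ ψ : MarkovShift A → ℝ}
    (hφ : Continuous φ) (hψ : Continuous ψ) {a : ℝ}
    (h : ∀ ε > 0, ∃ B : ℝ, ∀ n z,
      birkhoffSum (shift A) φ n z ≤ birkhoffSum (shift A) ψ n z + (B + n * (a + ε))) :
    topPressure φ ≤ topPressure ψ + a := by
  have hl : Tendsto (fun n : ℕ => 1 / (n : ℝ) *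
      (Real.log (partitionSum φ n) - Real.log (partitionSum ψ n))) atTop
      (𝓝 (topPressure φ - topPressure ψ)) := by
    refine ((tendsto_pressureSeq hφ).sub (tendsto_pressureSeq hψ)).congr fun n => ?_
    rw [pressureSeq_eq, pressureSeq_eq, mul_sub]
  have := le_of_tendsto_of_forall_le (a := a) hl fun ε hε => by
    obtain ⟨B, hB⟩ := h ε hε
    refine ⟨B, Eventually.of_forall fun n => ?_⟩
    have h1 := Real.log_le_log (partitionSum_pos φ n) (partitionSum_le_exp_mul hψ (hB n))
    rw [Real.log_mul (Real.exp_pos _).ne' (partitionSum_pos ψ n).ne', Real.log_exp] at h1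
    linarith
  linarith

theorem partitionSum_zero (n : ℕ) :
    partitionSum (fun _ : MarkovShift A => (0 : ℝ)) n = Nat.card (Set.range (word (A := A) n)) := by
  have := Fintype.ofFinite (Set.range (word (A := A) n))
  have h : ∀ u : Set.range (word (A := A) n), Real.exp (sSup (birkhoffSum (shift A)
      (fun _ : MarkovShift A => (0 : ℝ)) n '' wordCylinder (u : Fin (n + 1) → I))) = 1 := by
    rintro ⟨_, w, rfl⟩
    have : birkhoffSum (shift A) (fun _ : MarkovShift A => (0 : ℝ)) n '' wordCylinder (word n w) =
        {0} := by
      refine Set.eq_singleton_iff_unique_mem.2 ⟨⟨w, rfl, by simp [birkhoffSum]⟩, ?_⟩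
      rintro _ ⟨x, -, rfl⟩
      simp [birkhoffSum]
    simp [this]
  rw [partitionSum, tsum_congr h, tsum_fintype]
  simp

/-- Every word can be continued so as to end, N steps later, in a or in b. This at least doubles the
number of words, which makes the topological entropy at least (log 2)/N. -/
theorem two_mul_card_word_le {N : ℕ}
    (hN : ∀ c d : I, ∃ w : MarkovShift A, w.1 0 = c ∧ w.1 N = d) {a b : I} (hab : a ≠ b) (n : ℕ) :
    2 * Nat.card (Set.range (word (A := A) n)) ≤ Nat.card (Set.range (word (A := A) (n + N))) := by
  choose w hw using fun u : Set.range (word (A := A) n) => u.2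
  choose y hy0 hyN using hN
  let e : Bool × Set.range (word (A := A) n) → Set.range (word (A := A) (n + N)) := fun p =>
    ⟨word (n + N) (glue n (w p.2) (y ((w p.2).1 n) (if p.1 then a else b)) (hy0 _ _).symm), _, rfl⟩
  have he : Function.Injective e := by
    rintro ⟨i, u⟩ ⟨j, v⟩ huv
    have h := mem_cylinder_iff.1 (show glue n (w u) _ (hy0 _ (if i then a else b)).symm ∈
      cylinder (n + N) (glue n (w v) _ (hy0 _ (if j then a else b)).symm) from
        congrArg Subtype.val huv)
    have huv' : u = v := by
      refine Subtype.ext ?_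
      rw [← hw u, ← hw v]
      change w u ∈ cylinder n (w v)
      refine mem_cylinder_iff.2 fun k hk => ?_
      rw [← mem_cylinder_iff.1 (glue_mem_cylinder (hy0 ((w u).1 n) (if i then a else b)).symm) k hk,
        ← mem_cylinder_iff.1 (glue_mem_cylinder (hy0 ((w v).1 n) (if j then a else b)).symm) k hk]
      exact h k (hk.trans (Nat.le_add_right _ _))
    subst huv'
    have h2 := h (n + N) le_rfl
    simp only [glue, Nat.not_lt.2 (Nat.le_add_right n N), if_false, Nat.add_sub_cancel_left,
      hyN] at h2
    have : i = j := by
      rcases i <;> rcases j <;> simp_all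
    rw [this]
  have := Nat.card_le_card_of_injective e he
  simpa [Nat.card_prod] using this

theorem IsTopologicallyMixing.exists_uniform (hA : IsTopologicallyMixing A) :
    ∃ N, 0 < N ∧ ∀ c d : I, ∃ w : MarkovShift A, w.1 0 = c ∧ w.1 N = d := by
  choose N hN using hA
  have := Fintype.ofFinite I
  obtain ⟨m, hm⟩ := (Set.finite_range fun p : I × I => N p.1 p.2).bddAbove
  refine ⟨m + 1, m.succ_pos, fun c d => hN c d _ ?_⟩
  exact (hm ⟨(c, d), rfl⟩).trans m.le_succ

theorem topPressure_zero_pos [Nonempty (MarkovShift A)] (hA : IsTopologicallyMixing A)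
    {a b : I} (hab : a ≠ b) : 0 < topPressure fun _ : MarkovShift A => (0 : ℝ) := by
  obtain ⟨N, hN0, hN⟩ := hA.exists_uniform
  have hN0' : (0 : ℝ) < N := by exact_mod_cast hN0
  have hcard : ∀ k : ℕ, (2 : ℝ) ^ k ≤ partitionSum (fun _ : MarkovShift A => (0 : ℝ)) (k * N) := by
    intro k
    rw [partitionSum_zero]
    induction k with
    | zero =>
      have : 1 ≤ Nat.card (Set.range (word (A := A) (0 * N))) := Nat.card_pos
      rw [pow_zero]
      exact_mod_cast this
    | succ k ih =>
      have h2 : (2 : ℝ) * Nat.card (Set.range (word (A := A) (k * N))) ≤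
          Nat.card (Set.range (word (A := A) (k * N + N))) := by
        exact_mod_cast two_mul_card_word_le hN hab (k * N)
      rw [Nat.succ_mul, pow_succ]
      linarith
  have hlim := (tendsto_pressureSeq (A := A) (φ := fun _ => 0) continuous_const).comp
    (tendsto_id.atTop_mul_const' hN0 : Tendsto (fun k : ℕ => k * N) atTop atTop)
  refine lt_of_lt_of_le (div_pos (Real.log_pos one_lt_two) hN0') (ge_of_tendsto hlim ?_)
  filter_upwards [eventually_gt_atTop 0] with k hk
  have hk' : (0 : ℝ) < k := by exact_mod_cast hk
  have h3 := Real.log_le_log (by positivity) (hcard k)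
  rw [Real.log_pow] at h3
  rw [Function.comp_apply, pressureSeq_eq]
  push_cast
  calc Real.log 2 / N = 1 / (k * N : ℝ) * (k * Real.log 2) := by field_simp
    _ ≤ _ := by gcongr

end Pressure

end MarkovShift

namespace MarkovShift

/-! ### Gibbs estimates at every point, and the function t ↦ P_top(tφ). -/

section UniformGibbs

variable {I : Type*} {A : Matrix I I (Fin 2)}

/-- Two-sided Gibbs bounds on cylinders with a subexponential error, in logarithmic form. -/
def IsUniformGibbs (μ : Measure (MarkovShift A)) (φ : MarkovShift A → ℝ) (P : ℝ) : Prop :=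
  (∀ n x, 0 < μ.real (cylinder n x)) ∧ ∀ ε > 0, ∃ B : ℝ, 0 ≤ B ∧ ∀ (n : ℕ) (x : MarkovShift A),
    |Real.log (μ.real (cylinder n x)) -
      (birkhoffSum (shift A) φ (n + 1) x - (n + 1) * P)| ≤ B + ε * (n + 1)

theorem GibbsBound.abs_log_sub_le {μ : Measure (MarkovShift A)} {φ : MarkovShift A → ℝ} {P : ℝ}
    {K : ℕ → ℝ} {c : I → ℝ} {n : ℕ} {x z : MarkovShift A} (h : GibbsBound μ φ P K c n x z)
    (hc : 1 ≤ c (x.1 0)) (hK : 1 ≤ K (n + 1)) : 0 < μ.real (cylinder n x) ∧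
    |Real.log (μ.real (cylinder n x)) - (birkhoffSum (shift A) φ (n + 1) z - (n + 1) * P)| ≤
      Real.log (c (x.1 0)) + Real.log (K (n + 1)) := by
  obtain ⟨h1, h2⟩ := h
  have hcK : 0 < c (x.1 0) * K (n + 1) := by positivity
  set E := Real.exp (-((n + 1 : ℕ) : ℝ) * P + birkhoffSum (shift A) φ (n + 1) z) with hE
  have hE0 : 0 < E := Real.exp_pos _
  have hr : 0 < μ.real (cylinder n x) / E := lt_of_lt_of_le (by positivity) h1
  have hpos : 0 < μ.real (cylinder n x) := by
    have := mul_pos hr hE0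
    rwa [div_mul_cancel₀ _ hE0.ne'] at this
  refine ⟨hpos, ?_⟩
  have h1' := Real.log_le_log (by positivity) h1
  have h2' := Real.log_le_log hr h2
  rw [Real.log_div hpos.ne' hE0.ne', hE, Real.log_exp] at h1' h2'
  rw [Real.log_mul (by positivity) (by positivity)] at h2'
  rw [one_div, Real.log_inv, Real.log_mul (by positivity) (by positivity)] at h1'
  push_cast at h1' h2'
  rw [abs_le]
  constructor <;> linarith

/-- The Gibbs inequality is a closed condition on z. If it failed at x, it would fail on a whole
cylinder around x, and that cylinder has positive measure. -/
theorem IsWeakGibbs.gibbsBound_self {μ : Measure (MarkovShift A)} {φ : MarkovShift A → ℝ}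
    (hφ : Continuous φ) (hpos : ∀ n x, 0 < μ (cylinder n x)) {P : ℝ} {K : ℕ → ℝ} {c : I → ℝ}
    {n : ℕ} {x : MarkovShift A}
    (h : ∀ᵐ z ∂μ, z ∈ cylinder n x → GibbsBound μ φ P K c n x z) :
    GibbsBound μ φ P K c n x x := by
  by_contra hx
  have hclosed : IsClosed {z | GibbsBound μ φ P K c n x z} := by
    have hcont : Continuous fun z => μ.real (cylinder n x) /
        Real.exp (-((n + 1 : ℕ) : ℝ) * P + birkhoffSum (shift A) φ (n + 1) z) :=
      continuous_const.div
        (Real.continuous_exp.comp (continuous_const.add (continuous_birkhoffSum hφ _)))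
        fun _ => (Real.exp_pos _).ne'
    exact (isClosed_le continuous_const hcont).inter (isClosed_le hcont continuous_const)
  obtain ⟨m, hm⟩ := exists_cylinder_subset
    ((isOpen_cylinder n x).inter hclosed.isOpen_compl) ⟨self_mem_cylinder n x, hx⟩
  refine (hpos m x).ne' (measure_mono_null (fun z hz => ?_) (ae_iff.1 h))
  have := hm hz
  exact fun h' => this.2 (h' this.1)

theorem IsWeakGibbs.exists_isUniformGibbs {μ : Measure (MarkovShift A)} {φ : MarkovShift A → ℝ}
    (hμ : IsWeakGibbs μ φ) (hφ : Continuous φ) : ∃ P, IsUniformGibbs μ φ P := by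
  obtain ⟨hprob, hpos, P, K, c, hK, hlim, hc, ⟨D, hD⟩, hb⟩ := hμ
  refine ⟨P, fun n x => ENNReal.toReal_pos (hpos n x).ne' (measure_ne_top _ _), fun ε hε => ?_⟩
  have hmono : Monotone K := monotone_nat_of_le_succ fun n => (hK n).2
  obtain ⟨n₀, hn₀⟩ := eventually_atTop.1 ((hlim.eventually_le_const hε).and (eventually_gt_atTop 0))
  refine ⟨Real.log (max D 1) + Real.log (K n₀), add_nonneg
    (Real.log_nonneg (le_max_right _ _)) (Real.log_nonneg (hK n₀).1), fun n x => ?_⟩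
  have h1 := ((IsWeakGibbs.gibbsBound_self hφ hpos (hb n x)).abs_log_sub_le (hc _) (hK _).1).2
  have h2 : Real.log (c (x.1 0)) ≤ Real.log (max D 1) :=
    Real.log_le_log (by linarith [hc (x.1 0)]) ((hD ⟨_, rfl⟩).trans (le_max_left _ _))
  -- Subexponential growth gives the bound beyond n₀; before n₀ monotonicity of K bounds it by K n₀.
  have h3 : Real.log (K (n + 1)) ≤ Real.log (K n₀) + ε * (n + 1) := by
    have hK0 := Real.log_nonneg (hK n₀).1
    rcases le_total n₀ (n + 1) with h | h
    · obtain ⟨h4, h5⟩ := hn₀ _ h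
      have h5' : (0 : ℝ) < ((n + 1 : ℕ) : ℝ) := by exact_mod_cast h5
      rw [one_div, inv_mul_le_iff₀ h5'] at h4
      push_cast at h4
      linarith
    · have := Real.log_le_log (by linarith [(hK (n + 1)).1]) (hmono h)
      have : 0 ≤ ε * (n + 1) := by positivity
      linarith
  linarith

theorem IsGibbs.exists_abs_log_sub_le {μ : Measure (MarkovShift A)} {φ : MarkovShift A → ℝ}
    (hμ : IsGibbs μ φ) : ∃ P B : ℝ, 0 ≤ B ∧ ∀ (n : ℕ) (x : MarkovShift A),
      0 < μ.real (cylinder n x) ∧ |Real.log (μ.real (cylinder n x)) -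
      (birkhoffSum (shift A) φ (n + 1) x - (n + 1) * P)| ≤ B := by
  obtain ⟨hprob, P, K, c, hK, ⟨E, hE⟩, hc, ⟨D, hD⟩, hb⟩ := hμ
  refine ⟨P, Real.log (max D 1) + Real.log (max E 1), add_nonneg
    (Real.log_nonneg (le_max_right _ _)) (Real.log_nonneg (le_max_right _ _)), fun n x => ?_⟩
  have h1 := (hb n x x (self_mem_cylinder n x)).abs_log_sub_le (hc _) (hK _).1
  refine ⟨h1.1, h1.2.trans (add_le_add ?_ ?_)⟩
  · exact Real.log_le_log (by linarith [hc (x.1 0)]) ((hD ⟨_, rfl⟩).trans (le_max_left _ _))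
  · exact Real.log_le_log (by linarith [(hK (n + 1)).1]) ((hE ⟨_, rfl⟩).trans (le_max_left _ _))

theorem birkhoffSum_const_mul (t : ℝ) (φ : MarkovShift A → ℝ) (n : ℕ) (z : MarkovShift A) :
    birkhoffSum (shift A) (fun z => t * φ z) n z = t * birkhoffSum (shift A) φ n z := by
  simp [birkhoffSum, Finset.mul_sum]

theorem IsUniformGibbs.birkhoffSum_le {μ : Measure (MarkovShift A)} [IsProbabilityMeasure μ]
    {φ : MarkovShift A → ℝ} {P : ℝ} (hμ : IsUniformGibbs μ φ P) {ε : ℝ} (hε : 0 < ε) :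
    ∃ B : ℝ, 0 ≤ B ∧ ∀ (n : ℕ) (z : MarkovShift A),
      birkhoffSum (shift A) φ n z ≤ n * P + (B + n * ε) := by
  obtain ⟨B, hB0, hB⟩ := hμ.2 ε hε
  refine ⟨B, hB0, fun n z => ?_⟩
  rcases n with _ | n
  · simpa using hB0
  · have h1 := (abs_le.1 (hB n z)).1
    have h2 : Real.log (μ.real (cylinder n z)) ≤ 0 :=
      Real.log_nonpos measureReal_nonneg measureReal_le_one
    push_cast
    linarith

theorem birkhoffSum_succ_abs_sub_le {φ : MarkovShift A → ℝ} {M : ℝ} (hM : ∀ z, |φ z| ≤ M) (n : ℕ)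
    (z : MarkovShift A) :
    |birkhoffSum (shift A) φ (n + 1) z - birkhoffSum (shift A) φ n z| ≤ M := by
  rw [birkhoffSum_succ, add_sub_cancel_left]
  exact hM _

theorem integral_le_of_forall_wordCylinder {μ : Measure (MarkovShift A)} [IsProbabilityMeasure μ]
    {n : ℕ} {f : MarkovShift A → ℝ} (hf : Integrable f μ)
    {g : Set.range (word (A := A) n) → ℝ} [Fintype (Set.range (word (A := A) n))]
    (h : ∀ u : Set.range (word (A := A) n), ∀ z ∈ wordCylinder (u : Fin (n + 1) → I), f z ≤ g u) :
    ∫ z, f z ∂μ ≤ ∑ u : Set.range (word (A := A) n),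
      μ.real (wordCylinder (u : Fin (n + 1) → I)) * g u := by
  have hd : Pairwise fun u v : Set.range (word (A := A) n) =>
      Disjoint (wordCylinder (A := A) (u : Fin (n + 1) → I)) (wordCylinder (v : Fin (n + 1) → I)) := by
    intro u v huv
    refine Set.disjoint_left.2 fun z hz hz' => huv (Subtype.ext ?_)
    exact (show word n z = u from hz).symm.trans hz'
  have hm : ∀ u : Set.range (word (A := A) n),
      MeasurableSet (wordCylinder (A := A) (u : Fin (n + 1) → I)) := by
    rintro ⟨_, w, rfl⟩
    exact measurableSet_cylinder n w
  have hu : (⋃ u : Set.range (word (A := A) n), wordCylinder (A := A) (u : Fin (n + 1) → I)) =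
      Set.univ :=
    Set.eq_univ_of_forall fun z => Set.mem_iUnion.2 ⟨⟨word n z, z, rfl⟩, rfl⟩
  rw [← setIntegral_univ, ← hu, integral_iUnion_fintype hm hd fun u => hf.integrableOn]
  refine Finset.sum_le_sum fun u _ => ?_
  refine (setIntegral_mono_on hf.integrableOn (integrable_const (g u)).integrableOn (hm u)
    (h u)).trans_eq ?_
  simp

variable [Finite I]

/-- Up to e^{o(n)} the partition sum is e^{nP} times the total mass of the n-cylinders, which is 1.
-/
theorem IsUniformGibbs.topPressure_eq {μ : Measure (MarkovShift A)} [IsProbabilityMeasure μ]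
    {φ : MarkovShift A → ℝ} (hφ : Continuous φ) {P : ℝ} (hμ : IsUniformGibbs μ φ P) :
    topPressure φ = P := by
  have hne : Nonempty (MarkovShift A) := nonempty_of_isProbabilityMeasure μ
  have := fun k => Fintype.ofFinite (Set.range (word (A := A) k))
  obtain ⟨M, hM0, hM⟩ := exists_bound hφ
  have hlim := tendsto_pressureSeq hφ
  refine le_antisymm (le_of_tendsto_of_forall_le hlim fun ε hε => ?_)
    (ge_of_tendsto_of_forall_ge hlim fun ε hε => ?_)
  all_goals
    obtain ⟨B, hB0, hB⟩ := hμ.2 ε hε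
  -- An n-cylinder fixes n+1 symbols but the pressure uses S_n. The constants M, P and ε pay for the
  -- one extra term.
  · refine ⟨B + M + P + ε, Eventually.of_forall fun n => ?_⟩
    change Real.log (partitionSum φ n) ≤ _
    rw [Real.log_le_iff_le_exp (partitionSum_pos φ n), partitionSum, tsum_fintype]
    calc _ ≤ ∑ u : Set.range (word (A := A) n),
          Real.exp (B + M + P + ε + n * (P + ε)) * μ.real (wordCylinder (u : Fin (n + 1) → I)) := by
          refine Finset.sum_le_sum fun u _ => ?_
          obtain ⟨u, hu⟩ := u
          obtain ⟨w, rfl⟩ := hu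
          have hp : 0 < μ.real (wordCylinder (word n w)) := hμ.1 n w
          dsimp only
          rw [← Real.exp_log hp, ← Real.exp_add,
            Real.exp_le_exp]
          refine sSup_birkhoffSum_le ⟨w, rfl⟩ fun z hz => ?_
          have h1 := (abs_le.1 (hB n z)).1
          have h2 := (abs_le.1 (birkhoffSum_succ_abs_sub_le hM n z)).1
          rw [cylinder_eq_of_mem (show z ∈ cylinder n w from hz)] at h1
          change _ ≤ _ + Real.log (μ.real (cylinder n w))
          linarith
      _ = _ := by rw [← Finset.mul_sum, sum_measureReal_wordCylinder, mul_one]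
  · refine ⟨B + M - P + ε, Eventually.of_forall fun n => ?_⟩
    change _ ≤ Real.log (partitionSum φ n)
    rw [Real.le_log_iff_exp_le (partitionSum_pos φ n), partitionSum, tsum_fintype]
    calc _ = ∑ u : Set.range (word (A := A) n), Real.exp (n * (P - ε) - (B + M - P + ε)) *
          μ.real (wordCylinder (u : Fin (n + 1) → I)) := by
          rw [← Finset.mul_sum, sum_measureReal_wordCylinder, mul_one]
      _ ≤ _ := by
          refine Finset.sum_le_sum fun u _ => ?_
          obtain ⟨u, hu⟩ := u
          obtain ⟨w, rfl⟩ := hu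
          have hp : 0 < μ.real (wordCylinder (word n w)) := hμ.1 n w
          dsimp only
          rw [← Real.exp_log hp, ← Real.exp_add,
            Real.exp_le_exp]
          refine le_trans ?_ (birkhoffSum_le_sSup hφ (show w ∈ wordCylinder (word n w) from rfl))
          have h1 := (abs_le.1 (hB n w)).2
          have h2 := (abs_le.1 (birkhoffSum_succ_abs_sub_le hM n w)).2
          change _ + Real.log (μ.real (cylinder n w)) ≤ _
          linarith

theorem IsUniformGibbs.pressure_sub_anti {μ : Measure (MarkovShift A)} [IsProbabilityMeasure μ]
    {φ : MarkovShift A → ℝ} (hφ : Continuous φ) {P : ℝ} (hμ : IsUniformGibbs μ φ P) :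
    Antitone fun t : ℝ => topPressure (fun z => t * φ z) - t * P := by
  have hne : Nonempty (MarkovShift A) := nonempty_of_isProbabilityMeasure μ
  intro t t' htt'
  have := topPressure_le_add (φ := fun z => t' * φ z) (ψ := fun z => t * φ z) (by fun_prop)
    (by fun_prop) (a := (t' - t) * P) fun ε hε => by
      -- The +1 avoids dividing by zero when t = t'.
      have hd : 0 < t' - t + 1 := by linarith
      obtain ⟨B, hB0, hB⟩ := hμ.birkhoffSum_le (div_pos hε hd)
      refine ⟨(t' - t) * B, fun n z => ?_⟩
      rw [birkhoffSum_const_mul, birkhoffSum_const_mul]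
      have h1 := mul_le_mul_of_nonneg_left (hB n z) (sub_nonneg.2 htt')
      have h2 : (t' - t) * (ε / (t' - t + 1)) ≤ ε := by
        rw [← mul_div_assoc, div_le_iff₀ hd]
        nlinarith
      have h3 := mul_le_mul_of_nonneg_left h2 (Nat.cast_nonneg (α := ℝ) n)
      linarith
  simp only
  linarith

theorem continuous_topPressure_mul [Nonempty (MarkovShift A)] {φ : MarkovShift A → ℝ}
    (hφ : Continuous φ) : Continuous fun t : ℝ => topPressure fun z => t * φ z := by
  obtain ⟨M, hM0, hM⟩ := exists_bound hφ
  have h : ∀ t t' : ℝ, topPressure (fun z => t' * φ z) ≤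
      topPressure (fun z => t * φ z) + M * |t' - t| := fun t t' => by
    refine topPressure_le_add (by fun_prop) (by fun_prop) fun ε hε => ⟨0, fun n z => ?_⟩
    rw [birkhoffSum_const_mul, birkhoffSum_const_mul]
    have h1 : (t' - t) * birkhoffSum (shift A) φ n z ≤ |t' - t| * (n * M) := by
      refine (le_abs_self _).trans ?_
      rw [abs_mul]
      exact mul_le_mul_of_nonneg_left (abs_birkhoffSum_le hM n z) (abs_nonneg _)
    have : 0 ≤ n * ε := by positivity
    linarith
  refine (LipschitzWith.of_dist_le_mul (K := M.toNNReal) fun t t' => ?_).continuous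
  rw [Real.dist_eq, Real.dist_eq, abs_le, Real.coe_toNNReal _ hM0]
  have h1 := h t t'
  have h2 := h t' t
  rw [abs_sub_comm] at h1
  constructor <;> linarith

theorem integral_birkhoffSum {μ : Measure (MarkovShift A)} [IsFiniteMeasure μ]
    (hinv : MeasurePreserving (shift A) μ μ) {φ : MarkovShift A → ℝ} (hφ : Continuous φ) (n : ℕ) :
    ∫ z, birkhoffSum (shift A) φ n z ∂μ = n * ∫ z, φ z ∂μ := by
  simp only [birkhoffSum]
  rw [integral_finsetSum _ fun k _ => integrable_of_continuous
    (show Continuous fun z => φ ((shift A)^[k] z) from hφ.comp (continuous_shift.iterate k)) μ]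
  have : ∀ k, ∫ z, φ ((shift A)^[k] z) ∂μ = ∫ z, φ z ∂μ := fun k => by
    conv_rhs => rw [← (hinv.iterate k).map_eq]
    exact (integral_map (hinv.iterate k).measurable.aemeasurable
      hφ.aestronglyMeasurable).symm
  simp [this]

/-- The inequality h + t∫φ dμ ≤ P_top(tφ) with h = P - ∫φ dμ, obtained by Jensen's inequality with
no reference to entropy. -/
theorem IsUniformGibbs.le_topPressure_mul {μ : Measure (MarkovShift A)} [IsProbabilityMeasure μ]
    {φ : MarkovShift A → ℝ} (hφ : Continuous φ) {P : ℝ} (hμ : IsUniformGibbs μ φ P)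
    (hinv : MeasurePreserving (shift A) μ μ) (t : ℝ) :
    P - ∫ z, φ z ∂μ + t * ∫ z, φ z ∂μ ≤ topPressure fun z => t * φ z := by
  have hne : Nonempty (MarkovShift A) := nonempty_of_isProbabilityMeasure μ
  have := fun k => Fintype.ofFinite (Set.range (word (A := A) k))
  obtain ⟨M, hM0, hM⟩ := exists_bound hφ
  have hψ : Continuous fun z => t * φ z := by fun_prop
  refine ge_of_tendsto_of_forall_ge (tendsto_pressureSeq hψ) fun ε hε => ?_
  obtain ⟨B, hB0, hB⟩ := hμ.2 ε hε
  refine ⟨B + M - P + ε, Eventually.of_forall fun n => ?_⟩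
  change _ ≤ Real.log (partitionSum (fun z => t * φ z) n)
  rw [Real.le_log_iff_exp_le (partitionSum_pos _ n)]
  -- On an n-cylinder C the Gibbs estimate gives exp f ≤ exp(sup_C tS_nφ) / μ(C). Hence ∫ exp f dμ
  -- is at most the partition sum of tφ.
  let f : MarkovShift A → ℝ := fun z =>
    (t - 1) * birkhoffSum (shift A) φ n z + (n * (P - ε) - (B + M - P + ε))
  have hf : Continuous f := ((continuous_birkhoffSum hφ n).const_mul _).add continuous_const
  have hint : ∫ z, f z ∂μ = n * (P - ∫ z, φ z ∂μ + t * ∫ z, φ z ∂μ - ε) - (B + M - P + ε) := by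
    rw [integral_add (integrable_of_continuous ((continuous_birkhoffSum hφ n).const_mul _) μ)
      (integrable_const _), integral_const_mul, integral_birkhoffSum hinv hφ]
    simp
    ring
  rw [← hint]
  have hexp : Continuous fun z => Real.exp (f z) := Real.continuous_exp.comp hf
  have hJ : Real.exp (∫ z, f z ∂μ) ≤ ∫ z, Real.exp (f z) ∂μ :=
    convexOn_exp.map_integral_le Real.continuous_exp.continuousOn isClosed_univ
      (ae_of_all _ fun _ => Set.mem_univ _) (integrable_of_continuous hf μ)
      (integrable_of_continuous hexp μ)
  refine hJ.trans ((integral_le_of_forall_wordCylinder (n := n) (integrable_of_continuous hexp μ)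
    (g := fun u => (μ.real (wordCylinder (u : Fin (n + 1) → I)))⁻¹ *
      Real.exp (sSup (birkhoffSum (shift A) (fun z => t * φ z) n ''
        wordCylinder (u : Fin (n + 1) → I)))) ?_).trans_eq ?_)
  · rintro ⟨_, w, rfl⟩ z hz
    have hp : 0 < μ.real (wordCylinder (word n w)) := hμ.1 n w
    have h0 := birkhoffSum_le_sSup hψ hz
    rw [birkhoffSum_const_mul] at h0
    have h1 := (abs_le.1 (hB n z)).2
    have h2 := (abs_le.1 (birkhoffSum_succ_abs_sub_le hM n z)).2
    rw [cylinder_eq_of_mem (show z ∈ cylinder n w from hz)] at h1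
    rw [inv_mul_eq_div, ← Real.exp_log hp, ← Real.exp_sub, Real.exp_le_exp]
    change _ ≤ _ - Real.log (μ.real (cylinder n w))
    simp only [f]
    linarith
  · rw [partitionSum, tsum_fintype]
    refine Finset.sum_congr rfl fun u _ => ?_
    obtain ⟨u, hu⟩ := u
    obtain ⟨w, rfl⟩ := hu
    have hp : 0 < μ.real (wordCylinder (word n w)) := hμ.1 n w
    exact mul_inv_cancel_left₀ hp.ne' _

theorem IsUniformGibbs.integral_le {μ : Measure (MarkovShift A)} [IsProbabilityMeasure μ]
    {φ : MarkovShift A → ℝ} (hφ : Continuous φ) {P : ℝ} (hμ : IsUniformGibbs μ φ P)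
    (hinv : MeasurePreserving (shift A) μ μ) : ∫ z, φ z ∂μ ≤ P := by
  have hlim : Tendsto (fun n : ℕ => 1 / (n : ℝ) * (n * ∫ z, φ z ∂μ)) atTop (𝓝 (∫ z, φ z ∂μ)) := by
    refine tendsto_const_nhds.congr' ?_
    filter_upwards [eventually_gt_atTop 0] with n hn
    have : (n : ℝ) ≠ 0 := by exact_mod_cast hn.ne'
    field_simp
  refine le_of_tendsto_of_forall_le hlim fun ε hε => ?_
  obtain ⟨B, hB0, hB⟩ := hμ.birkhoffSum_le hε
  refine ⟨B, Eventually.of_forall fun n => ?_⟩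
  rw [← integral_birkhoffSum hinv hφ]
  refine (integral_mono (integrable_of_continuous (continuous_birkhoffSum hφ n) μ)
    (integrable_const _) (hB n)).trans_eq ?_
  simp
  ring

/-- With a bounded Gibbs constant and no atoms, cylinder measures decay exponentially in their
length, so a finite s forces ℓ_n = O(n). -/
theorem exists_linear_bound_of_gibbs {μ : Measure (MarkovShift A)} [IsProbabilityMeasure μ]
    [NullSingletonClass μ] {φ : MarkovShift A → ℝ} (hμ : IsGibbs μ φ) {w : MarkovShift A}
    {ℓ : ℕ → ℕ} {s : ℝ} (hs : Tendsto (fun n : ℕ => -(1 / (n : ℝ)) *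
      Real.log (μ.real (cylinder (ℓ n) w))) atTop (𝓝 s)) :
    ∃ C : ℝ, ∀ᶠ n : ℕ in atTop, (ℓ n : ℝ) / n ≤ C := by
  obtain ⟨P, B, hB0, hB⟩ := hμ.exists_abs_log_sub_le
  -- With this threshold the normalized sum E drops by at least 1 over each block of q+1 steps: log
  -- μ(C) < -B-1 and E ≤ log μ(C) + B.
  obtain ⟨q, hq⟩ := tendsto_cylinder_measure_zero μ (Real.exp_pos (-B - 1))
  let E : ℕ → MarkovShift A → ℝ := fun n z => birkhoffSum (shift A) φ n z - n * P
  have hEadd : ∀ m n z, E (m + n) z = E m z + E n ((shift A)^[m] z) := fun m n z => by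
    simp only [E, birkhoffSum_add]
    push_cast
    ring
  have hEle : ∀ n z, E n z ≤ B := fun n z => by
    rcases n with _ | n
    · simpa [E] using hB0
    · have h1 := (abs_le.1 (hB n z).2).1
      have h2 : Real.log (μ.real (cylinder n z)) ≤ 0 :=
        Real.log_nonpos measureReal_nonneg measureReal_le_one
      simp only [E]
      push_cast
      linarith
  have hEq : ∀ z, E (q + 1) z ≤ -1 := fun z => by
    have h1 := (abs_le.1 (hB q z).2).1
    have h2 := Real.log_le_log (hB q z).1 (hq z).le
    rw [Real.log_exp] at h2
    simp only [E]
    push_cast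
    linarith
  have hEmul : ∀ j z, E (j * (q + 1)) z ≤ -j := fun j => by
    induction j with
    | zero => intro z; simp [E]
    | succ j ih =>
      intro z
      rw [Nat.succ_mul, hEadd]
      push_cast
      linarith [ih z, hEq ((shift A)^[j * (q + 1)] z)]
  have hE : ∀ n z, E n z ≤ B + 1 - n / (q + 1) := fun n z => by
    conv_lhs => rw [← Nat.div_add_mod' n (q + 1), hEadd]
    have h1 := hEmul (n / (q + 1)) z
    have h2 := hEle (n % (q + 1)) ((shift A)^[n / (q + 1) * (q + 1)] z)
    have h3 : (n : ℝ) / (q + 1) ≤ (n / (q + 1) : ℕ) + 1 := by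
      have := (Nat.lt_floor_add_one ((n : ℝ) / ((q + 1 : ℕ) : ℝ))).le
      rw [Nat.floor_div_eq_div] at this
      exact_mod_cast this
    linarith
  refine ⟨(q + 1) * (s + 1 + 2 * B + 1), ?_⟩
  filter_upwards [hs.eventually_le_const (lt_add_one s), eventually_gt_atTop 0] with n hn hn0
  have hn0' : (1 : ℝ) ≤ n := by exact_mod_cast hn0
  have hnpos : (0 : ℝ) < n := by linarith
  rw [div_le_iff₀ hnpos]
  have h1 := (abs_le.1 (hB (ℓ n) w).2).2
  have h2 := hE (ℓ n + 1) w
  simp only [E] at h2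
  push_cast at h2
  have h3 : -Real.log (μ.real (cylinder (ℓ n) w)) ≤ (s + 1) * n := by
    have := mul_le_mul_of_nonneg_right hn hnpos.le
    calc _ = -(1 / (n : ℝ)) * Real.log (μ.real (cylinder (ℓ n) w)) * n := by field_simp
      _ ≤ _ := this
  have h4 : ((ℓ n : ℝ) + 1) / (q + 1) ≤ (s + 1) * n + 2 * B + 1 := by linarith
  rw [div_le_iff₀ (by positivity)] at h4
  have h5 : (s + 1) * n + 2 * B + 1 ≤ (s + 1 + 2 * B + 1) * n := by nlinarith
  have h6 := mul_le_mul_of_nonneg_right h5 (by positivity : (0 : ℝ) ≤ q + 1)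
  nlinarith

end UniformGibbs

end MarkovShift

/-! ### Upper bound for the dimension. -/

theorem caratheodoryPre_le_tsum {X ι : Type*} [MetricSpace X] [Countable ι] {𝓕 : Set (Set X)}
    {ψ : Set X → ℝ≥0∞} {ε : ℝ} {E : Set X} (F : ι → Set X)
    (hF : ∀ i, F i ∈ 𝓕 ∧ Metric.diam (F i) ≤ ε) (hE : E ⊆ ⋃ i, F i) :
    caratheodoryPre 𝓕 ψ ε E ≤ ∑' i, ψ (F i) := by
  refine (iInf₂_le (Set.range F) (Set.countable_range F)).trans ?_
  refine (iInf₂_le ?_ ?_).trans ?_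
  · rintro _ ⟨i, rfl⟩
    exact hF i
  · rwa [Set.sUnion_range]
  · exact ENNReal.tsum_le_tsum_comp_of_surjective (f := Set.rangeFactorization F)
      Set.rangeFactorization_surjective fun G : Set.range F => ψ G

namespace MarkovShift

section UpperBound

variable {I : Type*} {A : Matrix I I (Fin 2)}

theorem mem_cylinder_add {k m : ℕ} {x y w : MarkovShift A} (h : x ∈ cylinder k y)
    (hx : (shift A)^[k] x ∈ cylinder m w) (hy : (shift A)^[k] y ∈ cylinder m w) :
    x ∈ cylinder (k + m) y := by
  refine mem_cylinder_iff.2 fun i hi => ?_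
  rcases le_total i k with hik | hik
  · exact mem_cylinder_iff.1 h i hik
  · have h1 := mem_cylinder_iff.1 hx (i - k) (by omega)
    have h2 := mem_cylinder_iff.1 hy (i - k) (by omega)
    rw [shift_iterate_apply, Nat.sub_add_cancel hik] at h1 h2
    rw [h1, h2]

/-- The Gibbs estimate is used twice, for the long cylinder at z and for the target cylinder at σ^k
z. The sums over the last m+1 times cancel exactly, so no distortion bound is needed; only the two
errors remain. -/
theorem IsUniformGibbs.log_measure_cylinder_add_le {μ : Measure (MarkovShift A)}
    {φ : MarkovShift A → ℝ} {P B ε : ℝ}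
    (hB : ∀ (n : ℕ) (x : MarkovShift A), |Real.log (μ.real (cylinder n x)) -
      (birkhoffSum (shift A) φ (n + 1) x - (n + 1) * P)| ≤ B + ε * (n + 1))
    {k m : ℕ} {z w : MarkovShift A} (hz : (shift A)^[k] z ∈ cylinder m w) :
    |Real.log (μ.real (cylinder (k + m) z)) - (birkhoffSum (shift A) φ k z - k * P +
      Real.log (μ.real (cylinder m w)))| ≤ 2 * B + ε * (k + 2 * m + 2) := by
  have h1 := abs_le.1 (hB (k + m) z)
  have h2 := abs_le.1 (hB m ((shift A)^[k] z))
  rw [cylinder_eq_of_mem hz] at h2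
  rw [add_assoc, birkhoffSum_add] at h1
  push_cast at h1
  rw [abs_le]
  constructor <;> linarith [h1.1, h1.2, h2.1, h2.2]

variable [Finite I]

theorem muDim_le_one (μ : Measure (MarkovShift A)) [IsProbabilityMeasure μ]
    [NullSingletonClass μ] (E : Set (MarkovShift A)) : muDim μ E ≤ 1 := by
  have := fun k => Fintype.ofFinite (Set.range (word (A := A) k))
  refine ENNReal.le_of_forall_pos_le_add fun η hη _ => ?_
  refine iInf₂_le_of_le (1 + η) ?_ (by simp)
  have hη' : (0 : ℝ) < η := hη
  rw [caratheodoryMass, ENNReal.iSup_eq_zero]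
  refine fun ε => ENNReal.iSup_eq_zero.2 fun hε => ?_
  rw [← nonpos_iff_eq_zero]
  refine ENNReal.le_of_forall_pos_le_add fun κ hκ _ => ?_
  rw [zero_add]
  have hκ' : (0 : ℝ) < κ := hκ
  obtain ⟨n₁, hn₁⟩ := exists_pow_lt_of_lt_one hε (by norm_num : (1 / 2 : ℝ) < 1)
  -- For cylinders of measure below κ^{1/η} one has μ^{1+η} ≤ κμ, and the measures sum to 1.
  obtain ⟨n₂, hn₂⟩ := tendsto_cylinder_measure_zero μ (Real.rpow_pos_of_pos hκ' (η : ℝ)⁻¹)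
  set n := max n₁ n₂
  refine (caratheodoryPre_le_tsum (fun u : Set.range (word (A := A) n) =>
    wordCylinder (u : Fin (n + 1) → I)) ?_ ?_).trans ?_
  · rintro ⟨_, w, rfl⟩
    refine ⟨⟨n, w, rfl⟩, (diam_cylinder_le n w).trans ?_⟩
    exact (pow_le_pow_of_le_one (by norm_num) (by norm_num) (le_max_left _ _)).trans hn₁.le
  · exact fun z _ => Set.mem_iUnion.2 ⟨⟨word n z, z, rfl⟩, rfl⟩
  · have hterm : ∀ u : Set.range (word (A := A) n),
        μ (wordCylinder (u : Fin (n + 1) → I)) ^ ((1 + η : ℝ≥0) : ℝ) ≤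
          ENNReal.ofReal (μ.real (wordCylinder (u : Fin (n + 1) → I)) * κ) := by
      rintro ⟨_, w, rfl⟩
      change μ (cylinder n w) ^ _ ≤ ENNReal.ofReal (μ.real (cylinder n w) * κ)
      rw [← ofReal_measureReal, ENNReal.ofReal_rpow_of_nonneg measureReal_nonneg (by positivity)]
      refine ENNReal.ofReal_le_ofReal ?_
      push_cast
      rw [Real.rpow_add_of_nonneg measureReal_nonneg zero_le_one hη'.le, Real.rpow_one]
      refine mul_le_mul_of_nonneg_left ?_ measureReal_nonneg
      have h1 : μ.real (cylinder n w) ≤ (κ : ℝ) ^ (η : ℝ)⁻¹ :=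
        (measureReal_mono (cylinder_anti (le_max_right _ _) w)).trans (hn₂ w).le
      refine (Real.rpow_le_rpow measureReal_nonneg h1 hη'.le).trans_eq ?_
      exact Real.rpow_inv_rpow hκ'.le hη'.ne'
    refine (ENNReal.tsum_le_tsum hterm).trans ?_
    rw [tsum_fintype, ← ENNReal.ofReal_sum_of_nonneg fun _ _ => by positivity, ← Finset.sum_mul,
      sum_measureReal_wordCylinder, one_mul, ENNReal.ofReal_coe_nnreal]

theorem IsUniformGibbs.caratheodoryMass_targetSet_eq_zero {μ : Measure (MarkovShift A)}
    [IsProbabilityMeasure μ] {φ : MarkovShift A → ℝ} (hφ : Continuous φ) {P : ℝ}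
    (hμ : IsUniformGibbs μ φ P) {ℓ : ℕ → ℕ} {w : MarkovShift A} {s : ℝ}
    (hs : Tendsto (fun n : ℕ => -(1 / (n : ℝ)) *
      Real.log (μ.real (cylinder (ℓ n) w))) atTop (𝓝 s))
    (hℓ : ∃ C : ℝ, ∀ᶠ n : ℕ in atTop, (ℓ n : ℝ) / n ≤ C) {α : ℝ} (hα : 0 < α)
    (hF : topPressure (fun z => α * φ z) - α * P - s * α < 0) (E : Set (MarkovShift A)) :
    caratheodoryMass (cylinders A) (fun F => μ F ^ α) (targetSet E ℓ w) = 0 := by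
  have hne : Nonempty (MarkovShift A) := nonempty_of_isProbabilityMeasure μ
  obtain ⟨C', hC'⟩ := hℓ
  set C := max C' 0
  have hC0 : 0 ≤ C := le_max_right _ _
  set β := s * α + α * P - topPressure (fun z => α * φ z)
  have hβ : 0 < β := by linarith
  -- At time k the error is ε in the pressure and α·ε(2+2C) in the logarithm of the cylinder, per
  -- unit of k. This choice makes the total half of the gap β.
  set ε := β / (2 * (1 + α * (2 + 2 * C))) with hεdef
  have hD : 0 < 1 + α * (2 + 2 * C) := by positivity
  have hε : 0 < ε := by positivity
  have hεβ : ε * (1 + α * (2 + 2 * C)) = β / 2 := by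
    rw [hεdef]
    field_simp
  obtain ⟨B, hB0, hB⟩ := hμ.2 ε hε
  have hψ : Continuous fun z => α * φ z := by fun_prop
  set c := α * (2 * B + 2 * ε)
  set r := Real.exp (-(β / 2)) with hr
  have hr1 : r < 1 := Real.exp_lt_one_iff.2 (by linarith)
  -- The words of length k+1 that can be followed by the target. Such a word determines a single
  -- (k+ℓ_k)-cylinder, represented by the chosen point ζ.
  let V : ∀ k : ℕ, Set (Fin (k + 1) → I) := fun k => word k '' {z | (shift A)^[k] z ∈ cylinder (ℓ k) w}
  choose ζ hζ using fun (p : Σ k, V k) => p.2.2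
  have hζs : ∀ p : Σ k, V k, (shift A)^[p.1] (ζ p) ∈ cylinder (ℓ p.1) w := fun p => (hζ p).1
  have hζw : ∀ p : Σ k, V k, word p.1 (ζ p) = p.2 := fun p => (hζ p).2
  have hsum : ∀ᶠ k : ℕ in atTop, ∑' u : V k, μ (cylinder (k + ℓ k) (ζ ⟨k, u⟩)) ^ α ≤
      ENNReal.ofReal (Real.exp c * r ^ k) := by
    filter_upwards [hC', hs.eventually_const_le (sub_lt_self s hε), eventually_gt_atTop 0,
      (tendsto_pressureSeq hψ).eventually_le_const (lt_add_of_pos_right _ hε)] with k h1 h2 h3 h4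
    have hk : (0 : ℝ) < k := by exact_mod_cast h3
    have hℓk : (ℓ k : ℝ) ≤ C * k := by
      rw [div_le_iff₀ hk] at h1
      exact h1.trans (mul_le_mul_of_nonneg_right (le_max_left _ _) hk.le)
    have hsk : Real.log (μ.real (cylinder (ℓ k) w)) ≤ -(s - ε) * k := by
      have := mul_le_mul_of_nonneg_right h2 hk.le
      have h5 : -(1 / (k : ℝ)) * Real.log (μ.real (cylinder (ℓ k) w)) * k =
          -Real.log (μ.real (cylinder (ℓ k) w)) := by field_simp
      linarith
    have hZ : partitionSum (fun z => α * φ z) k ≤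
        Real.exp (k * (topPressure (fun z => α * φ z) + ε)) := by
      rw [← Real.log_le_iff_le_exp (partitionSum_pos _ k)]
      rw [pressureSeq_eq, one_div, inv_mul_le_iff₀ hk] at h4
      exact h4
    set d := α * (2 * B + ε * (2 * k + 2 * C * k + 2)) - α * (P + s) * k
    have hterm : ∀ u : V k, μ (cylinder (k + ℓ k) (ζ ⟨k, u⟩)) ^ α ≤ ENNReal.ofReal
        (Real.exp (birkhoffSum (shift A) (fun z => α * φ z) k (ζ ⟨k, u⟩)) * Real.exp d) := by
      intro u
      have h6 := (abs_le.1 (IsUniformGibbs.log_measure_cylinder_add_le hB (hζs ⟨k, u⟩))).2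
      have hpos := hμ.1 (k + ℓ k) (ζ ⟨k, u⟩)
      rw [← ofReal_measureReal, ENNReal.ofReal_rpow_of_pos hpos]
      refine ENNReal.ofReal_le_ofReal ?_
      rw [Real.rpow_def_of_pos hpos, ← Real.exp_add, Real.exp_le_exp, birkhoffSum_const_mul,
        mul_comm]
      have h7 : Real.log (μ.real (cylinder (k + ℓ k) (ζ ⟨k, u⟩))) ≤
          birkhoffSum (shift A) φ k (ζ ⟨k, u⟩) + (2 * B + ε * (2 * k + 2 * C * k + 2)) -
            (P + s) * k := by
        have := mul_le_mul_of_nonneg_left hℓk hε.le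
        dsimp only at h6
        linarith
      have := mul_le_mul_of_nonneg_left h7 hα.le
      simp only [d]
      linarith
    refine (ENNReal.tsum_le_tsum hterm).trans ?_
    rw [← ENNReal.ofReal_tsum_of_nonneg (fun _ => by positivity) Summable.of_finite, tsum_mul_right]
    refine ENNReal.ofReal_le_ofReal ?_
    have hle : ∑' u : V k, Real.exp (birkhoffSum (shift A) (fun z => α * φ z) k (ζ ⟨k, u⟩)) ≤
        partitionSum (fun z => α * φ z) k := by
      refine Summable.tsum_le_tsum_of_inj (fun u : V k => ⟨u, ζ ⟨k, u⟩, hζw ⟨k, u⟩⟩)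
        (fun u v h => Subtype.ext (Subtype.mk.inj h)) (fun _ _ => by positivity)
        (fun u => ?_) Summable.of_finite Summable.of_finite
      exact Real.exp_le_exp.2 (birkhoffSum_le_sSup hψ (hζw ⟨k, u⟩))
    refine (mul_le_mul_of_nonneg_right (hle.trans hZ) (Real.exp_pos _).le).trans ?_
    rw [hr, ← Real.exp_nat_mul, ← Real.exp_add, ← Real.exp_add, Real.exp_le_exp]
    have h8 := congrArg (fun x => x * (k : ℝ)) hεβ
    simp only [d, c, β] at h8 ⊢
    linarith
  have hfin : ∑' k : ℕ, ENNReal.ofReal (Real.exp c * r ^ k) ≠ ∞ :=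
    ((summable_geometric_of_lt_one (Real.exp_pos _).le hr1).mul_left _).tsum_ofReal_ne_top
  obtain ⟨K₀, hK₀⟩ := eventually_atTop.1 hsum
  rw [caratheodoryMass, ENNReal.iSup_eq_zero]
  refine fun δ => ENNReal.iSup_eq_zero.2 fun hδ => ?_
  obtain ⟨K₁, hK₁⟩ := exists_pow_lt_of_lt_one hδ (by norm_num : (1 / 2 : ℝ) < 1)
  rw [← nonpos_iff_eq_zero]
  refine ge_of_tendsto (ENNReal.tendsto_sum_nat_add _ hfin) ?_
  -- As in Borel-Cantelli: each point of the target set hits at some time k ≥ K, and the tail of the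
  -- geometric series tends to 0.
  filter_upwards [eventually_ge_atTop K₀, eventually_ge_atTop K₁] with K hK0 hK1
  refine (caratheodoryPre_le_tsum (fun p : Σ j : ℕ, V (j + K) =>
    cylinder (p.1 + K + ℓ (p.1 + K)) (ζ ⟨p.1 + K, p.2⟩)) (fun p => ?_) ?_).trans ?_
  · refine ⟨⟨p.1 + K + ℓ (p.1 + K), ζ ⟨p.1 + K, p.2⟩, rfl⟩, ?_⟩
    refine (diam_cylinder_le _ _).trans (le_trans ?_ hK₁.le)
    exact pow_le_pow_of_le_one (by norm_num) (by norm_num) (by omega)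
  · rintro z ⟨-, hz⟩
    obtain ⟨k, hkK, hk⟩ := (frequently_atTop.1 hz) K
    obtain ⟨j, rfl⟩ := Nat.exists_eq_add_of_le' hkK
    let u : V (j + K) := ⟨word (j + K) z, z, hk, rfl⟩
    exact Set.mem_iUnion.2 ⟨⟨j, u⟩, mem_cylinder_add (hζw ⟨j + K, u⟩).symm hk (hζs ⟨j + K, u⟩)⟩
  · rw [ENNReal.tsum_sigma' fun p : Σ j : ℕ, V (j + K) =>
      μ (cylinder (p.1 + K + ℓ (p.1 + K)) (ζ ⟨p.1 + K, p.2⟩)) ^ α]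
    exact ENNReal.tsum_le_tsum fun j => hK₀ (j + K) (by omega)

end UpperBound

end MarkovShift

namespace MarkovShift

/-! ### Lower bound: the pigeonhole argument for one generation. -/

section LowerBound

variable {I : Type*} {A : Matrix I I (Fin 2)}

/-- The points of the `k`-cylinder of `z` that hit the target `C(m, w)` at time `k`. -/
def hitCylinder (k m : ℕ) (w z : MarkovShift A) : Set (MarkovShift A) :=
  cylinder k z ∩ (shift A)^[k] ⁻¹' cylinder m w

/-- A nonempty set of this kind is a single cylinder of order k+m, so it is nested with or disjoint
from any other cylinder. -/
theorem hitCylinder_eq_cylinder {k m : ℕ} {w z y : MarkovShift A} (hy : y ∈ hitCylinder k m w z) :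
    hitCylinder k m w z = cylinder (k + m) y := by
  refine Set.Subset.antisymm (fun x hx => ?_) fun x hx => ⟨?_, ?_⟩
  · refine mem_cylinder_add ?_ hx.2 hy.2
    rw [cylinder_eq_of_mem hy.1]
    exact hx.1
  · rw [← cylinder_eq_of_mem hy.1]
    exact cylinder_anti (Nat.le_add_right k m) y hx
  · rw [Set.mem_preimage, ← cylinder_eq_of_mem hy.2]
    refine mem_cylinder_iff.2 fun i hi => ?_
    rw [shift_iterate_apply, shift_iterate_apply]
    exact mem_cylinder_iff.1 hx _ (by omega)

theorem hitCylinder_nonempty {k m : ℕ} {w z : MarkovShift A} (h : z.1 k = w.1 0) :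
    (hitCylinder k m w z).Nonempty :=
  ⟨glue k z w h, glue_mem_cylinder h, by
    rw [Set.mem_preimage, shift_iterate_glue]; exact self_mem_cylinder m w⟩

theorem tsum_indicator_union_le {X ι : Type*} {S : Set (Set X)} {ψ : Set X → ℝ≥0∞}
    {𝒜₀ 𝒜 : Set (Set X)} {U : Finset ι} {𝓑 : ι → Set (Set X)} (h0 : S ∩ 𝒜₀ ⊆ 𝒜)
    (h1 : ∀ u ∈ U, S ∩ 𝓑 u ⊆ 𝒜) (h01 : ∀ u ∈ U, ∀ F ∈ S, F ∈ 𝒜₀ → F ∉ 𝓑 u)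
    (h11 : ∀ u ∈ U, ∀ v ∈ U, ∀ F ∈ S, F ∈ 𝓑 u → F ∈ 𝓑 v → u = v) :
    ∑' F, (S ∩ 𝒜₀).indicator ψ F + ∑ u ∈ U, ∑' F, (S ∩ 𝓑 u).indicator ψ F ≤
      ∑' F, (S ∩ 𝒜).indicator ψ F := by
  classical
  rw [← Summable.tsum_finsetSum fun _ _ => ENNReal.summable, ← ENNReal.tsum_add]
  refine ENNReal.tsum_le_tsum fun F => ?_
  by_cases hS : F ∈ S
  swap
  · simp [Set.indicator, hS]
  by_cases hF0 : F ∈ 𝒜₀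
  · have hA : F ∈ 𝒜 := h0 ⟨hS, hF0⟩
    rw [Finset.sum_eq_zero fun u hu =>
      Set.indicator_of_notMem (fun h => h01 u hu F hS hF0 h.2) ψ, add_zero]
    simp [Set.indicator, hS, hF0, hA]
  rw [Set.indicator_of_notMem (fun h => hF0 h.2), zero_add]
  by_cases hu : ∃ u ∈ U, F ∈ 𝓑 u
  · obtain ⟨u, hu, hFu⟩ := hu
    rw [Finset.sum_eq_single_of_mem u hu fun v hv hvu =>
      Set.indicator_of_notMem (fun h => hvu (h11 v hv u hu F hS h.2 hFu)) ψ]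
    have hA : F ∈ 𝒜 := h1 u hu ⟨hS, hFu⟩
    simp [Set.indicator, hS, hFu, hA]
  · push Not at hu
    rw [Finset.sum_eq_zero fun u hu' => Set.indicator_of_notMem (fun h => hu u hu' h.2) ψ]
    exact zero_le

variable [Finite I]

/-- In a mass distribution dominated by the weights of cylinders, some cylinder of the next
generation is not covered and sees less weight of the cover than its own mass. -/
theorem exists_hitCylinder_lt {κ : Measure (MarkovShift A)} {S : Set (Set (MarkovShift A))}
    (hScyl : S ⊆ cylinders A) (hSc : S.Countable) {ψ : Set (MarkovShift A) → ℝ≥0∞}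
    (hψ : Monotone ψ) {L k m : ℕ} (hLk : L ≤ k) {x w : MarkovShift A}
    (h1 : ∀ n ≥ L, ∀ y ∈ cylinder L x, κ (cylinder n y) ≤ ψ (cylinder n y))
    (h2 : ∀ z ∈ cylinder L x, z.1 k = w.1 0 → κ (cylinder k z) ≤ ψ (hitCylinder k m w z))
    (h3 : ∑' F, (S ∩ {F | F ⊆ cylinder L x}).indicator ψ F <
      κ (cylinder L x ∩ {z | z.1 k = w.1 0}))
    (h4 : ∀ F ∈ S, ¬ cylinder L x ⊆ F) :
    ∃ z ∈ cylinder L x, z.1 k = w.1 0 ∧ (∀ F ∈ S, ¬ hitCylinder k m w z ⊆ F) ∧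
      ∑' F, (S ∩ {F | F ⊆ hitCylinder k m w z}).indicator ψ F < κ (cylinder k z) := by
  classical
  -- Let E₁ consist of the points whose hitting cylinder lies in a member of S, and E₂ of the rest.
  -- The masses of E₁ and E₂ are charged to disjoint subfamilies of S inside the starting cylinder,
  -- so their sum cannot exceed the available weight.
  by_contra! hcon
  set E := cylinder L x ∩ {z : MarkovShift A | z.1 k = w.1 0} with hE
  set E₁ : Set (MarkovShift A) := {z | z ∈ E ∧ ∃ F ∈ S, hitCylinder k m w z ⊆ F} with hE1
  set E₂ : Set (MarkovShift A) := {z | z ∈ E ∧ ∀ F ∈ S, ¬ hitCylinder k m w z ⊆ F} with hE2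
  set 𝒜₁ : Set (Set (MarkovShift A)) :=
    {F | F ⊆ cylinder L x ∧ ∃ z ∈ E, hitCylinder k m w z ⊆ F} with hA1
  have hhit : ∀ z ∈ E, hitCylinder k m w z ⊆ cylinder L x := fun z hz =>
    Set.inter_subset_left.trans (cylinder_subset_of_mem hLk (self_mem_cylinder k z) hz.1)
  have hE12 : E ⊆ E₁ ∪ E₂ := fun z hz => by
    by_cases h : ∃ F ∈ S, hitCylinder k m w z ⊆ F
    · exact Or.inl ⟨hz, h⟩
    · exact Or.inr ⟨hz, by simpa using h⟩
  have hbound1 : κ E₁ ≤ ∑' F, (S ∩ 𝒜₁).indicator ψ F := by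
    have hsub : E₁ ⊆ ⋃ F ∈ S ∩ 𝒜₁, {z | z ∈ E ∧ hitCylinder k m w z ⊆ F} := by
      rintro z ⟨hz, F, hF, hzF⟩
      refine Set.mem_biUnion (x := F) ⟨hF, ?_, z, hz, hzF⟩ ⟨hz, hzF⟩
      obtain ⟨y, hy⟩ := hitCylinder_nonempty (m := m) (w := w) hz.2
      obtain ⟨n, v, rfl⟩ := hScyl hF
      rcases le_total L n with hn | hn
      · exact cylinder_subset_of_mem hn (hzF hy) (hhit z hz hy)
      · exact absurd (cylinder_subset_of_mem hn (hhit z hz hy) (hzF hy)) (h4 _ hF)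
    refine (measure_mono hsub).trans ((measure_biUnion_le κ (hSc.mono Set.inter_subset_left) _).trans ?_)
    rw [← tsum_subtype (S ∩ 𝒜₁) ψ]
    refine ENNReal.tsum_le_tsum ?_
    rintro ⟨F, hF, hFD, z₀, hz₀, hz₀F⟩
    obtain ⟨y₀, hy₀⟩ := hitCylinder_nonempty (m := m) (w := w) hz₀.2
    obtain ⟨n, v, rfl⟩ := hScyl hF
    have hnL : L ≤ n := by
      by_contra hn
      exact h4 _ hF (cylinder_subset_of_mem (not_le.1 hn).le (hhit z₀ hz₀ hy₀) (hz₀F hy₀))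
    -- A member of order n ≤ k contains all the points charged to it. One of order n ≥ k meets a
    -- single k-cylinder, whose mass is already bounded by the weight of its hitting part.
    rcases le_total n k with hnk | hnk
    · refine (measure_mono ?_).trans (h1 n hnL v (hFD (self_mem_cylinder n v)))
      rintro z ⟨hz, hzF⟩
      obtain ⟨y, hy⟩ := hitCylinder_nonempty (m := m) (w := w) hz.2
      exact cylinder_subset_of_mem hnk hy.1 (hzF hy) (self_mem_cylinder k z)
    · refine le_trans (measure_mono ?_) ((h2 z₀ hz₀.1 hz₀.2).trans (hψ hz₀F))
      rintro z ⟨hz, hzF⟩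
      obtain ⟨y, hy⟩ := hitCylinder_nonempty (m := m) (w := w) hz.2
      have hyy : y ∈ cylinder k y₀ :=
        cylinder_subset_of_mem hnk (hz₀F hy₀) (self_mem_cylinder k y₀) (hzF hy)
      rw [cylinder_eq_of_mem hy₀.1] at hyy
      rw [← cylinder_eq_of_mem hyy, cylinder_eq_of_mem hy.1]
      exact self_mem_cylinder k z
  have hfin : (word k '' E₂).Finite := (Set.toFinite (Set.range (word (A := A) k))).subset
    (Set.image_subset_range _ _)
  choose ζ hζ using fun u : word k '' E₂ => u.2
  have := hfin.fintype
  have hbound2 : κ E₂ ≤ ∑ u : word k '' E₂, ∑' F,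
      (S ∩ {F | F ⊆ hitCylinder k m w (ζ u)}).indicator ψ F := by
    have hsub : E₂ ⊆ ⋃ u ∈ (Finset.univ : Finset (word k '' E₂)), cylinder k (ζ u) := fun z hz => by
      let u : word k '' E₂ := ⟨word k z, z, hz, rfl⟩
      have hu : z ∈ cylinder k (ζ u) := (hζ u).2.symm
      exact Set.mem_biUnion (Finset.mem_coe.2 (Finset.mem_univ u)) hu
    refine (measure_mono hsub).trans ((measure_biUnion_finset_le _ _).trans ?_)
    exact Finset.sum_le_sum fun u _ => hcon (ζ u) (hζ u).1.1.1 (hζ u).1.1.2 (hζ u).1.2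
  refine absurd h3 (not_lt.2 ?_)
  refine (measure_mono hE12).trans ((measure_union_le _ _).trans
    ((add_le_add hbound1 hbound2).trans (tsum_indicator_union_le ?_ ?_ ?_ ?_)))
  · exact fun F hF => hF.2.1
  · exact fun u _ F hF => hF.2.trans (hhit _ (hζ u).1.1)
  -- A member charged in both ways would contain one hitting cylinder and be contained in another.
  -- The two would coincide, contradicting that the latter is uncovered.
  · rintro u - F hF ⟨-, z, hz, hzF⟩ hFu
    obtain ⟨y, hy⟩ := hitCylinder_nonempty (m := m) (w := w) hz.2
    refine (hζ u).1.2 F hF ?_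
    have hyu := hFu (hzF hy)
    have : hitCylinder k m w (ζ u) = hitCylinder k m w z := by
      rw [hitCylinder_eq_cylinder hyu, hitCylinder_eq_cylinder hy]
    rwa [this]
  · intro u _ v _ F hF hFu hFv
    obtain ⟨n, y, rfl⟩ := hScyl hF
    have hyu := (hFu (self_mem_cylinder n y)).1
    have hyv := (hFv (self_mem_cylinder n y)).1
    refine Subtype.ext ?_
    rw [← (hζ u).2, ← (hζ v).2]
    exact (show word k y = word k (ζ u) from hyu).symm.trans hyv

end LowerBound

end MarkovShift

namespace MarkovShift

/-! ### Lower bound: passing to the next generation. -/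

section MassDistribution

variable {I : Type*} {A : Matrix I I (Fin 2)}

/-- A cylinder carrying a mass `a` that is small against its weight, but large against the weight
of the members of `S` inside it. -/
structure IsUncovered (μ : Measure (MarkovShift A)) (S : Set (Set (MarkovShift A)))
    (t ε D : ℝ) (L : ℕ) (x : MarkovShift A) (a : ℝ) : Prop where
  pos : 0 < a
  log_le : Real.log a ≤ t * Real.log (μ.real (cylinder L x)) - 4 * ε * (L + 1) - D
  tsum_lt : ∑' F, (S ∩ {F | F ⊆ cylinder L x}).indicator (fun F => μ F ^ t) F < ENNReal.ofReal a
  not_subset : ∀ F ∈ S, ¬ cylinder L x ⊆ F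

theorem ofReal_le_measure_rpow {X : Type*} [MeasurableSpace X] {μ : Measure X} [IsFiniteMeasure μ]
    {F : Set X} (hF : 0 < μ.real F) {a t : ℝ} (ha : 0 < a)
    (h : Real.log a ≤ t * Real.log (μ.real F)) : ENNReal.ofReal a ≤ μ F ^ t := by
  rw [← ofReal_measureReal, ENNReal.ofReal_rpow_of_pos hF]
  refine ENNReal.ofReal_le_ofReal ?_
  rwa [Real.rpow_def_of_pos hF, ← Real.log_le_iff_le_exp ha, mul_comm]

variable [Finite I]

/-- The mass a is spread over the part of the cylinder with z_k = w_0, in proportion to m, for a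
very late time k. The slack 4ε(L+1) + D reserved at each stage absorbs all Gibbs errors between
orders L and n: 2ε(L+1) at order L, and 2ε(n+1) at order n, whose excess over 2ε(L+1) is paid by the
gap P' - tP ≥ 2ε. The strict gap P' - tP - ts restores the slack at order k+ℓ_k. -/
theorem IsUncovered.exists_next {μ m : Measure (MarkovShift A)} [IsProbabilityMeasure μ]
    [IsProbabilityMeasure m] {φ : MarkovShift A → ℝ} {M P P' t s ε B C : ℝ}
    (hM0 : 0 ≤ M) (hM : ∀ z, |φ z| ≤ M) (ht0 : 0 ≤ t) (ht1 : t ≤ 1) (hε : 0 < ε)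
    (hμpos : ∀ n x, 0 < μ.real (cylinder n x)) (hmpos : ∀ n x, 0 < m.real (cylinder n x))
    (hB0 : 0 ≤ B)
    (hBμ : ∀ (n : ℕ) (x : MarkovShift A), |Real.log (μ.real (cylinder n x)) -
      (birkhoffSum (shift A) φ (n + 1) x - (n + 1) * P)| ≤ B + ε * (n + 1))
    (hBm : ∀ (n : ℕ) (x : MarkovShift A), |Real.log (m.real (cylinder n x)) -
      (t * birkhoffSum (shift A) φ (n + 1) x - (n + 1) * P')| ≤ B + ε * (n + 1))
    (hmix : ∀ B C : Set (MarkovShift A), MeasurableSet B → MeasurableSet C →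
      Tendsto (fun n : ℕ => m (B ∩ (shift A)^[n] ⁻¹' C)) atTop (𝓝 (m B * m C)))
    {ℓ : ℕ → ℕ} {w : MarkovShift A} (hℓ : ∀ᶠ k : ℕ in atTop, (ℓ k : ℝ) ≤ C * k)
    (hs : ∀ᶠ k : ℕ in atTop, -(s + ε) * k ≤ Real.log (μ.real (cylinder (ℓ k) w)))
    (hG : 2 * ε ≤ P' - t * P) (hF0 : 0 < P' - t * P - t * s)
    (hF : ε * (7 + 6 * C) ≤ (P' - t * P - t * s) / 2)
    {S : Set (Set (MarkovShift A))} (hScyl : S ⊆ cylinders A) {D : ℝ}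
    (hD : 4 * B + (Real.log 2 - Real.log (m.real (cylinder 0 w))) ≤ D)
    {L : ℕ} {x : MarkovShift A} {a : ℝ} (ha : IsUncovered μ S t ε D L x a) :
    ∃ (k : ℕ) (z : MarkovShift A) (a' : ℝ), L < k ∧ z ∈ cylinder L x ∧
      (shift A)^[k] z ∈ cylinder (ℓ k) w ∧ IsUncovered μ S t ε D (k + ℓ k) z a' := by
  have hSc : S.Countable := countable_cylinders.mono hScyl
  set c₁ := Real.log 2 - Real.log (m.real (cylinder 0 w)) with hc1
  -- Mixing: the conditioned set has at least half its asymptotic measure, so conditioning costs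
  -- only the constant c₁, which does not depend on the stage.
  have hev : ∀ᶠ k : ℕ in atTop, m.real (cylinder L x) * m.real (cylinder 0 w) / 2 <
      m.real (cylinder L x ∩ (shift A)^[k] ⁻¹' cylinder 0 w) := by
    have h := (ENNReal.tendsto_toReal (ENNReal.mul_ne_top (measure_ne_top m _)
      (measure_ne_top m _))).comp (hmix _ _ (measurableSet_cylinder L x) (measurableSet_cylinder 0 w))
    rw [ENNReal.toReal_mul] at h
    exact h.eventually_const_lt (half_lt_self (mul_pos (hmpos L x) (hmpos 0 w)))
  -- This constant depends on the current stage, but k is chosen afterwards and the linear gain in k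
  -- overwhelms it.
  set c₀ := Real.log a - Real.log (m.real (cylinder L x)) + c₁ + M + |P'| with hc0
  have hev2 : ∀ᶠ k : ℕ in atTop, c₀ + 3 * B + D + 7 * ε ≤ (P' - t * P - t * s) / 2 * k :=
    (tendsto_natCast_atTop_atTop.const_mul_atTop (half_pos hF0)).eventually_ge_atTop _
  obtain ⟨k, hk1, hk2, hk3, hk4, hkL⟩ :=
    (hev.and (hev2.and (hℓ.and (hs.and (eventually_gt_atTop L))))).exists
  have hEeq : cylinder L x ∩ (shift A)^[k] ⁻¹' cylinder 0 w =
      cylinder L x ∩ {z : MarkovShift A | z.1 k = w.1 0} := by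
    ext z
    have : (shift A)^[k] z ∈ cylinder 0 w ↔ z.1 k = w.1 0 := by
      simp [mem_cylinder_iff, shift_iterate_apply]
    exact and_congr_right fun _ => this
  rw [hEeq] at hk1
  set E := cylinder L x ∩ {z : MarkovShift A | z.1 k = w.1 0} with hE
  have hEm : MeasurableSet E := by
    rw [← hEeq]
    exact (measurableSet_cylinder L x).inter
      ((measurable_shift.iterate k) (measurableSet_cylinder 0 w))
  have hEpos : 0 < m.real E := lt_trans (by have := hmpos L x; have := hmpos 0 w; positivity) hk1
  have hElog : Real.log (m.real (cylinder L x)) - c₁ ≤ Real.log (m.real E) := by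
    have := Real.log_le_log (by have := hmpos L x; have := hmpos 0 w; positivity) hk1.le
    rw [Real.log_div (mul_pos (hmpos L x) (hmpos 0 w)).ne' two_ne_zero,
      Real.log_mul (hmpos L x).ne' (hmpos 0 w).ne'] at this
    rw [hc1]
    linarith
  have hapos := ha.pos
  set κ : Measure (MarkovShift A) := ENNReal.ofReal (a / m.real E) • m.restrict E with hκ
  have hκE : κ E = ENNReal.ofReal a := by
    rw [hκ, Measure.smul_apply, Measure.restrict_apply_self, smul_eq_mul, ← ofReal_measureReal,
      ← ENNReal.ofReal_mul (by positivity), div_mul_cancel₀ _ hEpos.ne']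
  have hκle : ∀ G : Set (MarkovShift A), κ G ≤ ENNReal.ofReal (a / m.real E * m.real G) := by
    intro G
    rw [hκ, Measure.smul_apply, smul_eq_mul, ENNReal.ofReal_mul (by positivity), ofReal_measureReal]
    gcongr
    exact Measure.restrict_le_self
  have hlogκ : ∀ n y, Real.log (a / m.real E * m.real (cylinder n y)) ≤
      Real.log a - Real.log (m.real (cylinder L x)) + c₁ + Real.log (m.real (cylinder n y)) := by
    intro n y
    rw [Real.log_mul (div_pos hapos hEpos).ne' (hmpos n y).ne', Real.log_div hapos.ne' hEpos.ne']
    linarith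
  -- The new mass meets the requirement at order k+ℓ_k. The errors add up to at most ε(7k + 6ℓ_k)
  -- plus constants, hence the condition with 7 + 6C.
  have hkey : ∀ z ∈ cylinder L x, z.1 k = w.1 0 →
      ∀ y ∈ hitCylinder k (ℓ k) w z, Real.log (a / m.real E * m.real (cylinder k z)) ≤
        t * Real.log (μ.real (cylinder (k + ℓ k) y)) - 4 * ε * ((k + ℓ k : ℕ) + 1) - D := by
    intro z hz hzk y hy
    have h1 := hlogκ k z
    rw [← cylinder_eq_of_mem hy.1] at h1 ⊢
    have h2 := (abs_le.1 (hBm k y)).2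
    have h3 : t * birkhoffSum (shift A) φ (k + 1) y ≤ t * birkhoffSum (shift A) φ k y + M := by
      have := (abs_le.1 (birkhoffSum_succ_abs_sub_le hM k y)).2
      nlinarith
    have h4 := (abs_le.1 (IsUniformGibbs.log_measure_cylinder_add_le hBμ hy.2)).1
    have h5 : t * (birkhoffSum (shift A) φ k y - k * P - (s + ε) * k - (2 * B + ε * (k + 2 * ℓ k + 2)))
        ≤ t * Real.log (μ.real (cylinder (k + ℓ k) y)) :=
      mul_le_mul_of_nonneg_left (by linarith) ht0
    have h6 : t * (2 * B + ε * (k + 2 * ℓ k + 2)) ≤ 2 * B + ε * (k + 2 * ℓ k + 2) :=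
      mul_le_of_le_one_left (by positivity) ht1
    have h7 : t * (ε * k) ≤ ε * k := mul_le_of_le_one_left (by positivity) ht1
    have h8 := mul_le_mul_of_nonneg_left hk3 hε.le
    have h9 := mul_le_mul_of_nonneg_right hF (Nat.cast_nonneg (α := ℝ) k)
    have h10 := neg_abs_le P'
    push_cast
    simp only [hc0] at hk2
    linarith
  have hnext := exists_hitCylinder_lt (κ := κ) (ψ := fun F => μ F ^ t) (m := ℓ k) (w := w) hScyl hSc
    (fun F G h => ENNReal.rpow_le_rpow (measure_mono h) ht0) hkL.le (x := x) ?_ ?_ ?_ ha.not_subset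
  · obtain ⟨z, hz, hzk, hz1, hz2⟩ := hnext
    obtain ⟨y, hy⟩ := hitCylinder_nonempty (m := ℓ k) hzk
    rw [hitCylinder_eq_cylinder hy] at hz1 hz2
    refine ⟨k, y, a / m.real E * m.real (cylinder k z), hkL, ?_, hy.2,
      mul_pos (div_pos hapos hEpos) (hmpos k z), hkey z hz hzk y hy, hz2.trans_le (hκle _), hz1⟩
    exact cylinder_subset_of_mem hkL.le (self_mem_cylinder k z) hz hy.1
  · intro n hn y hy
    refine (hκle _).trans (ofReal_le_measure_rpow (hμpos n y)
      (mul_pos (div_pos hapos hEpos) (hmpos n y)) ?_)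
    have h1 := hlogκ n y
    have h2 := (abs_le.1 (hBm n y)).2
    have h3 := (abs_le.1 (hBμ n y)).1
    have h4 := (abs_le.1 (hBm L y)).1
    have h5 := (abs_le.1 (hBμ L y)).2
    have h6 := ha.log_le
    rw [← cylinder_eq_of_mem hy] at h1 h6
    have h7 : t * (birkhoffSum (shift A) φ (n + 1) y - (n + 1) * P - (B + ε * (n + 1))) ≤
        t * Real.log (μ.real (cylinder n y)) := mul_le_mul_of_nonneg_left (by linarith) ht0
    have h8 : t * Real.log (μ.real (cylinder L y)) ≤
        t * (birkhoffSum (shift A) φ (L + 1) y - (L + 1) * P + (B + ε * (L + 1))) :=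
      mul_le_mul_of_nonneg_left (by linarith) ht0
    have h9 : t * (B + ε * (n + 1)) ≤ B + ε * (n + 1) :=
      mul_le_of_le_one_left (by positivity) ht1
    have h10 : t * (B + ε * (L + 1)) ≤ B + ε * (L + 1) :=
      mul_le_of_le_one_left (by positivity) ht1
    have hn' : (0 : ℝ) ≤ n - L := sub_nonneg.2 (by exact_mod_cast hn)
    have h11 := mul_le_mul_of_nonneg_right hG hn'
    linarith
  · intro z hz hzk
    obtain ⟨y, hy⟩ := hitCylinder_nonempty (m := ℓ k) hzk
    rw [hitCylinder_eq_cylinder hy]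
    have hB' : c₁ + 4 * B ≤ D := by linarith
    have hc1' : 0 ≤ c₁ := by
      have h1 : Real.log (m.real (cylinder 0 w)) ≤ 0 :=
        Real.log_nonpos measureReal_nonneg measureReal_le_one
      have h2 := Real.log_nonneg one_le_two
      rw [hc1]
      linarith
    refine (hκle _).trans (ofReal_le_measure_rpow (hμpos _ y)
      (mul_pos (div_pos hapos hEpos) (hmpos k z)) ?_)
    have h1 := hkey z hz hzk y hy
    have : 0 ≤ 4 * ε * (((k + ℓ k : ℕ) : ℝ) + 1) := by positivity
    linarith
  · rw [hκE]
    exact ha.tsum_lt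

end MassDistribution

end MarkovShift

namespace MarkovShift

/-! ### Lower bound: the nested construction and the uncovered point. -/

section LowerBoundConclusion

variable {I : Type*} {A : Matrix I I (Fin 2)}

theorem exists_forall_mem_cylinder {L : ℕ → ℕ} {x : ℕ → MarkovShift A} (hL : ∀ j, j ≤ L j)
    (hx : ∀ i j, i ≤ j → x j ∈ cylinder (L i) (x i)) :
    ∃ z : MarkovShift A, ∀ j, z ∈ cylinder (L j) (x j) := by
  have hz : ∀ i j, i ≤ j → (x j).1 i = (x i).1 i := fun i j hij =>
    mem_cylinder_iff.1 (hx i j hij) i (hL i)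
  refine ⟨⟨fun i => (x i).1 i, fun i => ?_⟩, fun j => mem_cylinder_iff.2 fun i hi => ?_⟩
  · change A ((x i).1 i) ((x (i + 1)).1 (i + 1)) = 1
    rw [← hz i (i + 1) i.le_succ]
    exact (x (i + 1)).2 i
  · rcases le_total i j with hij | hij
    · exact (hz i j hij).symm
    · exact mem_cylinder_iff.1 (hx j i hij) i hi

variable [Finite I]

theorem IsUniformGibbs.le_muDim_targetSet {μ m : Measure (MarkovShift A)} [IsProbabilityMeasure μ]
    [IsProbabilityMeasure m] {φ : MarkovShift A → ℝ} (hφ : Continuous φ) {P P' t s : ℝ}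
    (ht0 : 0 < t) (ht1 : t ≤ 1) (hμ : IsUniformGibbs μ φ P)
    (hm : IsUniformGibbs m (fun z => t * φ z) P') (hmix : IsMixingMeasure (shift A) m)
    {ℓ : ℕ → ℕ} {w : MarkovShift A} (hs : Tendsto (fun n : ℕ => -(1 / (n : ℝ)) *
      Real.log (μ.real (cylinder (ℓ n) w))) atTop (𝓝 s)) (hs0 : 0 ≤ s)
    (hℓ : ∃ C : ℝ, ∀ᶠ n : ℕ in atTop, (ℓ n : ℝ) / n ≤ C) (hF : 0 < P' - t * P - t * s)
    (N : ℕ) (p : MarkovShift A) :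
    ENNReal.ofReal t ≤ muDim μ (targetSet (cylinder N p) ℓ w) := by
  obtain ⟨M, hM0, hM⟩ := exists_bound hφ
  obtain ⟨C', hC'⟩ := hℓ
  set C := max C' 0
  have hC0 : 0 ≤ C := le_max_right _ _
  set F := P' - t * P - t * s with hFdef
  set ε := F / (2 * (7 + 6 * C)) with hεdef
  have hε : 0 < ε := by positivity
  have hεF : ε * (7 + 6 * C) = F / 2 := by rw [hεdef]; field_simp
  have hG : 2 * ε ≤ P' - t * P := by
    have : 0 ≤ ε * C := by positivity
    have : 0 ≤ t * s := by positivity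
    linarith
  have hℓ' : ∀ᶠ k : ℕ in atTop, (ℓ k : ℝ) ≤ C * k := by
    filter_upwards [hC', eventually_gt_atTop 0] with k h1 h3
    have hk : (0 : ℝ) < k := by exact_mod_cast h3
    rw [div_le_iff₀ hk] at h1
    exact h1.trans (mul_le_mul_of_nonneg_right (le_max_left _ _) hk.le)
  have hs' : ∀ᶠ k : ℕ in atTop, -(s + ε) * k ≤ Real.log (μ.real (cylinder (ℓ k) w)) := by
    filter_upwards [hs.eventually_le_const (lt_add_of_pos_right s hε), eventually_gt_atTop 0]
      with k h2 h3
    have hk : (0 : ℝ) < k := by exact_mod_cast h3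
    have := mul_le_mul_of_nonneg_right h2 hk.le
    have h5 : -(1 / (k : ℝ)) * Real.log (μ.real (cylinder (ℓ k) w)) * k =
        -Real.log (μ.real (cylinder (ℓ k) w)) := by field_simp
    linarith
  obtain ⟨B₁, hB₁0, hB₁⟩ := hμ.2 ε hε
  obtain ⟨B₂, hB₂0, hB₂⟩ := hm.2 ε hε
  set B := max B₁ B₂
  set D := 4 * B + (Real.log 2 - Real.log (m.real (cylinder 0 w))) with hD
  refine le_iInf₂ fun α hα => ?_
  by_contra hαt
  have hαt' : (α : ℝ) < t := by
    rw [not_le, ← ENNReal.ofReal_coe_nnreal, ENNReal.ofReal_lt_ofReal_iff ht0] at hαt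
    exact hαt
  set a₀ := Real.exp (t * Real.log (μ.real (cylinder N p)) - 4 * ε * (N + 1) - D) with ha0
  have hpre : caratheodoryPre (cylinders A) (fun F => μ F ^ (α : ℝ)) 1
      (targetSet (cylinder N p) ℓ w) < ENNReal.ofReal a₀ := by
    -- Scale 1 suffices: the construction defeats every cover by cylinders of small total weight,
    -- whatever their diameters.
    refine lt_of_le_of_lt (le_iSup₂ (f := fun (ε : ℝ) (_ : 0 < ε) => caratheodoryPre (cylinders A)
      (fun F => μ F ^ (α : ℝ)) ε (targetSet (cylinder N p) ℓ w)) 1 one_pos) ?_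
    rw [show (⨆ (ε : ℝ) (_ : 0 < ε), caratheodoryPre (cylinders A)
      (fun F => μ F ^ (α : ℝ)) ε (targetSet (cylinder N p) ℓ w)) = 0 from hα]
    exact ENNReal.ofReal_pos.2 (Real.exp_pos _)
  simp only [caratheodoryPre, iInf_lt_iff] at hpre
  obtain ⟨S, -, hS, hcov, hsum⟩ := hpre
  have hScyl : S ⊆ cylinders A := fun F hF => (hS F hF).1
  -- Since μ(F) ≤ 1 and α < t, raising the exponent from α to t only decreases the weights.
  have htot : ∑' F, S.indicator (fun F => μ F ^ t) F < ENNReal.ofReal a₀ := by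
    rw [← tsum_subtype S fun F => μ F ^ t]
    refine lt_of_le_of_lt (ENNReal.tsum_le_tsum fun F => ?_) hsum
    exact ENNReal.rpow_le_rpow_of_exponent_ge prob_le_one hαt'.le
  have hinit : IsUncovered μ S t ε D N p a₀ := by
    refine ⟨Real.exp_pos _, (Real.log_exp _).le, lt_of_le_of_lt ?_ htot, fun F hF hsub => ?_⟩
    · exact ENNReal.tsum_le_tsum fun F =>
        Set.indicator_le_indicator_of_subset Set.inter_subset_left (fun _ => zero_le) F
    · have h1 : ENNReal.ofReal a₀ ≤ μ (cylinder N p) ^ t := by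
        refine ofReal_le_measure_rpow (hμ.1 N p) (Real.exp_pos _) ?_
        rw [Real.log_exp]
        have hc1' : 0 ≤ Real.log 2 - Real.log (m.real (cylinder 0 w)) := by
          have h1 : Real.log (m.real (cylinder 0 w)) ≤ 0 :=
            Real.log_nonpos measureReal_nonneg measureReal_le_one
          have h2 := Real.log_nonneg one_le_two
          linarith
        have : 0 ≤ B := hB₁0.trans (le_max_left _ _)
        have : 0 ≤ 4 * ε * ((N : ℝ) + 1) := by positivity
        linarith
      have h2 : μ F ^ t ≤ ∑' F, S.indicator (fun F => μ F ^ t) F := by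
        refine le_trans ?_ (ENNReal.le_tsum F)
        rw [Set.indicator_of_mem hF]
      exact absurd (h1.trans ((ENNReal.rpow_le_rpow (measure_mono hsub) ht0.le).trans h2))
        (not_le.2 htot)
  let State := {q : ℕ × MarkovShift A × ℝ // IsUncovered μ S t ε D q.1 q.2.1 q.2.2}
  have hnext : ∀ q : State, ∃ q' : State, ∃ k : ℕ, q.1.1 < k ∧ q'.1.1 = k + ℓ k ∧
      q'.1.2.1 ∈ cylinder q.1.1 q.1.2.1 ∧ (shift A)^[k] q'.1.2.1 ∈ cylinder (ℓ k) w := by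
    rintro ⟨⟨L, x, a⟩, ha⟩
    obtain ⟨k, z, a', hk, hz, hkz, ha'⟩ := ha.exists_next hM0 hM ht0.le ht1 hε hμ.1 hm.1
      (hB₁0.trans (le_max_left _ _) : 0 ≤ B)
      (fun n x => (hB₁ n x).trans (by gcongr; exact le_max_left _ _))
      (fun n x => by
        have := hB₂ n x
        rw [birkhoffSum_const_mul] at this
        exact this.trans (by gcongr; exact le_max_right _ _))
      hmix.2 hℓ' hs' hG hF hεF.le hScyl le_rfl
    exact ⟨⟨(k + ℓ k, z, a'), ha'⟩, k, hk, rfl, hz, hkz⟩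
  choose next κ hκ1 hκ2 hκ3 hκ4 using hnext
  let q : ℕ → State := fun j => Nat.rec ⟨(N, p, a₀), hinit⟩ (fun _ q => next q) j
  have hqs : ∀ j, q (j + 1) = next (q j) := fun _ => rfl
  have hLlt : ∀ j, (q j).1.1 < (q (j + 1)).1.1 := fun j => by
    rw [hqs, hκ2]
    exact (hκ1 _).trans_le (Nat.le_add_right _ _)
  have hLmono : StrictMono fun j => (q j).1.1 := strictMono_nat_of_lt_succ hLlt
  have hchain : ∀ i j, i ≤ j → (q j).1.2.1 ∈ cylinder (q i).1.1 (q i).1.2.1 := by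
    intro i j hij
    induction j, hij using Nat.le_induction with
    | base => exact self_mem_cylinder _ _
    | succ j hij ih =>
      exact cylinder_subset_of_mem (hLmono.monotone hij) (self_mem_cylinder _ _) ih
        (by rw [hqs]; exact hκ3 _)
  obtain ⟨z, hz⟩ := exists_forall_mem_cylinder (fun _ => hLmono.le_apply) hchain
  have hzW : z ∈ targetSet (cylinder N p) ℓ w := by
    refine ⟨hz 0, frequently_atTop.2 fun n => ⟨κ (q n), ?_, ?_⟩⟩
    · exact (hLmono.le_apply (x := n)).trans (hκ1 _).le
    · have h1 := hz (n + 1)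
      rw [hqs, hκ2] at h1
      have h2 := hκ4 (q n)
      refine mem_cylinder_iff.2 fun i hi => ?_
      rw [← mem_cylinder_iff.1 h2 i hi, shift_iterate_apply, shift_iterate_apply]
      exact mem_cylinder_iff.1 h1 _ (by omega)
  -- The covering cylinder has some order n, and the n-th nested cylinder has order at least n, so
  -- it lies inside: a contradiction.
  obtain ⟨G, hG, hzG⟩ := hcov hzW
  obtain ⟨n, y, rfl⟩ := hScyl hG
  exact (q n).2.not_subset _ hG (cylinder_subset_of_mem hLmono.le_apply (hz n) hzG)

end LowerBoundConclusion

end MarkovShift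

/-! ### Shannon entropy of finite-valued maps. -/

theorem sum_negMulLog_submodular {α β γ : Type*} [Fintype α] [Fintype β] [Fintype γ] {p : α → β → γ → ℝ} (hp : ∀ a b c, 0 ≤ p a b c) :
    (∑ a, ∑ b, ∑ c, Real.negMulLog (p a b c)) + ∑ b, Real.negMulLog (∑ a, ∑ c, p a b c) ≤
      (∑ a, ∑ b, Real.negMulLog (∑ c, p a b c)) + ∑ b, ∑ c, Real.negMulLog (∑ a, p a b c) := by
  set r : α → β → ℝ := fun a b => ∑ c, p a b c with hr
  set s : β → γ → ℝ := fun b c => ∑ a, p a b c with hs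
  set q : β → ℝ := fun b => ∑ a, ∑ c, p a b c with hq
  have hr0 : ∀ a b, 0 ≤ r a b := fun a b => Finset.sum_nonneg fun c _ => hp a b c
  have hs0 : ∀ b c, 0 ≤ s b c := fun b c => Finset.sum_nonneg fun a _ => hp a b c
  have hq0 : ∀ b, 0 ≤ q b := fun b => Finset.sum_nonneg fun a _ => hr0 a b
  have hpr : ∀ a b c, p a b c ≤ r a b := fun a b c =>
    Finset.single_le_sum (fun c _ => hp a b c) (Finset.mem_univ c)
  have hps : ∀ a b c, p a b c ≤ s b c := fun a b c =>
    Finset.single_le_sum (f := fun a => p a b c) (fun a _ => hp a b c) (Finset.mem_univ a)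
  have hrq : ∀ a b, r a b ≤ q b := fun a b =>
    Finset.single_le_sum (f := fun a => r a b) (fun a _ => hr0 a b) (Finset.mem_univ a)
  -- Nonnegativity of conditional mutual information: log x ≤ x - 1 at x = rs/(qp). The right-hand
  -- sides sum to zero.
  have hterm : ∀ a b c, p a b c * (Real.log (r a b) + Real.log (s b c) - Real.log (q b) -
      Real.log (p a b c)) ≤ r a b * s b c / q b - p a b c := by
    intro a b c
    rcases (hp a b c).eq_or_lt with h | h
    · rw [← h, zero_mul, sub_zero]
      have := hr0 a b; have := hs0 b c; have := hq0 b
      positivity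
    · have h1 := h.trans_le (hpr a b c)
      have h2 := h.trans_le (hps a b c)
      have h3 := h1.trans_le (hrq a b)
      have h4 := Real.log_le_sub_one_of_pos
        (show 0 < r a b * s b c / (q b * p a b c) by positivity)
      rw [Real.log_div (by positivity) (by positivity), Real.log_mul h1.ne' h2.ne',
        Real.log_mul h3.ne' h.ne'] at h4
      calc _ ≤ p a b c * (r a b * s b c / (q b * p a b c) - 1) :=
            mul_le_mul_of_nonneg_left (by linarith) h.le
        _ = _ := by field_simp
  have hqs : ∀ b, ∑ c, s b c = q b := fun b => Finset.sum_comm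
  have hzero : ∑ a, ∑ b, ∑ c, (r a b * s b c / q b - p a b c) = 0 := by
    rw [Finset.sum_comm]
    refine Finset.sum_eq_zero fun b _ => ?_
    simp only [Finset.sum_sub_distrib]
    simp only [← Finset.sum_div, ← Finset.mul_sum, ← Finset.sum_mul, hqs]
    change q b * q b / q b - q b = 0
    rcases eq_or_ne (q b) 0 with h | h
    · simp [h]
    · field_simp
      simp
  have hsum := Finset.sum_le_sum fun a (_ : a ∈ Finset.univ) => Finset.sum_le_sum
    fun b (_ : b ∈ Finset.univ) => Finset.sum_le_sum fun c (_ : c ∈ Finset.univ) => hterm a b c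
  rw [hzero] at hsum
  have e1 : ∑ a, ∑ b, Real.negMulLog (r a b) = -∑ a, ∑ b, ∑ c, p a b c * Real.log (r a b) := by
    simp only [Real.negMulLog, hr, neg_mul, Finset.sum_neg_distrib, Finset.sum_mul]
  have e2 : ∑ b, ∑ c, Real.negMulLog (s b c) = -∑ a, ∑ b, ∑ c, p a b c * Real.log (s b c) := by
    simp only [Real.negMulLog, neg_mul, Finset.sum_neg_distrib, neg_inj]
    rw [Finset.sum_comm (f := fun a b => ∑ c, p a b c * Real.log (s b c))]
    refine Finset.sum_congr rfl fun b _ => ?_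
    rw [Finset.sum_comm (f := fun a c => p a b c * Real.log (s b c))]
    refine Finset.sum_congr rfl fun c _ => ?_
    rw [← Finset.sum_mul]
  have e3 : ∑ b, Real.negMulLog (q b) = -∑ a, ∑ b, ∑ c, p a b c * Real.log (q b) := by
    rw [Finset.sum_comm, ← Finset.sum_neg_distrib]
    refine Finset.sum_congr rfl fun b _ => ?_
    simp only [Real.negMulLog, hq, neg_mul, Finset.sum_mul]
  have e4 : ∑ a, ∑ b, ∑ c, Real.negMulLog (p a b c) =
      -∑ a, ∑ b, ∑ c, p a b c * Real.log (p a b c) := by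
    simp only [Real.negMulLog, neg_mul, Finset.sum_neg_distrib]
  rw [e1, e2, e3, e4]
  simp only [mul_sub, mul_add, Finset.sum_sub_distrib, Finset.sum_add_distrib] at hsum
  linarith

section ShannonEntropy

variable {X : Type*} [MeasurableSpace X]

/-- The Shannon entropy of the law of a finite-valued map. -/
noncomputable def shannonEntropy {α : Type*} [Fintype α] (μ : Measure X) (f : X → α) : ℝ :=
  ∑ a, Real.negMulLog (μ.real (f ⁻¹' {a}))

theorem shannonEntropy_nonneg (μ : Measure X) [IsProbabilityMeasure μ] {α : Type*} [Fintype α] (f : X → α) :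
    0 ≤ shannonEntropy μ f :=
  Finset.sum_nonneg fun _ _ => Real.negMulLog_nonneg measureReal_nonneg measureReal_le_one

variable {α β γ : Type*} [Fintype α] [Fintype β] [Fintype γ]
  [MeasurableSpace α] [MeasurableSpace β] [MeasurableSpace γ]
  [MeasurableSingletonClass α] [MeasurableSingletonClass β] [MeasurableSingletonClass γ]

theorem measureReal_eq_sum_inter_preimage (μ : Measure X) [IsFiniteMeasure μ] {f : X → α}
    (hf : Measurable f) {s : Set X} (hs : MeasurableSet s) :
    μ.real s = ∑ a, μ.real (s ∩ f ⁻¹' {a}) := by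
  have hu : ⋃ a, f ⁻¹' {a} = Set.univ := Set.eq_univ_of_forall fun x => Set.mem_iUnion.2 ⟨f x, rfl⟩
  rw [← measureReal_iUnion_fintype, ← Set.inter_iUnion, hu, Set.inter_univ]
  · intro a b hab
    refine Set.disjoint_left.2 fun x hx hx' => hab ?_
    exact (show f x = a from hx.2).symm.trans hx'.2
  · exact fun a => hs.inter (hf (measurableSet_singleton a))

theorem shannonEntropy_comp_le (μ : Measure X) [IsFiniteMeasure μ] {f : X → α}
    (hf : Measurable f) (g : α → β) : shannonEntropy μ (fun x => g (f x)) ≤ shannonEntropy μ f := by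
  classical
  have hg : Measurable g := measurable_of_countable g
  calc shannonEntropy μ (fun x => g (f x))
      ≤ ∑ b, ∑ a, if g a = b then Real.negMulLog (μ.real (f ⁻¹' {a})) else 0 := by
        refine Finset.sum_le_sum fun b _ => ?_
        set s := (fun x => g (f x)) ⁻¹' {b}
        have hs : MeasurableSet s := (hg.comp hf) (measurableSet_singleton b)
        have hterm : ∀ a, μ.real (s ∩ f ⁻¹' {a}) = if g a = b then μ.real (f ⁻¹' {a}) else 0 := by
          intro a
          split_ifs with h
          · congr 1
            refine Set.inter_eq_right.2 fun x hx => ?_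
            rw [Set.mem_preimage, Set.mem_singleton_iff] at hx
            simp [s, hx, h]
          · rw [show s ∩ f ⁻¹' {a} = ∅ from Set.eq_empty_of_forall_notMem ?_, measureReal_empty]
            rintro x ⟨hx, rfl⟩
            exact h hx
        rw [Real.negMulLog, neg_mul, ← mul_neg]
        nth_rw 1 [measureReal_eq_sum_inter_preimage μ hf hs]
        rw [Finset.sum_mul]
        refine Finset.sum_le_sum fun a _ => ?_
        rw [hterm]
        split_ifs with h
        swap
        · simp
        rw [Real.negMulLog, neg_mul, ← mul_neg]
        rcases (measureReal_nonneg (μ := μ) (s := f ⁻¹' {a})).eq_or_lt with h0 | h0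
        · simp [← h0]
        refine mul_le_mul_of_nonneg_left (neg_le_neg (Real.log_le_log h0 ?_)) h0.le
        refine measureReal_mono fun x hx => ?_
        rw [Set.mem_preimage, Set.mem_singleton_iff] at hx
        simp [s, hx, h]
    _ = shannonEntropy μ f := by
        rw [Finset.sum_comm]
        simp [shannonEntropy]

theorem shannonEntropy_submodular (μ : Measure X) [IsFiniteMeasure μ] {f : X → α} {g : X → β}
    {h : X → γ} (hf : Measurable f) (hg : Measurable g) (hh : Measurable h) :
    shannonEntropy μ (fun x => (f x, g x, h x)) + shannonEntropy μ g ≤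
      shannonEntropy μ (fun x => (f x, g x)) + shannonEntropy μ (fun x => (g x, h x)) := by
  have hsub := sum_negMulLog_submodular
    (p := fun a b c => μ.real ((fun x => (f x, g x, h x)) ⁻¹' {(a, b, c)}))
    fun a b c => measureReal_nonneg
  have m1 : ∀ a b, ∑ c, μ.real ((fun x => (f x, g x, h x)) ⁻¹' {(a, b, c)}) =
      μ.real ((fun x => (f x, g x)) ⁻¹' {(a, b)}) := fun a b => by
    rw [measureReal_eq_sum_inter_preimage μ hh ((hf.prodMk hg) (measurableSet_singleton (a, b)))]
    refine Finset.sum_congr rfl fun c _ => congrArg μ.real (Set.ext fun x => ?_)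
    simp [and_assoc]
  have m2 : ∀ b c, ∑ a, μ.real ((fun x => (f x, g x, h x)) ⁻¹' {(a, b, c)}) =
      μ.real ((fun x => (g x, h x)) ⁻¹' {(b, c)}) := fun b c => by
    rw [measureReal_eq_sum_inter_preimage μ hf ((hg.prodMk hh) (measurableSet_singleton (b, c)))]
    refine Finset.sum_congr rfl fun a _ => congrArg μ.real (Set.ext fun x => ?_)
    simp [and_comm]
  have m3 : ∀ b, ∑ a, μ.real ((fun x => (f x, g x)) ⁻¹' {(a, b)}) = μ.real (g ⁻¹' {b}) :=
    fun b => by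
      rw [measureReal_eq_sum_inter_preimage μ hf (hg (measurableSet_singleton b))]
      refine Finset.sum_congr rfl fun a _ => congrArg μ.real (Set.ext fun x => ?_)
      simp [and_comm]
  simp only [m1, m2, m3] at hsub
  simpa only [shannonEntropy, Fintype.sum_prod_type] using hsub

theorem shannonEntropy_prod_le (μ : Measure X) [IsProbabilityMeasure μ] {f : X → α} {g : X → β}
    (hf : Measurable f) (hg : Measurable g) :
    shannonEntropy μ (fun x => (f x, g x)) ≤ shannonEntropy μ f + shannonEntropy μ g := by
  -- Subadditivity is submodularity with a constant middle variable.
  have h := shannonEntropy_submodular μ hf (measurable_const (a := ())) hg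
  have h1 := shannonEntropy_comp_le μ (hf.prodMk ((measurable_const (a := ())).prodMk hg))
    fun p : α × Unit × β => (p.1, p.2.2)
  have h2 := shannonEntropy_comp_le μ hf fun a => (a, ())
  have h3 := shannonEntropy_comp_le μ hg fun b => ((), b)
  have h4 := shannonEntropy_nonneg μ fun _ : X => ()
  linarith

theorem shannonEntropy_comp_measurePreserving {μ : Measure X} {T : X → X}
    (hT : MeasurePreserving T μ μ) {f : X → α} (hf : Measurable f) :
    shannonEntropy μ (fun x => f (T x)) = shannonEntropy μ f := by
  refine Finset.sum_congr rfl fun a _ => congrArg _ ?_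
  exact hT.measureReal_preimage (hf (measurableSet_singleton a)).nullMeasurableSet

theorem sum_measureReal_mul_eq_integral (μ : Measure X) [IsFiniteMeasure μ] {f : X → α}
    (hf : Measurable f) (h : α → ℝ) :
    ∑ a, μ.real (f ⁻¹' {a}) * h a = ∫ x, h (f x) ∂μ := by
  rw [← integral_map (φ := f) hf.aemeasurable (measurable_of_countable h).aestronglyMeasurable,
    integral_fintype Integrable.of_finite]
  refine Finset.sum_congr rfl fun a _ => ?_
  rw [map_measureReal_apply hf (measurableSet_singleton a), smul_eq_mul]

/-- Continuity of the conditional entropy: it is small when `g` is close to `f`. -/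
theorem tendsto_condEntropy_zero (μ : Measure X) [IsFiniteMeasure μ] {f : X → α}
    (hf : Measurable f) {g : ℕ → X → α} (hg : ∀ n, Measurable (g n))
    (h : Tendsto (fun n => μ.real {x | f x ≠ g n x}) atTop (𝓝 0)) :
    Tendsto (fun n => shannonEntropy μ (fun x => (f x, g n x)) - shannonEntropy μ (g n)) atTop
      (𝓝 0) := by
  classical
  -- The law of (f, g_n) tends to the diagonal law of f, and that of g_n to the law of f; both
  -- limits have entropy H(f).
  have hg' : ∀ a, Tendsto (fun n => μ.real (g n ⁻¹' {a})) atTop (𝓝 (μ.real (f ⁻¹' {a}))) := by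
    intro a
    refine tendsto_iff_dist_tendsto_zero.2 (squeeze_zero (fun _ => dist_nonneg) (fun n => ?_) h)
    rw [Real.dist_eq]
    refine (abs_measureReal_sub_le_measureReal_symmDiff (hg n (measurableSet_singleton a)).nullMeasurableSet
      (hf (measurableSet_singleton a)).nullMeasurableSet).trans (measureReal_mono ?_)
    rintro x (⟨h1, h2⟩ | ⟨h1, h2⟩) heq
    · exact h2 ((show f x = g n x from heq).trans h1)
    · exact h2 ((show f x = g n x from heq).symm.trans h1)
  have hfg : ∀ a b, Tendsto (fun n => μ.real ((fun x => (f x, g n x)) ⁻¹' {(a, b)})) atTop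
      (𝓝 (if a = b then μ.real (f ⁻¹' {a}) else 0)) := by
    intro a b
    split_ifs with hab
    · subst hab
      refine tendsto_iff_dist_tendsto_zero.2 (squeeze_zero (fun _ => dist_nonneg) (fun n => ?_) h)
      rw [Real.dist_eq]
      refine (abs_measureReal_sub_le_measureReal_symmDiff
        (((hf.prodMk (hg n)) (measurableSet_singleton _)).nullMeasurableSet)
        (hf (measurableSet_singleton a)).nullMeasurableSet).trans (measureReal_mono ?_)
      rintro x (⟨h1, h2⟩ | ⟨h1, h2⟩) heq
      · exact h2 (congrArg Prod.fst h1)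
      · exact h2 (Prod.ext h1 ((show f x = g n x from heq).symm.trans h1))
    · refine squeeze_zero (fun _ => measureReal_nonneg) (fun n => measureReal_mono ?_) h
      intro x hx heq
      exact hab ((congrArg Prod.fst hx).symm.trans
        ((show f x = g n x from heq).trans (congrArg Prod.snd hx)))
  have h1 : Tendsto (fun n => shannonEntropy μ fun x => (f x, g n x)) atTop
      (𝓝 (∑ p : α × α, Real.negMulLog (if p.1 = p.2 then μ.real (f ⁻¹' {p.1}) else 0))) :=
    tendsto_finsetSum _ fun p _ => (Real.continuous_negMulLog.tendsto _).comp (hfg p.1 p.2)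
  have h2 : Tendsto (fun n => shannonEntropy μ (g n)) atTop
      (𝓝 (∑ a, Real.negMulLog (μ.real (f ⁻¹' {a})))) :=
    tendsto_finsetSum _ fun a _ => (Real.continuous_negMulLog.tendsto _).comp (hg' a)
  have h3 : ∑ p : α × α, Real.negMulLog (if p.1 = p.2 then μ.real (f ⁻¹' {p.1}) else 0) =
      ∑ a, Real.negMulLog (μ.real (f ⁻¹' {a})) := by
    simp [Fintype.sum_prod_type, apply_ite]
  rw [h3] at h1
  simpa using h1.sub h2

end ShannonEntropy

/-! ### The Kolmogorov-Sinai theorem. -/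

section KolmogorovSinai

variable {X : Type*} [MeasurableSpace X]

/-- The first `n` symbols of the itinerary of a point. -/
def itinerary {α : Type*} (T : X → X) (ξ : X → α) (n : ℕ) (x : X) : Fin n → α :=
  fun i => ξ (T^[i] x)

variable {T : X → X} {μ : Measure X}

theorem measurable_itinerary {α : Type*} [MeasurableSpace α] (hT : Measurable T) {ξ : X → α}
    (hξ : Measurable ξ) (n : ℕ) : Measurable (itinerary T ξ n) :=
  measurable_pi_lambda _ fun i => hξ.comp (hT.iterate i)

theorem partitionEntropySeq_eq {k : ℕ} (ξ : X → Fin k) (n : ℕ) :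
    partitionEntropySeq T μ ξ n = 1 / (n : ℝ) * shannonEntropy μ (itinerary T ξ n) := by
  unfold partitionEntropySeq shannonEntropy
  congr 1
  refine Finset.sum_congr rfl fun u _ => ?_
  congr 2
  ext x
  simp [itinerary, funext_iff]

variable [IsProbabilityMeasure μ]

theorem shannonEntropy_itinerary_add_le (hT : MeasurePreserving T μ μ) {d : ℕ} {ξ : X → Fin d}
    (hξ : Measurable ξ) (m n : ℕ) : shannonEntropy μ (itinerary T ξ (m + n)) ≤
      shannonEntropy μ (itinerary T ξ m) + shannonEntropy μ (itinerary T ξ n) := by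
  have hm := measurable_itinerary hT.measurable hξ
  have h1 := shannonEntropy_prod_le μ (hm m) ((hm n).comp (hT.iterate m).measurable)
  have h2 := shannonEntropy_comp_measurePreserving (hT.iterate m) (hm n)
  have h3 := shannonEntropy_comp_le μ ((hm m).prodMk ((hm n).comp (hT.iterate m).measurable))
    fun p : (Fin m → Fin d) × (Fin n → Fin d) => Fin.append p.1 p.2
  have h4 : (fun x => Fin.append (itinerary T ξ m x) ((itinerary T ξ n ∘ T^[m]) x)) =
      itinerary T ξ (m + n) := by
    funext x i
    refine Fin.addCases (fun j => ?_) (fun j => ?_) i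
    · simp [itinerary]
    · simp [itinerary, ← Function.iterate_add_apply, add_comm]
  rw [h4] at h3
  exact h3.trans (h1.trans_eq (congrArg _ h2))

theorem exists_tendsto_partitionEntropySeq (hT : MeasurePreserving T μ μ) {d : ℕ} {ξ : X → Fin d}
    (hξ : Measurable ξ) :
    ∃ h : ℝ, 0 ≤ h ∧ Tendsto (partitionEntropySeq T μ ξ) atTop (𝓝 h) := by
  have hsub : Subadditive fun n => shannonEntropy μ (itinerary T ξ n) :=
    fun m n => shannonEntropy_itinerary_add_le hT hξ m n
  have hnn : ∀ n, 0 ≤ partitionEntropySeq T μ ξ n := fun n => by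
    rw [partitionEntropySeq_eq]
    have := shannonEntropy_nonneg μ (itinerary T ξ n)
    positivity
  have hlim : Tendsto (partitionEntropySeq T μ ξ) atTop (𝓝 hsub.lim) := by
    refine (hsub.tendsto_lim ⟨0, ?_⟩).congr fun n => ?_
    · rintro _ ⟨n, rfl⟩
      exact div_nonneg (shannonEntropy_nonneg μ _) (Nat.cast_nonneg n)
    · rw [partitionEntropySeq_eq]
      ring
  exact ⟨_, ge_of_tendsto' hlim hnn, hlim⟩

/-- The long ξ-itinerary determines each g∘T^j with j < n. Adjoining the symbol η∘T^j to it
therefore costs at most the conditional entropy of η given g, by submodularity and invariance. -/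
theorem shannonEntropy_itinerary_le (hT : MeasurePreserving T μ μ) {d k : ℕ} {ξ : X → Fin d}
    (hξ : Measurable ξ) {η : X → Fin k} (hη : Measurable η) {m : ℕ} (G : (Fin m → Fin d) → Fin k)
    (n : ℕ) : shannonEntropy μ (itinerary T η n) ≤ shannonEntropy μ (itinerary T ξ (n + m)) +
      n * (shannonEntropy μ (fun x => (η x, G (itinerary T ξ m x))) -
        shannonEntropy μ (fun x => G (itinerary T ξ m x))) := by
  have hmξ := measurable_itinerary hT.measurable hξ
  have hmη := measurable_itinerary hT.measurable hη
  set g : X → Fin k := fun x => G (itinerary T ξ m x) with hg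
  have hgm : Measurable g := (measurable_of_countable G).comp (hmξ m)
  set c := shannonEntropy μ (fun x => (η x, g x)) - shannonEntropy μ g
  set R := itinerary T ξ (n + m) with hR
  have hind : ∀ j ≤ n, shannonEntropy μ (fun x => (itinerary T η j x, R x)) ≤
      shannonEntropy μ R + j * c := by
    intro j
    induction j with
    | zero =>
      intro _
      have := shannonEntropy_comp_le μ (hmξ (n + m))
        fun r => ((fun i => i.elim0 : Fin 0 → Fin k), r)
      rw [Nat.cast_zero, zero_mul, add_zero]
      refine le_trans (le_of_eq ?_) this
      congr 1
      funext x
      exact Prod.ext (funext fun i => i.elim0) rfl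
    | succ j ih =>
      intro hj
      have hjm : j + m ≤ n + m := by omega
      have hTj := (hT.iterate j).measurable
      have hsubm := shannonEntropy_submodular μ (hη.comp hTj) (hgm.comp hTj)
        ((hmη j).prodMk (hmξ (n + m)))
      have h1 := shannonEntropy_comp_measurePreserving (hT.iterate j) (hη.prodMk hgm)
      have h2 := shannonEntropy_comp_measurePreserving (hT.iterate j) hgm
      have h3 := shannonEntropy_comp_le μ ((hmη j).prodMk (hmξ (n + m)))
        fun p : (Fin j → Fin k) × (Fin (n + m) → Fin d) =>
          (G fun i => p.2 ⟨i + j, by omega⟩, p)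
      have h4 : (fun x => (G fun i : Fin m => R x ⟨i + j, by omega⟩, itinerary T η j x, R x)) =
          fun x => ((g ∘ T^[j]) x, itinerary T η j x, R x) := by
        funext x
        refine Prod.ext (congrArg G (funext fun i => ?_)) rfl
        simp [hR, itinerary, Function.iterate_add_apply]
      have h5 := shannonEntropy_comp_le μ
        ((hη.comp hTj).prodMk ((hgm.comp hTj).prodMk ((hmη j).prodMk (hmξ (n + m)))))
        fun p : Fin k × Fin k × (Fin j → Fin k) × (Fin (n + m) → Fin d) =>
          ((Fin.snoc p.2.2.1 p.1 : Fin (j + 1) → Fin k), p.2.2.2)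
      have h6 : (fun x => ((Fin.snoc (itinerary T η j x) ((η ∘ T^[j]) x) : Fin (j + 1) → Fin k),
          R x)) = fun x => (itinerary T η (j + 1) x, R x) := by
        funext x
        refine Prod.ext (funext fun i => ?_) rfl
        refine Fin.lastCases ?_ (fun i => ?_) i
        · simp [itinerary]
        · simp [itinerary]
      have h3' := (congrArg (shannonEntropy μ) h4).symm.trans_le h3
      have h5' := (congrArg (shannonEntropy μ) h6).symm.trans_le h5
      have ih' := ih (by omega)
      change shannonEntropy μ (fun x => ((η ∘ T^[j]) x, (g ∘ T^[j]) x)) = _ at h1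
      change shannonEntropy μ (g ∘ T^[j]) = _ at h2
      push_cast
      linarith
  have h7 := shannonEntropy_comp_le μ ((hmη n).prodMk (hmξ (n + m))) Prod.fst
  exact h7.trans (hind n le_rfl)

/-- The Kolmogorov-Sinai theorem: the entropy is computed by a partition whose itineraries
approximate every finite partition. -/
theorem measureEntropy_eq_of_generating (hT : MeasurePreserving T μ μ) {d : ℕ} {ξ : X → Fin d}
    (hξ : Measurable ξ) (hgen : ∀ (k : ℕ) (η : X → Fin k), Measurable η → ∀ δ > 0,
      ∃ (m : ℕ) (G : (Fin m → Fin d) → Fin k), μ.real {x | η x ≠ G (itinerary T ξ m x)} < δ)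
    {h : ℝ} (hh : Tendsto (partitionEntropySeq T μ ξ) atTop (𝓝 h)) :
    measureEntropy T μ = ENNReal.ofReal h := by
  refine le_antisymm (iSup_le fun k => iSup_le fun η => iSup_le fun hη => ?_) ?_
  · obtain ⟨h', -, hh'⟩ := exists_tendsto_partitionEntropySeq hT hη
    rw [hh'.limUnder_eq]
    refine ENNReal.ofReal_le_ofReal (le_of_forall_pos_le_add fun ε hε => ?_)
    -- The approximations of η by functions of ξ-itineraries make the conditional entropy at most ε.
    -- Then h(η) ≤ h(ξ) + ε, since the extra m symbols vanish after division by n.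
    choose m G hmG using fun i : ℕ => hgen k η hη (1 / (i + 1)) (by positivity)
    have hG : ∀ i, Measurable fun x => G i (itinerary T ξ (m i) x) := fun i =>
      (measurable_of_countable (G i)).comp (measurable_itinerary hT.measurable hξ (m i))
    have hc := tendsto_condEntropy_zero μ hη hG (squeeze_zero (fun _ => measureReal_nonneg)
      (fun i => (hmG i).le) tendsto_one_div_add_atTop_nhds_zero_nat)
    obtain ⟨i, hi⟩ := (hc.eventually_le_const hε).exists
    have hlim : Tendsto (fun n : ℕ => partitionEntropySeq T μ ξ n +
        1 / (n : ℝ) * shannonEntropy μ (itinerary T ξ (m i)) + ε) atTop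
        (𝓝 (h + 0 * shannonEntropy μ (itinerary T ξ (m i)) + ε)) :=
      (hh.add (tendsto_one_div_atTop_nhds_zero_nat.mul_const _)).add_const ε
    rw [zero_mul, add_zero] at hlim
    refine le_of_tendsto_of_tendsto hh' hlim ?_
    filter_upwards [eventually_gt_atTop 0] with n hn
    have hn' : (0 : ℝ) < n := by exact_mod_cast hn
    rw [partitionEntropySeq_eq, partitionEntropySeq_eq, ← mul_add]
    have h1 := shannonEntropy_itinerary_le hT hξ hη (G i) n
    have h2 := shannonEntropy_itinerary_add_le hT hξ n (m i)
    have h3 := mul_le_mul_of_nonneg_left hi hn'.le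
    calc 1 / (n : ℝ) * shannonEntropy μ (itinerary T η n)
        ≤ 1 / (n : ℝ) * (shannonEntropy μ (itinerary T ξ n) +
          shannonEntropy μ (itinerary T ξ (m i)) + n * ε) := by
          refine mul_le_mul_of_nonneg_left ?_ (by positivity)
          linarith
      _ = _ := by field_simp
  · rw [← hh.limUnder_eq]
    exact le_iSup_of_le d (le_iSup_of_le ξ (le_iSup_of_le hξ le_rfl))

end KolmogorovSinai

namespace MarkovShift

/-! ### Entropy of weak Gibbs measures. -/

section Entropy

variable {I : Type*} [Finite I] {A : Matrix I I (Fin 2)}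

/-- The partition of the chain according to the first symbol. -/
noncomputable def symbol (z : MarkovShift A) : Fin (Nat.card I) := Finite.equivFin I (z.1 0)

theorem itinerary_symbol_eq_iff {n : ℕ} {x y : MarkovShift A} :
    itinerary (shift A) symbol (n + 1) x = itinerary (shift A) symbol (n + 1) y ↔
      x ∈ cylinder n y := by
  simp only [funext_iff, itinerary, symbol, EmbeddingLike.apply_eq_iff_eq, shift_iterate_apply,
    zero_add, mem_cylinder_iff]
  exact ⟨fun h k hk => h ⟨k, Nat.lt_succ_of_le hk⟩, fun h k => h k (Nat.le_of_lt_succ k.2)⟩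

theorem itinerary_symbol_preimage (n : ℕ) (x : MarkovShift A) :
    itinerary (shift A) symbol (n + 1) ⁻¹' {itinerary (shift A) symbol (n + 1) x} =
      cylinder n x :=
  Set.ext fun _ => itinerary_symbol_eq_iff

theorem measurable_symbol : Measurable (symbol : MarkovShift A → Fin (Nat.card I)) := by
  refine measurable_to_countable' fun a => ?_
  rcases (symbol ⁻¹' {a} : Set (MarkovShift A)).eq_empty_or_nonempty with h | ⟨x, hx⟩
  · rw [h]
    exact MeasurableSet.empty
  · have : (symbol ⁻¹' {a} : Set (MarkovShift A)) = cylinder 0 x := by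
      ext z
      rw [Set.mem_preimage, Set.mem_singleton_iff] at hx ⊢
      rw [← hx]
      simp [symbol, mem_cylinder_iff]
    rw [this]
    exact measurableSet_cylinder 0 x

/-- The sets determined by finitely many symbols. -/
def finiteTimeSets (A : Matrix I I (Fin 2)) : Set (Set (MarkovShift A)) :=
  {B | ∃ m, ∀ M ≥ m, ∃ U : Set (Fin M → Fin (Nat.card I)),
    B = itinerary (shift A) symbol M ⁻¹' U}

theorem isSetAlgebra_finiteTimeSets : IsSetAlgebra (finiteTimeSets A) where
  empty_mem := ⟨0, fun _ _ => ⟨∅, rfl⟩⟩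
  compl_mem := by
    rintro s ⟨m, hm⟩
    refine ⟨m, fun M hM => ?_⟩
    obtain ⟨U, rfl⟩ := hm M hM
    exact ⟨Uᶜ, rfl⟩
  union_mem := by
    rintro s t ⟨m, hm⟩ ⟨m', hm'⟩
    refine ⟨max m m', fun M hM => ?_⟩
    obtain ⟨U, hU⟩ := hm M ((le_max_left _ _).trans hM)
    obtain ⟨V, hV⟩ := hm' M ((le_max_right _ _).trans hM)
    exact ⟨U ∪ V, by rw [hU, hV]; rfl⟩

theorem cylinder_mem_finiteTimeSets (n : ℕ) (w : MarkovShift A) :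
    cylinder n w ∈ finiteTimeSets A := by
  refine ⟨n + 1, fun M hM => ?_⟩
  obtain ⟨j, rfl⟩ := Nat.exists_eq_add_of_le hM
  refine ⟨{u | ∀ i : Fin (n + 1), u (Fin.castAdd j i) = itinerary (shift A) symbol (n + 1) w i}, ?_⟩
  ext z
  rw [← itinerary_symbol_eq_iff, funext_iff]
  rfl

theorem generateFrom_finiteTimeSets :
    (inferInstance : MeasurableSpace (MarkovShift A)) =
      MeasurableSpace.generateFrom (finiteTimeSets A) := by
  refine le_antisymm (MeasurableSpace.generateFrom_le fun U hU => ?_)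
    (MeasurableSpace.generateFrom_le ?_)
  · have h : U = ⋃₀ {F | F ∈ cylinders A ∧ F ⊆ U} := by
      refine Set.Subset.antisymm (fun z hz => ?_) (Set.sUnion_subset fun F hF => hF.2)
      obtain ⟨n, hn⟩ := exists_cylinder_subset hU hz
      exact ⟨_, ⟨⟨n, z, rfl⟩, hn⟩, self_mem_cylinder n z⟩
    rw [h]
    refine MeasurableSet.sUnion (countable_cylinders.mono fun F hF => hF.1) ?_
    rintro _ ⟨⟨n, w, rfl⟩, -⟩
    exact MeasurableSpace.measurableSet_generateFrom (cylinder_mem_finiteTimeSets n w)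
  · rintro B ⟨m, hm⟩
    obtain ⟨U, rfl⟩ := hm m le_rfl
    exact measurable_itinerary measurable_shift measurable_symbol m (Set.toFinite U).measurableSet

theorem exists_itinerary_approx (ν : Measure (MarkovShift A)) [IsProbabilityMeasure ν] (k : ℕ)
    (η : MarkovShift A → Fin k) (hη : Measurable η) (δ : ℝ) (hδ : 0 < δ) :
    ∃ (m : ℕ) (G : (Fin m → Fin (Nat.card I)) → Fin k),
      ν.real {x | η x ≠ G (itinerary (shift A) symbol m x)} < δ := by
  classical
  obtain ⟨x₀⟩ := nonempty_of_isProbabilityMeasure ν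
  have hdense := Measure.MeasureDense.of_generateFrom_isSetAlgebra_finite (μ := ν)
    isSetAlgebra_finiteTimeSets generateFrom_finiteTimeSets
  have hk : (0 : ℝ) < k := by exact_mod_cast (Fin.pos (η x₀))
  choose B hB hBν using fun a : Fin k => hdense.approx (η ⁻¹' {a}) (hη (measurableSet_singleton a))
    (measure_ne_top _ _) (δ / k) (div_pos hδ hk)
  choose m hm using hB
  obtain ⟨M, hM⟩ : ∃ M, ∀ a, m a ≤ M :=
    ⟨Finset.univ.sup m, fun a => Finset.le_sup (f := m) (Finset.mem_univ a)⟩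
  choose U hU using fun a : Fin k => hm a M (hM a)
  -- Off the symmetric differences, exactly one U a contains the itinerary, namely a = η x. The
  -- default value η x₀ is harmless.
  refine ⟨M, fun u => if h : ∃ a, u ∈ U a then h.choose else η x₀, ?_⟩
  have hsub : {x | η x ≠ (if h : ∃ a, itinerary (shift A) symbol M x ∈ U a then h.choose
      else η x₀)} ⊆ ⋃ a, symmDiff (η ⁻¹' {a}) (B a) := by
    intro x hx
    by_contra hcon
    rw [Set.mem_iUnion, not_exists] at hcon
    have hiff : ∀ a, η x = a ↔ itinerary (shift A) symbol M x ∈ U a := fun a => by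
      have h1 := hcon a
      rw [hU a, Set.mem_symmDiff] at h1
      simp only [Set.mem_preimage, Set.mem_singleton_iff] at h1
      tauto
    have hex : ∃ a, itinerary (shift A) symbol M x ∈ U a := ⟨η x, (hiff _).1 rfl⟩
    refine hx ?_
    rw [dif_pos hex]
    exact (hiff _).2 hex.choose_spec
  have hne : (Finset.univ : Finset (Fin k)).Nonempty := ⟨η x₀, Finset.mem_univ _⟩
  calc _ ≤ ν.real (⋃ a, symmDiff (η ⁻¹' {a}) (B a)) := measureReal_mono hsub
    _ ≤ ∑ a, ν.real (symmDiff (η ⁻¹' {a}) (B a)) := measureReal_iUnion_fintype_le _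
    _ < ∑ _a : Fin k, δ / k := by
        refine Finset.sum_lt_sum_of_nonempty hne fun a _ => ?_
        have := ENNReal.toReal_lt_of_lt_ofReal (hBν a)
        exact this
    _ = δ := by
        simp
        field_simp

theorem tendsto_entropy {ν : Measure (MarkovShift A)} [IsProbabilityMeasure ν]
    (hν : MeasurePreserving (shift A) ν ν) :
    Tendsto (fun n : ℕ => 1 / (n : ℝ) * shannonEntropy ν (itinerary (shift A) symbol n)) atTop
      (𝓝 (entropy ν)) := by
  obtain ⟨h, h0, hh⟩ := exists_tendsto_partitionEntropySeq hν (measurable_symbol (A := A))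
  rw [entropy, measureEntropy_eq_of_generating hν measurable_symbol (exists_itinerary_approx ν) hh,
    ENNReal.toReal_ofReal h0]
  exact hh.congr fun n => partitionEntropySeq_eq _ n

/-- Stated for any invariant ν ≤ Rμ, because it is applied both to μ itself and to μ conditioned on
an invariant set. The factor R only adds log R to the n-th entropy. -/
theorem IsUniformGibbs.sub_integral_le_entropy {μ ν : Measure (MarkovShift A)}
    [IsProbabilityMeasure μ] [IsProbabilityMeasure ν] {φ : MarkovShift A → ℝ} (hφ : Continuous φ)
    {P : ℝ} (hμ : IsUniformGibbs μ φ P) (hν : MeasurePreserving (shift A) ν ν) {R : ℝ}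
    (hR : 0 < R) (hνμ : ∀ s, ν.real s ≤ R * μ.real s) : P - ∫ z, φ z ∂ν ≤ entropy ν := by
  refine ge_of_tendsto_of_forall_ge (tendsto_entropy hν) fun ε hε => ?_
  obtain ⟨B, hB0, hB⟩ := hμ.2 ε hε
  refine ⟨B + Real.log R, (eventually_gt_atTop 0).mono fun n hn => ?_⟩
  obtain ⟨n, rfl⟩ := Nat.exists_eq_succ_of_ne_zero hn.ne'
  set f := itinerary (shift A) (symbol (A := A)) (n + 1) with hf
  have hfm : Measurable f := measurable_itinerary measurable_shift measurable_symbol _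
  let h : (Fin (n + 1) → Fin (Nat.card I)) → ℝ := fun a =>
    -Real.log (μ.real (f ⁻¹' {a})) - Real.log R
  have hint : Integrable (fun x => h (f x)) ν :=
    (Integrable.of_finite (f := h) (μ := ν.map f)).comp_measurable hfm
  have hS := integrable_of_continuous (continuous_birkhoffSum hφ (n + 1)) ν
  calc ((n + 1 : ℕ) : ℝ) * (P - ∫ z, φ z ∂ν - ε) - (B + Real.log R)
      = ∫ x, ((((n + 1 : ℕ) : ℝ) * (P - ε) - (B + Real.log R)) -
          birkhoffSum (shift A) φ (n + 1) x) ∂ν := by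
        rw [integral_sub (integrable_const _) hS, integral_birkhoffSum hν hφ]
        simp
        ring
    _ ≤ ∫ x, h (f x) ∂ν := by
        refine integral_mono ((integrable_const _).sub hS) hint fun x => ?_
        have h1 := (abs_le.1 (hB n x)).2
        simp only [h, hf, itinerary_symbol_preimage]
        push_cast
        linarith
    _ = ∑ a, ν.real (f ⁻¹' {a}) * h a := (sum_measureReal_mul_eq_integral ν hfm h).symm
    _ ≤ shannonEntropy ν f := by
        refine Finset.sum_le_sum fun a _ => ?_
        rcases (measureReal_nonneg (μ := ν) (s := f ⁻¹' {a})).eq_or_lt with h0 | h0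
        · simp [← h0]
        · have h1 := h0.trans_le (hνμ (f ⁻¹' {a}))
          have h2 : 0 < μ.real (f ⁻¹' {a}) := pos_of_mul_pos_right h1 hR.le
          have h3 := Real.log_le_log h0 (hνμ (f ⁻¹' {a}))
          rw [Real.log_mul hR.ne' h2.ne'] at h3
          rw [Real.negMulLog, neg_mul, ← mul_neg]
          exact mul_le_mul_of_nonneg_left (by simp only [h]; linarith) h0.le

theorem IsUniformGibbs.entropy_eq {μ : Measure (MarkovShift A)} [IsProbabilityMeasure μ]
    {φ : MarkovShift A → ℝ} (hφ : Continuous φ) {P : ℝ} (hμ : IsUniformGibbs μ φ P)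
    (hinv : MeasurePreserving (shift A) μ μ) : entropy μ = P - ∫ z, φ z ∂μ := by
  refine le_antisymm ?_
    (hμ.sub_integral_le_entropy hφ hinv one_pos fun s => (one_mul (μ.real s)).ge)
  refine le_of_tendsto_of_forall_le (tendsto_entropy hinv) fun ε hε => ?_
  obtain ⟨B, hB0, hB⟩ := hμ.2 ε hε
  refine ⟨B, (eventually_gt_atTop 0).mono fun n hn => ?_⟩
  obtain ⟨n, rfl⟩ := Nat.exists_eq_succ_of_ne_zero hn.ne'
  set f := itinerary (shift A) (symbol (A := A)) (n + 1) with hf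
  have hfm : Measurable f := measurable_itinerary measurable_shift measurable_symbol _
  let h : (Fin (n + 1) → Fin (Nat.card I)) → ℝ := fun a => -Real.log (μ.real (f ⁻¹' {a}))
  have hint : Integrable (fun x => h (f x)) μ :=
    (Integrable.of_finite (f := h) (μ := μ.map f)).comp_measurable hfm
  have hS := integrable_of_continuous (continuous_birkhoffSum hφ (n + 1)) μ
  calc shannonEntropy μ f = ∑ a, μ.real (f ⁻¹' {a}) * h a := by
        refine Finset.sum_congr rfl fun a _ => ?_
        simp [Real.negMulLog, h]
    _ = ∫ x, h (f x) ∂μ := sum_measureReal_mul_eq_integral μ hfm h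
    _ ≤ ∫ x, ((((n + 1 : ℕ) : ℝ) * (P + ε) + B) - birkhoffSum (shift A) φ (n + 1) x) ∂μ := by
        refine integral_mono hint ((integrable_const _).sub hS) fun x => ?_
        have h1 := (abs_le.1 (hB n x)).1
        simp only [h, hf, itinerary_symbol_preimage]
        push_cast
        linarith
    _ = _ := by
        rw [integral_sub (integrable_const _) hS, integral_birkhoffSum hinv hφ]
        simp
        ring

end Entropy

end MarkovShift

/-! ### Birkhoff's ergodic theorem. -/

section Birkhoff

variable {X : Type*}

/-- The maximum of `0` and the first `n` Birkhoff sums. -/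
noncomputable def maxBirkhoffSum (T : X → X) (f : X → ℝ) : ℕ → X → ℝ
  | 0, _ => 0
  | n + 1, x => max 0 (f x + maxBirkhoffSum T f n (T x))

variable {T : X → X} {f : X → ℝ}

theorem birkhoffSum_le_maxBirkhoffSum (n : ℕ) (x : X) :
    birkhoffSum T f n x ≤ maxBirkhoffSum T f n x := by
  induction n generalizing x with
  | zero => simp [maxBirkhoffSum]
  | succ n ih =>
    rw [birkhoffSum_succ', maxBirkhoffSum]
    exact (add_le_add_right (ih (T x)) _).trans (le_max_right _ _)

theorem maxBirkhoffSum_nonneg (n : ℕ) (x : X) : 0 ≤ maxBirkhoffSum T f n x := by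
  cases n with
  | zero => exact le_rfl
  | succ n => exact le_max_left _ _

theorem maxBirkhoffSum_mono (x : X) : Monotone fun n => maxBirkhoffSum T f n x := by
  refine monotone_nat_of_le_succ fun n => ?_
  induction n generalizing x with
  | zero => exact maxBirkhoffSum_nonneg 1 x
  | succ n ih => exact max_le_max le_rfl (add_le_add_right (ih (T x)) _)

theorem bddAbove_maxBirkhoffSum_iff (x : X) :
    BddAbove (Set.range fun n => maxBirkhoffSum T f n (T x)) ↔
      BddAbove (Set.range fun n => maxBirkhoffSum T f n x) := by
  constructor
  · rintro ⟨K, hK⟩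
    refine ⟨max 0 (f x + K), ?_⟩
    rintro _ ⟨n, rfl⟩
    cases n with
    | zero => exact le_max_left _ _
    | succ n => exact max_le_max le_rfl (add_le_add_right (hK ⟨n, rfl⟩) _)
  · rintro ⟨K, hK⟩
    refine ⟨K - f x, ?_⟩
    rintro _ ⟨n, rfl⟩
    have h1 : maxBirkhoffSum T f (n + 1) x ≤ K := hK ⟨n + 1, rfl⟩
    have h2 := (le_max_right 0 (f x + maxBirkhoffSum T f n (T x))).trans h1
    simp only
    linarith

variable [MeasurableSpace X] {μ : Measure X}

theorem measurable_maxBirkhoffSum (hT : Measurable T) (hf : Measurable f) (n : ℕ) :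
    Measurable (maxBirkhoffSum T f n) := by
  induction n with
  | zero => exact measurable_const
  | succ n ih => exact measurable_const.max (hf.add (ih.comp hT))

theorem integrable_maxBirkhoffSum [IsFiniteMeasure μ] (hT : MeasurePreserving T μ μ)
    (hfi : Integrable f μ) (n : ℕ) : Integrable (maxBirkhoffSum T f n) μ := by
  induction n with
  | zero => exact integrable_zero _ _ _
  | succ n ih =>
    exact (integrable_zero _ _ _).sup (hfi.add (hT.integrable_comp_of_integrable ih))

/-- The maximal ergodic argument. Boundedness of the maxima M_n is an invariant property; if it
failed almost everywhere, M_{n+1} - M_n∘T = max(f, -M_n∘T) would tend to f, while its integrals are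
nonnegative. This contradicts ∫ f < 0. -/
theorem Ergodic.ae_bddAbove_birkhoffSum [IsProbabilityMeasure μ] (hT : Ergodic T μ)
    (hf : Measurable f) (hfi : Integrable f μ) (hneg : ∫ x, f x ∂μ < 0) :
    ∀ᵐ x ∂μ, ∃ K : ℝ, ∀ n, birkhoffSum T f n x ≤ K := by
  have hTm := hT.toMeasurePreserving
  set s : Set X := {x | BddAbove (Set.range fun n => maxBirkhoffSum T f n x)} with hs
  have hsm : MeasurableSet s :=
    measurableSet_bddAbove_range fun n => measurable_maxBirkhoffSum hTm.measurable hf n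
  have hsT : T ⁻¹' s = s := Set.ext fun x => bddAbove_maxBirkhoffSum_iff x
  suffices h : ∀ᵐ x ∂μ, x ∈ s by
    filter_upwards [h] with x ⟨K, hK⟩
    exact ⟨K, fun n => (birkhoffSum_le_maxBirkhoffSum n x).trans (hK ⟨n, rfl⟩)⟩
  rcases eventuallyConst_set.1 (hT.aeconst_set hsm hsT) with h | h
  · exact h
  exfalso
  let g : ℕ → X → ℝ := fun n x => max (f x) (-maxBirkhoffSum T f n (T x))
  have hg : ∀ n x, g n x = maxBirkhoffSum T f (n + 1) x - maxBirkhoffSum T f n (T x) := by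
    intro n x
    rw [maxBirkhoffSum, max_comm, ← max_sub_sub_right, add_sub_cancel_right, zero_sub]
  have hM := fun n => integrable_maxBirkhoffSum (f := f) hTm hfi n
  have hgint : ∀ n, 0 ≤ ∫ x, g n x ∂μ := by
    intro n
    simp only [hg]
    have hcomp : ∫ x, maxBirkhoffSum T f n (T x) ∂μ = ∫ x, maxBirkhoffSum T f n x ∂μ := by
      conv_rhs => rw [← hTm.map_eq]
      refine (integral_map hTm.measurable.aemeasurable ?_).symm
      rw [hTm.map_eq]
      exact (hM n).aestronglyMeasurable
    rw [integral_sub (hM (n + 1))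
      (show Integrable (fun x => maxBirkhoffSum T f n (T x)) μ from
        hTm.integrable_comp_of_integrable (hM n)), hcomp, sub_nonneg]
    exact integral_mono (hM n) (hM (n + 1)) fun x => maxBirkhoffSum_mono x n.le_succ
  have hlim : Tendsto (fun n => ∫ x, g n x ∂μ) atTop (𝓝 (∫ x, f x ∂μ)) := by
    refine tendsto_integral_of_dominated_convergence (fun x => |f x|) (fun n => ?_) hfi.abs
      (fun n => ae_of_all _ fun x => ?_) ?_
    · exact (hf.max ((measurable_maxBirkhoffSum hTm.measurable hf n).comp
        hTm.measurable).neg).aestronglyMeasurable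
    · have h0 := maxBirkhoffSum_nonneg (T := T) (f := f) n (T x)
      rw [Real.norm_eq_abs, abs_le]
      refine ⟨(neg_abs_le _).trans (le_max_left _ _), max_le (le_abs_self _) ?_⟩
      linarith [abs_nonneg (f x)]
    · filter_upwards [h] with x hx
      have hx' : ¬ BddAbove (Set.range fun n => maxBirkhoffSum T f n (T x)) := by
        rw [bddAbove_maxBirkhoffSum_iff]
        exact hx
      have hev : ∀ᶠ n in atTop, -f x ≤ maxBirkhoffSum T f n (T x) := by
        obtain ⟨_, ⟨n, rfl⟩, hn⟩ := not_bddAbove_iff.1 hx' (-f x)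
        filter_upwards [eventually_ge_atTop n] with k hk
        exact hn.le.trans (maxBirkhoffSum_mono (T x) hk)
      refine tendsto_const_nhds.congr' (hev.mono fun n hn => ?_)
      exact (max_eq_left (by linarith)).symm
  exact absurd (ge_of_tendsto' hlim hgint) (not_le.2 hneg)

theorem Ergodic.ae_birkhoffSum_le [IsProbabilityMeasure μ] (hT : Ergodic T μ)
    (hf : Measurable f) (hfi : Integrable f μ) :
    ∀ᵐ x ∂μ, ∀ ε > 0, ∃ K : ℝ, ∀ n : ℕ, birkhoffSum T f n x ≤ K + n * (∫ x, f x ∂μ + ε) := by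
  have h : ∀ j : ℕ, ∀ᵐ x ∂μ, ∃ K : ℝ, ∀ n : ℕ,
      birkhoffSum T f n x ≤ K + n * (∫ x, f x ∂μ + 1 / ((j : ℝ) + 1)) := by
    intro j
    set c := ∫ x, f x ∂μ + 1 / ((j : ℝ) + 1) with hc
    have hj : 0 < 1 / ((j : ℝ) + 1) := by positivity
    -- Subtracting slightly more than the mean makes the integral negative. Only countably many
    -- margins 1/(j+1) are needed.
    have := hT.ae_bddAbove_birkhoffSum (f := fun x => f x - c) (hf.sub_const c)
      (hfi.sub (integrable_const c)) (by
        rw [integral_sub hfi (integrable_const c)]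
        simp
        linarith)
    filter_upwards [this] with x ⟨K, hK⟩
    refine ⟨K, fun n => ?_⟩
    have h1 := hK n
    have h2 : birkhoffSum T (fun x => f x - c) n x = birkhoffSum T f n x - n * c := by
      simp [birkhoffSum, Finset.sum_sub_distrib]
    linarith
  filter_upwards [ae_all_iff.2 h] with x hx ε hε
  obtain ⟨j, hj⟩ := exists_nat_one_div_lt hε
  obtain ⟨K, hK⟩ := hx j
  refine ⟨K, fun n => (hK n).trans ?_⟩
  gcongr

/-- Birkhoff's ergodic theorem, as a bound on the deviation of the Birkhoff sums. -/
theorem Ergodic.ae_abs_birkhoffSum_sub_le [IsProbabilityMeasure μ] (hT : Ergodic T μ)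
    (hf : Measurable f) (hfi : Integrable f μ) :
    ∀ᵐ x ∂μ, ∀ ε > 0, ∃ K : ℝ, ∀ n : ℕ, |birkhoffSum T f n x - n * ∫ x, f x ∂μ| ≤ K + n * ε := by
  filter_upwards [hT.ae_birkhoffSum_le hf hfi, hT.ae_birkhoffSum_le hf.neg hfi.neg]
    with x h1 h2 ε hε
  obtain ⟨K₁, hK₁⟩ := h1 ε hε
  obtain ⟨K₂, hK₂⟩ := h2 ε hε
  refine ⟨max K₁ K₂, fun n => ?_⟩
  have h3 := hK₁ n
  have h4 := hK₂ n
  have h5 : birkhoffSum T (-f) n x = -birkhoffSum T f n x := by simp [birkhoffSum]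
  have h6 : ∫ x, (-f) x ∂μ = -∫ x, f x ∂μ := integral_neg f
  rw [h5, h6] at h4
  have := le_max_left K₁ K₂
  have := le_max_right K₁ K₂
  rw [abs_le]
  constructor <;> linarith

end Birkhoff

/-! ### Ergodicity and local entropies. -/

theorem IsMixingMeasure.ergodic {X : Type*} [MeasurableSpace X] {T : X → X} {μ : Measure X}
    [IsProbabilityMeasure μ] (h : IsMixingMeasure T μ) : Ergodic T μ := by
  refine { toMeasurePreserving := h.1, aeconst_set := fun s hs hT => ?_ }
  have hn : ∀ n, T^[n] ⁻¹' s = s := fun n => by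
    rw [Set.preimage_iterate_eq]
    exact Function.iterate_fixed hT n
  have hlim := h.2 s s hs hs
  simp only [hn, Set.inter_self] at hlim
  have heq : μ s = μ s * μ s := tendsto_nhds_unique tendsto_const_nhds hlim
  refine eventuallyConst_set'.2 ?_
  rcases eq_or_ne (μ s) 0 with h0 | h0
  · exact Or.inl (ae_eq_empty.2 h0)
  · refine Or.inr (ae_eq_univ.2 ?_)
    have h1 : μ s = 1 := by
      have := (ENNReal.mul_eq_left h0 (measure_ne_top μ s)).1 heq.symm
      exact this
    rw [prob_compl_eq_zero_iff hs, h1]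

namespace MarkovShift

variable {I : Type*} [Finite I] {A : Matrix I I (Fin 2)}

/-- Conditioned on an invariant set s of positive measure, μ keeps h + ∫φ at least P, the value
attained by μ. So the conditional measure is an equilibrium measure, equals μ by uniqueness, and the
complement of s is null. -/
theorem IsUniformGibbs.ergodic_of_unique {μ : Measure (MarkovShift A)} [IsProbabilityMeasure μ]
    {φ : MarkovShift A → ℝ} (hφ : Continuous φ) {P : ℝ} (hμ : IsUniformGibbs μ φ P)
    (heq : IsEquilibrium μ φ) (huniq : ∀ ν, IsEquilibrium ν φ → ν = μ) :
    Ergodic (shift A) μ := by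
  obtain ⟨-, hinv, hmax⟩ := heq
  refine { toMeasurePreserving := hinv, aeconst_set := fun s hs hT => ?_ }
  refine eventuallyConst_set'.2 ?_
  rcases eq_or_ne (μ s) 0 with h0 | h0
  · exact Or.inl (ae_eq_empty.2 h0)
  refine Or.inr (ae_eq_univ.2 ?_)
  set ν := ProbabilityTheory.cond μ s with hν
  have : IsProbabilityMeasure ν := ProbabilityTheory.cond_isProbabilityMeasure h0
  have hνinv : MeasurePreserving (shift A) ν ν := by
    have := hinv.restrict_preimage hs
    rw [hT] at this
    exact this.smul_measure (μ s)⁻¹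
  have hνμ : ∀ t, ν.real t ≤ (μ.real s)⁻¹ * μ.real t := fun t => by
    rw [hν, measureReal_def, ProbabilityTheory.cond_apply hs, ENNReal.toReal_mul,
      ENNReal.toReal_inv]
    exact mul_le_mul_of_nonneg_left (measureReal_mono Set.inter_subset_right)
      (inv_nonneg.2 measureReal_nonneg)
  have hR : 0 < (μ.real s)⁻¹ := inv_pos.2 (ENNReal.toReal_pos h0 (measure_ne_top _ _))
  have h1 := hμ.sub_integral_le_entropy hφ hνinv hR hνμ
  have h2 := hμ.entropy_eq hφ hinv
  have hνeq : ν = μ := huniq ν ⟨this, hνinv, fun ρ hρ hρ' => by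
    have := hmax ρ hρ hρ'
    linarith⟩
  rw [← hνeq, hν, ProbabilityTheory.cond_apply hs, Set.inter_compl_self, measure_empty, mul_zero]

/-- Local entropies along cylinders of length proportional to the time. -/
theorem IsUniformGibbs.ae_tendsto_log_cylinder {μ : Measure (MarkovShift A)}
    [IsProbabilityMeasure μ] {φ : MarkovShift A → ℝ} (hφ : Continuous φ) {P : ℝ}
    (hμ : IsUniformGibbs μ φ P) (herg : Ergodic (shift A) μ) {ℓ : ℕ → ℕ} {v : ℝ}
    (hv : Tendsto (fun n : ℕ => (ℓ n : ℝ) / n) atTop (𝓝 v)) :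
    ∀ᵐ x ∂μ, Tendsto (fun n : ℕ => -(1 / (n : ℝ)) * Real.log (μ.real (cylinder (ℓ n) x))) atTop
      (𝓝 (v * (P - ∫ z, φ z ∂μ))) := by
  filter_upwards [herg.ae_abs_birkhoffSum_sub_le hφ.measurable (integrable_of_continuous hφ μ)]
    with x hx
  set J := ∫ z, φ z ∂μ
  have hv0 : 0 ≤ v := ge_of_tendsto' hv fun n => by positivity
  -- The Gibbs and the Birkhoff errors are both at most a constant plus ε times the cylinder length,
  -- which is asymptotically vn. This fixes ε = δ/(4(v+1)).
  have hdiff : Tendsto (fun n : ℕ => -(1 / (n : ℝ)) * Real.log (μ.real (cylinder (ℓ n) x)) -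
      (ℓ n : ℝ) / n * (P - J)) atTop (𝓝 0) := by
    rw [Metric.tendsto_atTop']
    intro δ hδ
    set ε := δ / (4 * (v + 1)) with hεdef
    have hε : 0 < ε := by positivity
    have hεv : ε * (v + 1) = δ / 4 := by rw [hεdef]; field_simp
    obtain ⟨B, hB0, hB⟩ := hμ.2 ε hε
    obtain ⟨K, hK⟩ := hx ε hε
    have hK0 : 0 ≤ K := by
      have := hK 0
      simpa using this
    set D := B + K + 2 * ε + |P - J|
    have hlim : Tendsto (fun n : ℕ => D * (1 / (n : ℝ)) + 2 * ε * ((ℓ n : ℝ) / n)) atTop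
        (𝓝 (D * 0 + 2 * ε * v)) :=
      (tendsto_one_div_atTop_nhds_zero_nat.const_mul D).add (hv.const_mul _)
    have hlt : D * 0 + 2 * ε * v < δ := by nlinarith
    obtain ⟨n₀, hn₀⟩ := eventually_atTop.1 (hlim.eventually_lt_const hlt)
    refine ⟨n₀ + 1, fun n hn => ?_⟩
    have hn' : (0 : ℝ) < n := by exact_mod_cast (by omega : 0 < n)
    refine lt_of_le_of_lt ?_ (hn₀ n (by omega))
    have h1 := hB (ℓ n) x
    have h2 := hK (ℓ n + 1)
    push_cast at h2
    have h3 : |Real.log (μ.real (cylinder (ℓ n) x)) + ℓ n * (P - J)| ≤ D + 2 * ε * ℓ n := by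
      have h4 := abs_le.1 h1
      have h5 := abs_le.1 h2
      have h6 := abs_le.1 (le_refl |P - J|)
      rw [abs_le]
      constructor <;> simp only [D] <;> linarith [h4.1, h4.2, h5.1, h5.2, h6.1, h6.2]
    rw [dist_zero_right, Real.norm_eq_abs]
    have h7 : -(1 / (n : ℝ)) * Real.log (μ.real (cylinder (ℓ n) x)) - (ℓ n : ℝ) / n * (P - J) =
        -(1 / (n : ℝ)) * (Real.log (μ.real (cylinder (ℓ n) x)) + ℓ n * (P - J)) := by ring
    rw [h7, abs_mul, abs_neg, abs_of_nonneg (by positivity : 0 ≤ 1 / (n : ℝ))]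
    calc _ ≤ 1 / (n : ℝ) * (D + 2 * ε * ℓ n) := by gcongr
      _ = _ := by ring
  have := hdiff.add (hv.mul_const (P - J))
  simpa using this

end MarkovShift

/-! ### Assembly of the theorem. -/

theorem ENNReal.ofReal_le_of_forall_lt {T : ℝ} {D : ℝ≥0∞}
    (h : ∀ t, 0 < t → t < T → ENNReal.ofReal t ≤ D) : ENNReal.ofReal T ≤ D := by
  by_contra! hD
  have hfin : D ≠ ∞ := ne_top_of_lt hD
  have hDT : D.toReal < T := (ENNReal.lt_ofReal_iff_toReal_lt hfin).1 hD
  obtain ⟨t, h1, h2⟩ := exists_between hDT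
  have h0 := ENNReal.toReal_nonneg (a := D)
  have h3 := h t (h0.trans_lt h1) h2
  rw [ENNReal.ofReal_le_iff_le_toReal hfin] at h3
  linarith

namespace MarkovShift

theorem exists_ne_of_nullSingletonClass {I : Type*} {A : Matrix I I (Fin 2)}
    (μ : Measure (MarkovShift A)) [IsProbabilityMeasure μ] [NullSingletonClass μ] :
    ∃ a b : I, a ≠ b := by
  by_contra! hcon
  obtain ⟨x⟩ := nonempty_of_isProbabilityMeasure μ
  have : (Set.univ : Set (MarkovShift A)) = {x} :=
    Set.eq_singleton_iff_unique_mem.2 ⟨trivial, fun y _ => ext' fun k => hcon _ _⟩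
  have h1 := measure_univ (μ := μ)
  rw [this, measure_singleton] at h1
  exact zero_ne_one h1

end MarkovShift

theorem theoremA {I : Type*} [Fintype I] (A : Matrix I I (Fin 2))
    (hA : MarkovShift.IsTopologicallyMixing A)
    (φ : MarkovShift A → ℝ) (hφ : Continuous φ)
    (μ : Measure (MarkovShift A)) (hatom : NullSingletonClass μ)
    (hμ : MarkovShift.IsWeakSigmaGibbs μ φ)
    (hm : ∀ t : ℝ, 0 < t → t ≤ 1 → ∃ m : Measure (MarkovShift A),
      MarkovShift.IsWeakSigmaGibbs m (fun z => t * φ z) ∧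
        IsMixingMeasure (MarkovShift.shift A) m)
    (N : ℕ) (p w : MarkovShift A) (ℓ : ℕ → ℕ) (s : ℝ)
    (hs : Tendsto (fun n : ℕ => -(1 / (n : ℝ)) *
      Real.log (μ.real (MarkovShift.cylinder (ℓ n) w))) atTop (𝓝 s))
    (hℓ : MarkovShift.IsGibbs μ φ ∨ ∃ C : ℝ, ∀ᶠ n : ℕ in atTop, (ℓ n : ℝ) / n ≤ C) :
    (∃ T : ℝ, 0 < T ∧ T ≤ 1 ∧
      MarkovShift.topPressure (fun z => T * φ z) - MarkovShift.topPressure φ * T = s * T ∧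
      (0 < s → ∀ t : ℝ,
        MarkovShift.topPressure (fun z => t * φ z) - MarkovShift.topPressure φ * t = s * t →
          t = T) ∧
      (0 < MarkovShift.entropy μ → ∀ t ∈ Set.Icc (0 : ℝ) 1,
        MarkovShift.topPressure (fun z => t * φ z) - MarkovShift.topPressure φ * t = s * t →
          t = T) ∧
      MarkovShift.muDim μ (MarkovShift.targetSet (MarkovShift.cylinder N p) ℓ w) =
        ENNReal.ofReal T ∧
      (IsMixingMeasure (MarkovShift.shift A) μ →
        T ≥ (MarkovShift.topPressure φ - ∫ z, φ z ∂μ) /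
            (MarkovShift.topPressure φ - ∫ z, φ z ∂μ + s) ∧
        (MarkovShift.topPressure φ - ∫ z, φ z ∂μ) /
            (MarkovShift.topPressure φ - ∫ z, φ z ∂μ + s) ≥
          MarkovShift.entropy μ / (MarkovShift.entropy μ + s))) ∧
    (MarkovShift.IsEquilibrium μ φ →
      MarkovShift.topPressure φ - ∫ z, φ z ∂μ = MarkovShift.entropy μ) ∧
    ((IsMixingMeasure (MarkovShift.shift A) μ ∨
        (MarkovShift.IsEquilibrium μ φ ∧
          ∀ ν : Measure (MarkovShift A), MarkovShift.IsEquilibrium ν φ → ν = μ)) →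
      ∀ v : ℝ, Tendsto (fun n : ℕ => (ℓ n : ℝ) / n) atTop (𝓝 v) →
        ∀ᵐ x ∂μ, Tendsto (fun n : ℕ => -(1 / (n : ℝ)) *
          Real.log (μ.real (MarkovShift.cylinder (ℓ n) x))) atTop
          (𝓝 (v * MarkovShift.entropy μ))) := by
  obtain ⟨hweak, hinv⟩ := hμ
  have hprob := hweak.1
  have hne : Nonempty (MarkovShift A) := nonempty_of_isProbabilityMeasure μ
  obtain ⟨P, hU⟩ := hweak.exists_isUniformGibbs hφ
  -- From here on h_μ is P - ∫φ dμ for every measure considered, so item 3 and the second inequality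
  -- of item 2 hold by reflexivity.
  rw [hU.topPressure_eq hφ, hU.entropy_eq hφ hinv]
  have hh0 : 0 ≤ P - ∫ z, φ z ∂μ := sub_nonneg.2 (hU.integral_le hφ hinv)
  have hvar := hU.le_topPressure_mul hφ hinv
  set h := P - ∫ z, φ z ∂μ with hh
  have hs0 : 0 ≤ s := ge_of_tendsto' hs fun n => by
    have h1 : Real.log (μ.real (MarkovShift.cylinder (ℓ n) w)) ≤ 0 :=
      Real.log_nonpos measureReal_nonneg measureReal_le_one
    have h2 : (0 : ℝ) ≤ 1 / n := by positivity
    nlinarith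
  have hℓ' : ∃ C : ℝ, ∀ᶠ n : ℕ in atTop, (ℓ n : ℝ) / n ≤ C :=
    hℓ.elim (fun hG => MarkovShift.exists_linear_bound_of_gibbs hG hs) id
  set W := MarkovShift.targetSet (MarkovShift.cylinder N p) ℓ w
  let G : ℝ → ℝ := fun t => MarkovShift.topPressure fun z => t * φ z
  have hanti : Antitone fun t => G t - t * P := hU.pressure_sub_anti hφ
  have hcont : Continuous fun t => G t - t * P :=
    (MarkovShift.continuous_topPressure_mul hφ).sub (continuous_id.mul continuous_const)
  have hG1 : G 1 = P := by
    simp only [G, one_mul]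
    exact hU.topPressure_eq hφ
  have hG0 : 0 < G 0 := by
    obtain ⟨a, b, hab⟩ := MarkovShift.exists_ne_of_nullSingletonClass μ
    simpa only [G, zero_mul] using MarkovShift.topPressure_zero_pos hA hab
  have hlower : ∀ t, 0 < t → t ≤ 1 → 0 < G t - t * P - t * s →
      ENNReal.ofReal t ≤ MarkovShift.muDim μ W := by
    intro t ht0 ht1 ht
    obtain ⟨m, hm, hmix⟩ := hm t ht0 ht1
    have := hm.1.1
    have htφ : Continuous fun z => t * φ z := by fun_prop
    obtain ⟨P', hP'⟩ := hm.1.exists_isUniformGibbs htφ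
    have hP'G : G t = P' := hP'.topPressure_eq htφ
    rw [hP'G] at ht
    exact hU.le_muDim_targetSet hφ ht0 ht1 hP' hmix hs hs0 hℓ' ht N p
  have huniq : 0 < s → ∀ t t', G t - P * t = s * t → G t' - P * t' = s * t' → t ≤ t' := by
    intro hs t t' ht ht'
    by_contra! hlt
    have := hanti hlt.le
    simp only at this
    nlinarith
  -- When s = 0, Jensen's bound gives G(t) - Pt ≥ (1-t)h, which is positive for t < 1.
  have hone : s = 0 → 0 < h → ∀ t, t ≤ 1 → G t - P * t = s * t → t = 1 := by
    intro hs hpos t ht1 ht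
    have h1 : h + t * ∫ z, φ z ∂μ ≤ G t := hvar t
    have h2 : ∫ z, φ z ∂μ = P - h := by rw [hh]; ring
    rw [h2] at h1
    rw [hs] at ht
    nlinarith
  refine ⟨?_, fun _ => rfl, ?_⟩
  swap
  · intro herg v hv
    refine hU.ae_tendsto_log_cylinder hφ ?_ hv
    rcases herg with hmix | ⟨heq, huniq⟩
    · exact hmix.ergodic
    · exact hU.ergodic_of_unique hφ heq huniq
  have hex : ∃ T : ℝ, 0 < T ∧ T ≤ 1 ∧ G T - P * T = s * T ∧
      MarkovShift.muDim μ W = ENNReal.ofReal T := by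
    -- For s = 0 the roots may fill an interval ending at 1, so T is taken to be the dimension. If
    -- G(T) - PT were positive with T < 1, it would stay positive slightly to the right, and the
    -- lower bound would push the dimension above T.
    rcases hs0.eq_or_lt with hs0 | hspos
    · have hle := MarkovShift.muDim_le_one μ W
      have hfin : MarkovShift.muDim μ W ≠ ∞ := ne_top_of_le_ne_top ENNReal.one_ne_top hle
      set T := (MarkovShift.muDim μ W).toReal with hT
      have hlower' : ∀ t, 0 < t → t ≤ 1 → 0 < G t - t * P → t ≤ T := fun t ht0 ht1 ht =>
        (ENNReal.ofReal_le_iff_le_toReal hfin).1 (hlower t ht0 ht1 (by rwa [← hs0, mul_zero, sub_zero]))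
      have hT1 : T ≤ 1 := ENNReal.toReal_le_of_le_ofReal zero_le_one (by simpa using hle)
      have hnear : ∀ x, 0 ≤ x → x < 1 → 0 < G x - x * P → ∃ t, x < t ∧ t ≤ T := by
        intro x hx0 hx1 hx
        obtain ⟨t, ht, hxt, ht1⟩ := (((hcont.tendsto x).eventually_const_lt hx).filter_mono
          nhdsWithin_le_nhds |>.and (Ioo_mem_nhdsGT hx1)).exists
        exact ⟨t, hxt, hlower' t (hx0.trans_lt hxt) ht1.le ht⟩
      have hT0 : 0 < T := by
        obtain ⟨t, h1, h2⟩ := hnear 0 le_rfl one_pos (by simpa using hG0)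
        exact h1.trans_le h2
      have hroot1 := hanti hT1
      simp only [hG1] at hroot1
      have hroot2 : G T - T * P ≤ 0 := by
        by_contra! hpos
        rcases hT1.eq_or_lt with h1 | h1
        · rw [h1, hG1] at hpos
          linarith
        · obtain ⟨t, h2, h3⟩ := hnear T hT0.le h1 hpos
          linarith
      exact ⟨T, hT0, hT1, by rw [← hs0]; linarith, (ENNReal.ofReal_toReal hfin).symm⟩
    · have hFcont : Continuous fun t => G t - t * P - s * t := hcont.sub (continuous_const.mul continuous_id)
      obtain ⟨T, ⟨hT0, hT1⟩, hT⟩ := intermediate_value_Icc' zero_le_one hFcont.continuousOn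
        (show (0 : ℝ) ∈ Set.Icc _ _ by
          refine ⟨?_, ?_⟩
          · simp only [hG1]
            linarith
          · simp only [zero_mul, mul_zero, sub_zero]
            exact hG0.le)
      simp only at hT
      have hTpos : 0 < T := by
        refine hT0.lt_of_ne fun h0 => ?_
        rw [← h0] at hT
        simp only [zero_mul, mul_zero, sub_zero] at hT
        linarith
      refine ⟨T, hTpos, hT1, by linarith, le_antisymm ?_ ?_⟩
      · refine ENNReal.le_of_forall_pos_le_add fun η hη _ => ?_
        have hη' : (0 : ℝ) < η := hη
        have hα : ((T.toNNReal + η : ℝ≥0) : ℝ) = T + η := by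
          rw [NNReal.coe_add, Real.coe_toNNReal _ hT0]
        refine iInf₂_le_of_le (T.toNNReal + η) ?_ (by rw [ENNReal.coe_add]; rfl)
        rw [hα]
        refine hU.caratheodoryMass_targetSet_eq_zero hφ hs hℓ' (by positivity) ?_ _
        -- Past the root the term -s·η makes the exponent strictly negative, even where G(t) - Pt is
        -- flat.
        have h1 := hanti (show T ≤ T + η by linarith)
        have h2 : 0 < s * η := mul_pos hspos hη'
        simp only [G] at h1 hT
        linarith
      · refine ENNReal.ofReal_le_of_forall_lt fun t ht0 htT => ?_
        refine hlower t ht0 (htT.le.trans hT1) ?_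
        have h1 := hanti htT.le
        have h2 := mul_lt_mul_of_pos_left htT hspos
        simp only at h1
        linarith
  obtain ⟨T, hT0, hT1, hT, hdim⟩ := hex
  refine ⟨T, hT0, hT1, hT, fun hspos t ht => le_antisymm (huniq hspos t T ht hT)
    (huniq hspos T t hT ht), fun hpos t ht01 ht => ?_, hdim, fun _ => ⟨?_, le_rfl⟩⟩
  · rcases hs0.eq_or_lt with hs0 | hspos
    · rw [hone hs0.symm hpos t ht01.2 ht, hone hs0.symm hpos T hT1 hT]
    · exact le_antisymm (huniq hspos t T ht hT) (huniq hspos T t hT ht)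
  · have h1 : h + T * ∫ z, φ z ∂μ ≤ G T := hvar T
    have h2 : ∫ z, φ z ∂μ = P - h := by rw [hh]; ring
    rw [h2] at h1
    -- Jensen's bound at the root reads h ≤ T(h+s). The lemma also covers h + s = 0, where the
    -- quotient is 0.
    exact div_le_of_le_mul₀ (add_nonneg hh0 hs0) hT0.le (by linarith)
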